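/- **Setting.** Let $(C_n)_{n\ge 0}$, $(l_n)_{n\ge0}$, $(s_n)_{n\ge0}$ be sequences of positive integers with $l_n\ge 2$, $\sum_n 1/l_n<\infty$, $s_n^2\mid C_n$, and (R1) $s_n\mid s_{n+1}$ for all $n$, and $s_n\to\infty$. Put $p_0=0$, $q_0=1$, $k_n=2^{n+2}q_nC_n$, $q_{n+1}=k_nl_nq_n^2$, $p_{n+1}=p_nk_nl_nq_n+1$, $\alpha_n=p_n/q_n$. For $i\in\mathbb N$ let $j_i=j_i^{(n)}\in\{0,\dots,q_n-1\}$ satisfy $j_i\equiv p_n^{-1}i \pmod{q_n}$ (so $j_i=0$ if $n=0$). For $0\le i<2^{n+2}q_n$ let $a_n(i)$ be $0$ if $i<2^{n+1}q_n$ is even, $\frac{i+1}2 \bmod q_n$ if $i<2^{n+1}q_n$ is odd, $\frac i2+1 \bmod q_n$ if $i\ge 2^{n+1}q_n$ is even, and $1$ if $i\ge 2^{n+1}q_n$ is odd; put $\psi_n(i)=j_{a_n(i)}$. The twisting operator is $$\mathcal C_n^{\rm twist}(w_0,\dots,w_{k_n-1})=\prod_{m=0}^{q_n-1}\prod_{i=0}^{2^{n+2}q_n-1}\prod_{c=0}^{C_n-1}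 b^{\,q_n-r}\,(w_{iC_n+c})^{l_n-1}\,e^{\,r},\qquad r=(\psi_n(i)+j_m)\bmod q_n .$$ Let $M$ be $\mathbb T^2$, the annulus or the disk (more generally, a standard Borel probability space) with normalized area $\lambda$ and coordinates $(\theta,r)\in[0,1)^2$ that identify $(M,\lambda)$ modulo null sets with the unit square with Lebesgue measure. Put $R_t(\theta,r)=(\theta+t,r)$ and $\Delta_{N,S}^{i,t}=[\frac iN,\frac{i+1}N)\times[\frac tS,\frac{t+1}S)$. Let $h_{n+1}=h_{n+1,2}\circ h_{n+1,1}$, where both maps permute the atoms $\Delta^{i,t}_{k_nq_n,s_{n+1}}$ by translations: $h_{n+1,1}$ moves the column with index $i_1k_n+i_2C_n+i_3$ ($0\le i_1<q_n$, $0\le i_2<2^{n+2}q_n$, $0\le i_3<C_n$) to the column with index $((i_1+a_n(i_2))\bmod q_n)k_n+i_2C_n+i_3$, and $h_{n+1,2}$ leaves $[0,1/q_n)\times[0,1)$ invariant and commutes with $R_{1/q_n}$. For $0\le i<k_n$, $0\le t<s_{n+1}$ let $b_n(i,t)\in\{0,\dots,s_n-1\}$ be defined by $h_{n+1,2}(\Delta^{i,t}_{k_nq_n,s_{n+1}})\subseteq\Delta^{0,b_n(i,t)}_{q_n,s_n}$,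 and suppose (R2) for all $n$, $t<s_{n+1}$ and $u<s_n$, the symbol $u$ occurs exactly $k_n/s_n$ times in $(b_n(0,t),\dots,b_n(k_n-1,t))$; (R3) for all $n$ the map $t\mapsto(b_n(0,t),\dots,b_n(k_n-1,t))$ is one-to-one. Put $H_0=\mathrm{id}$, $H_{n+1}=H_n\circ h_{n+1}$, $T_n=H_n\circ R_{\alpha_n}\circ H_n^{-1}$, and let $T$ be an invertible measure-preserving transformation of $(M,\lambda)$ that is the limit of $(T_n)$ in the weak topology, that is, $\lambda(T_nA\,\Delta\,TA)\to0$ for all measurable $A$. **Names.** At stage $n+1$, a point of $H_{n+1}\big([\frac i{q_{n+1}},\frac{i+1}{q_{n+1}})\times[0,1)\big)$ is labelled $b$ (resp. $e$) if the letter in position $j^{(n+1)}_i$ (counted from $0$) of $\mathcal C_n^{\rm twist}(\omega,\dots,\omega)$, with $\omega$ any string of length $q_n$ without letters $b,e$, is $b$ (resp. $e$). Let $B$ (resp. $E$) be the set of points that are labelled at least once and only finitely often, and for the last time with $b$ (resp. $e$). Let $\mathcal Q$ be the partition into $B$, $E$ and $A_i=\big([0,1)\times[\frac i{s_0},\frac{i+1}{s_0})\big)\setminus(B\cup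 E)$, $i<s_0$, and let $\phi(x)\in(\Sigma\cup\{b,e\})^{\mathbb Z}$, $\Sigma=\{a_0,\dots,a_{s_0-1}\}$, be the $(T,\mathcal Q)$-name of $x$. **Words.** Let $u^{0}_t=a_t$ for $t<s_0$, and $u^{n+1}_t=\mathcal C_n^{\rm twist}(u^n_{b_n(0,t)},\dots,u^n_{b_n(k_n-1,t)})$ for $t<s_{n+1}$. Put $\mathcal W_n=\{u^n_t: t<s_n\}$, $P_{n+1}=\{(u^n_{b_n(0,t)},\dots,u^n_{b_n(k_n-1,t)}): t<s_{n+1}\}$, and let $\mathbb K$ be the set of all $x\in(\Sigma\cup\{b,e\})^{\mathbb Z}$ every finite contiguous substring of which occurs inside some word of some $\mathcal W_n$. A set $W$ of words is uniquely readable if $uv=pws$ with $u,v,w\in W$ implies that $p$ or $s$ is empty. **Proposition.** 1. $(\mathcal W_n)_{n}$ is a construction sequence: all words of $\mathcal W_n$ have length $q_n$, each $n$-word occurs in each $(n+1)$-word, and for some summable sequence of positive numbers $\varepsilon_n$ every $w'\in\mathcal W_{n+1}$ has exactly one parsing into $n$-words and spacers in which the spacers have total length less than $\varepsilon_{n+1}|w'|$.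 It is built from the pre-words $P_{n+1}\subseteq(\mathcal W_n)^{k_n}$ by the operators $\mathcal C_n^{\rm twist}$, and it is strongly uniform: for every $n$, every $n$-word occurs the same positive number of times in the parsing of every $(n+1)$-word. 2. $(\mathcal W_n)_n$ satisfies in addition the strong readability assumption (each $P_{n+1}$ is uniquely readable in the alphabet $\mathcal W_n$), and so is a twisted construction sequence, if and only if for each $n$ the set of sequences $(b_n(0,t),\dots,b_n(k_n-1,t))$, $t<s_{n+1}$, is uniquely readable. In that case the strong uniformity also holds when all occurrences as subwords are counted. 3. The words are the $\mathcal Q$-names of the towers: for almost every $x\in M$ and all sufficiently large $n$, if $x\in T_n^i H_n(\Delta^{0,t}_{q_n,s_n})$ with $0\le i<q_n$, $t<s_n$, then $\phi(x)$ restricted to $[-i,q_n-i)$ is $u^n_t$. 4. $\phi(x)\in\mathbb K$ for almost every $x$, and $\phi$ is one-to-one on a measurable set of $\lambda$-measure one. 5. There is exactly one non-atomic shift-invariant Borel probability measure $\nu$ on $\mathbb K$. It concentrates on the range of $\phi$, and $\phi$ is a measure-theoretic isomorphism from $(M,\lambda,T)$ to $(\mathbb K,\nu,\mathrm{sh})$.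 -/

import Mathlib

open MeasureTheory Filter Topology
open scoped symmDiff

/-! ### Words, construction sequences and symbolic shifts -/

/-- The alphabet `α ∪ {b, e}`. -/
inductive Letter (α : Type) : Type
  | sym (a : α) : Letter α
  | b : Letter α
  | e : Letter α
deriving DecidableEq

instance (α : Type) : MeasurableSpace (Letter α) := ⊤

/-- Unique readability: if `u v = p w t` with `u, v, w ∈ W`, then `p` or `t` is empty. -/
def UniquelyReadable {A : Type} (W : Set (List A)) : Prop :=
  ∀ u ∈ W, ∀ v ∈ W, ∀ w ∈ W, ∀ p t : List A, u ++ v = p ++ w ++ t → p = [] ∨ t = []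

/-- A way of cutting a string as `u₀ w₁ u₁ w₂ ⋯ w_r u_r`: the list of pairs `(u_{i-1}, w_i)` and
the last spacer `u_r`. -/
abbrev Parsing (A : Type) : Type := List (List A × List A) × List A

namespace Parsing

/-- The string that is cut. -/
def total {A : Type} (P : Parsing A) : List A := (P.1.map fun x => x.1 ++ x.2).flatten ++ P.2

/-- The words `w₁, …, w_r`. -/
def blocks {A : Type} (P : Parsing A) : List (List A) := P.1.map Prod.snd

/-- The total length of the spacers. -/
def spacerLength {A : Type} (P : Parsing A) : ℕ :=
  (P.1.map fun x => x.1.length).sum + P.2.length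

end Parsing

/-- `P` parses the `(n+1)`-word `w'` into `n`-words and spacers whose proportion in `w'` is
less than `δ`. -/
def IsParsing {A : Type} (Wn : Set (List A)) (δ : ℝ) (w' : List A) (P : Parsing A) : Prop :=
  P.total = w' ∧ (∀ w ∈ P.blocks, w ∈ Wn) ∧ (P.spacerLength : ℝ) / w'.length < δ

/-- `W` is a construction sequence with word lengths `h` and spacer proportions
bounded by `ε`. -/
structure IsConstructionSequence {A : Type} (W : ℕ → Set (List A)) (h : ℕ → ℕ) (ε : ℕ → ℝ) :
    Prop where
  length_eq : ∀ n, ∀ w ∈ W n, w.length = h n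
  occurs : ∀ n, ∀ w ∈ W n, ∀ w' ∈ W (n + 1), w <:+: w'
  eps_pos : ∀ n, 0 < ε n
  eps_summable : Summable ε
  parsing : ∀ n, ∀ w' ∈ W (n + 1), ∃! P : Parsing A, IsParsing (W n) (ε (n + 1)) w' P

/-- Strong uniformity, the occurrences of `n`-words in `(n+1)`-words being counted in the
parsing: every `n`-word occurs the same positive number of times in every `(n+1)`-word. -/
def IsStronglyUniformParsed {A : Type} [DecidableEq A] (W : ℕ → Set (List A)) (ε : ℕ → ℝ) :
    Prop :=
  ∀ n, ∃ c : ℕ, 0 < c ∧ ∀ w' ∈ W (n + 1), ∀ P : Parsing A, IsParsing (W n) (ε (n + 1)) w' P →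
    ∀ w ∈ W n, P.blocks.count w = c

/-- The number of all positions in `w'` at which `w` occurs as a subword. -/
noncomputable def subwordCount {A : Type} (w w' : List A) : ℕ :=
  {p : List A | ∃ t, w' = p ++ w ++ t}.ncard

/-- Strong uniformity, all occurrences as subwords being counted. -/
def IsStronglyUniform {A : Type} (W : ℕ → Set (List A)) : Prop :=
  ∀ n, ∃ c : ℕ, 0 < c ∧ ∀ w' ∈ W (n + 1), ∀ w ∈ W n, subwordCount w w' = c

/-- The symbolic shift of a sequence of collections of words: the bi-infinite sequences all of whose
finite contiguous substrings occur inside some word of the sequence. -/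
def symbolicShift {A : Type} (W : ℕ → Set (List A)) : Set (ℤ → A) :=
  {x | ∀ (a : ℤ) (N : ℕ), ∃ n, ∃ w ∈ W n, (List.ofFn fun i : Fin N => x (a + (i : ℕ))) <:+: w}

/-- The left shift. -/
def shiftMap (A : Type) (x : ℤ → A) : ℤ → A := fun i => x (i + 1)

/-! ### The twisting operator -/

/-- A pair of sequences of positive integers `C n`, `l n`. -/
structure TwistCoeff where
  C : ℕ → ℕ
  l : ℕ → ℕ
  C_pos : ∀ n, 0 < C n
  l_pos : ∀ n, 0 < l n

namespace TwistCoeff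

variable (c : TwistCoeff)

/-- `q 0 = 1` and `q (n+1) = k n * l n * (q n)^2`, where `k n = 2^(n+2) * q n * C n`. -/
def q : ℕ → ℕ
  | 0 => 1
  | n + 1 => (2 ^ (n + 2) * q n * c.C n) * c.l n * q n ^ 2

/-- `k n = 2^(n+2) * q n * C n`. -/
def k (n : ℕ) : ℕ := 2 ^ (n + 2) * c.q n * c.C n

/-- `p 0 = 0` and `p (n+1) = p n * k n * l n * q n + 1`. -/
def p : ℕ → ℕ
  | 0 => 0
  | n + 1 => p n * c.k n * c.l n * c.q n + 1

theorem q_pos (n : ℕ) : 0 < c.q n := by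
  induction n with
  | zero => exact Nat.one_pos
  | succ n ih =>
    have h1 := c.C_pos n
    have h2 := c.l_pos n
    unfold q
    positivity

theorem k_pos (n : ℕ) : 0 < c.k n := by
  have h1 := c.C_pos n
  have h2 := c.q_pos n
  unfold k
  positivity

instance (n : ℕ) : NeZero (c.q n) := ⟨(c.q_pos n).ne'⟩

instance (n : ℕ) : NeZero (c.k n) := ⟨(c.k_pos n).ne'⟩

/-- `α n = p n / q n`. -/
noncomputable def α (n : ℕ) : ℝ := (c.p n : ℝ) / (c.q n : ℝ)

/-- `j n i ∈ {0, …, q n - 1}` is congruent to `(p n)⁻¹ * i` modulo `q n`. -/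
def j (n i : ℕ) : ℕ := ((c.p n : ZMod (c.q n))⁻¹ * (i : ZMod (c.q n))).val

/-- The horizontal translation numbers of the twist map. -/
def a (n i : ℕ) : ℕ :=
  if i < 2 ^ (n + 1) * c.q n then
    if Even i then 0 else ((i + 1) / 2) % c.q n
  else
    if Even i then (i / 2 + 1) % c.q n else 1

/-- The spacer numbers of the twisting operator. -/
def ψ (n i : ℕ) : ℕ :=
  if i < 2 ^ (n + 1) * c.q n then
    if Even i then 0 else c.j n ((i + 1) / 2)
  else
    if Even i then c.j n (i / 2 + 1) else c.j n 1

/-- The twisting operator at level `n`, applied to the words `w 0, …, w (k n - 1)`. With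
`r = (ψ n i + j n m) mod q n`, the factor with indices `m, i, d` is
`b^(q n - r) (w (i * C n + d))^(l n - 1) e^r`. -/
def twist {α : Type} (n : ℕ) (w : ℕ → List (Letter α)) : List (Letter α) :=
  (List.range (c.q n)).flatMap fun m =>
    (List.range (2 ^ (n + 2) * c.q n)).flatMap fun i =>
      (List.range (c.C n)).flatMap fun d =>
        List.replicate (c.q n - (c.ψ n i + c.j n m) % c.q n) Letter.b ++
          (List.replicate (c.l n - 1) (w (i * c.C n + d))).flatten ++
          List.replicate ((c.ψ n i + c.j n m) % c.q n) Letter.e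

/-- `W` is built by the twisting operators from the sets of pre-words `P`, where `P n` is a set of
`k n`-tuples of words of `W n`. -/
structure IsBuiltFrom {α : Type} (W : ℕ → Set (List (Letter α)))
    (P : ℕ → Set (List (List (Letter α)))) : Prop where
  zero : W 0 = Set.range fun x : α => [Letter.sym x]
  tuples : ∀ n, ∀ t ∈ P n, t.length = c.k n ∧ ∀ w ∈ t, w ∈ W n
  succ : ∀ n, W (n + 1) = (fun t : List (List (Letter α)) => c.twist n fun i => t.getD i []) '' P n

/-- A twisted construction sequence with the coefficients `c`, including the strong readability
assumption that the sets of pre-words are uniquely readable in the alphabet of `n`-words. -/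
def IsTwisted {α : Type} (W : ℕ → Set (List (Letter α))) : Prop :=
  (Summable fun n => 1 / (c.l n : ℝ)) ∧
    (∃ ε : ℕ → ℝ, IsConstructionSequence W c.q ε) ∧
    ∃ P : ℕ → Set (List (List (Letter α))), c.IsBuiltFrom W P ∧ ∀ n, UniquelyReadable (P n)

end TwistCoeff

/-! ### The coordinate square -/

/-- The interval `[0, 1)`. -/
abbrev I01 : Type := Set.Ico (0 : ℝ) 1

/-- The square `[0, 1) × [0, 1)` of coordinates `(θ, r)`. -/
abbrev Sq : Type := I01 × I01

/-- Lebesgue measure on the square. -/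
noncomputable def lebSq : Measure Sq :=
  ((volume : Measure ℝ).comap Subtype.val).prod ((volume : Measure ℝ).comap Subtype.val)

/-- The partition of `[0, 1)` into `N` intervals `[i/N, (i+1)/N)`, as a bijection: `x = (i + u) / N`
corresponds to the pair of the index `i` of its interval and the relative position `u ∈ [0, 1)`. -/
noncomputable def cell (N : ℕ) [NeZero N] : I01 ≃ Fin N × I01 where
  toFun x :=
    (⟨⌊(N : ℝ) * (x : ℝ)⌋₊, by
      have hN : (0 : ℝ) < N := Nat.cast_pos.mpr (NeZero.pos N)
      rw [Nat.floor_lt (mul_nonneg hN.le x.2.1)]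
      nlinarith [x.2.2]⟩,
     ⟨Int.fract ((N : ℝ) * (x : ℝ)), Int.fract_nonneg _, Int.fract_lt_one _⟩)
  invFun y :=
    ⟨((y.1 : ℕ) + (y.2 : ℝ)) / N, by
      have hN : (0 : ℝ) < N := Nat.cast_pos.mpr (NeZero.pos N)
      have h0 := y.2.2.1
      have h1 : (((y.1 : ℕ) : ℝ)) + 1 ≤ N := by exact_mod_cast y.1.2
      constructor
      · positivity
      · rw [div_lt_one hN]
        linarith [y.2.2.2]⟩
  left_inv x := by
    have hN : (0 : ℝ) < N := Nat.cast_pos.mpr (NeZero.pos N)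
    have h0 : 0 ≤ (N : ℝ) * (x : ℝ) := mul_nonneg hN.le x.2.1
    apply Subtype.ext
    simp only
    rw [natCast_floor_eq_intCast_floor h0, Int.floor_add_fract]
    field_simp
  right_inv y := by
    have hN : (0 : ℝ) < N := Nat.cast_pos.mpr (NeZero.pos N)
    have e : (N : ℝ) * (((y.1 : ℕ) + (y.2 : ℝ)) / N) = (y.1 : ℕ) + (y.2 : ℝ) := by field_simp
    refine Prod.ext (Fin.ext ?_) (Subtype.ext ?_)
    · simp only [e]
      rw [add_comm, Nat.floor_add_natCast y.2.2.1, Nat.floor_eq_zero.mpr y.2.2.2, zero_add]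
    · simp only [e]
      rw [Int.fract_natCast_add, Int.fract_eq_self.mpr y.2.2]

/-- The rotation `x ↦ x + t mod 1` of `[0, 1)`. -/
noncomputable def rot (t : ℝ) : I01 ≃ I01 where
  toFun x := ⟨Int.fract ((x : ℝ) + t), Int.fract_nonneg _, Int.fract_lt_one _⟩
  invFun x := ⟨Int.fract ((x : ℝ) - t), Int.fract_nonneg _, Int.fract_lt_one _⟩
  left_inv x := by
    apply Subtype.ext
    simp only
    have e : Int.fract ((x : ℝ) + t) - t = (x : ℝ) - (⌊(x : ℝ) + t⌋ : ℤ) := by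
      rw [Int.fract]; ring
    rw [e, Int.fract_sub_intCast, Int.fract_eq_self.mpr x.2]
  right_inv x := by
    apply Subtype.ext
    simp only
    have e : Int.fract ((x : ℝ) - t) + t = (x : ℝ) - (⌊(x : ℝ) - t⌋ : ℤ) := by
      rw [Int.fract]; ring
    rw [e, Int.fract_sub_intCast, Int.fract_eq_self.mpr x.2]

/-- The circle action `(θ, r) ↦ (θ + t, r)`. -/
noncomputable def rotSq (t : ℝ) : Equiv.Perm Sq := Equiv.prodCongr (rot t) (Equiv.refl I01)

/-! ### The approximation-by-conjugation construction -/

/-- The data of the construction: the coefficients `C n`, `l n`, the numbers `s n` of horizontal rows,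
and for every `n` a permutation of the atoms with column index `< k n` and row index
`< s (n+1)` of the fundamental domain `[0, 1/q n) × [0, 1)`. -/
structure AbC extends TwistCoeff where
  s : ℕ → ℕ
  s_pos : ∀ n, 0 < s n
  σ : ∀ n, Equiv.Perm (Fin (toTwistCoeff.k n) × Fin (s (n + 1)))

namespace AbC

variable (d : AbC)

instance (n : ℕ) : NeZero (d.s n) := ⟨(d.s_pos n).ne'⟩

/-- Coordinates adapted to the partition into the `q n * k n * s (n+1)` atoms
`[i/(q n * k n), (i+1)/(q n * k n)) × [t/s (n+1), (t+1)/s (n+1))` with `i = i₁ * k n + i₂`: the index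
`i₁` of the fundamental domain, the column `i₂` in it and the relative horizontal position, then the
row `t` and the relative vertical position. -/
noncomputable def grid (n : ℕ) :
    Sq ≃ (Fin (d.q n) × Fin (d.k n) × I01) × (Fin (d.s (n + 1)) × I01) :=
  Equiv.prodCongr
    ((cell (d.q n)).trans (Equiv.prodCongr (Equiv.refl _) (cell (d.k n))))
    (cell (d.s (n + 1)))

/-- The twist map `h_{n+1,1}` in adapted coordinates: the column with index `i₂ * C n + i₃` of the
`i₁`-th fundamental domain is translated to the fundamental domain `i₁ + a n i₂ mod q n`. -/
def twistPerm (n : ℕ) :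
    Equiv.Perm ((Fin (d.q n) × Fin (d.k n) × I01) × (Fin (d.s (n + 1)) × I01)) where
  toFun z := ((z.1.1 + Fin.ofNat (d.q n) (d.a n ((z.1.2.1 : ℕ) / d.C n)), z.1.2), z.2)
  invFun z := ((z.1.1 - Fin.ofNat (d.q n) (d.a n ((z.1.2.1 : ℕ) / d.C n)), z.1.2), z.2)
  left_inv z := by simp
  right_inv z := by simp

/-- The map `h_{n+1,2}` in adapted coordinates: the permutation `σ n` of the atoms
of each fundamental domain, the same in all of them. -/
def rowPerm (n : ℕ) :
    Equiv.Perm ((Fin (d.q n) × Fin (d.k n) × I01) × (Fin (d.s (n + 1)) × I01)) where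
  toFun z :=
    ((z.1.1, (d.σ n (z.1.2.1, z.2.1)).1, z.1.2.2), ((d.σ n (z.1.2.1, z.2.1)).2, z.2.2))
  invFun z :=
    ((z.1.1, ((d.σ n).symm (z.1.2.1, z.2.1)).1, z.1.2.2),
      (((d.σ n).symm (z.1.2.1, z.2.1)).2, z.2.2))
  left_inv z := by simp
  right_inv z := by simp

/-- The conjugation map `h_{n+1} = h_{n+1,2} ∘ h_{n+1,1}`; every atom is moved by a translation. -/
noncomputable def h (n : ℕ) : Equiv.Perm Sq :=
  ((d.grid n).trans ((d.twistPerm n).trans (d.rowPerm n))).trans (d.grid n).symm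

/-- `H 0 = id` and `H (n+1) = H n ∘ h_{n+1}`. -/
noncomputable def H : ℕ → Equiv.Perm Sq
  | 0 => Equiv.refl Sq
  | n + 1 => (d.h n).trans (H n)

/-- `T_n = H n ∘ R_{α n} ∘ (H n)⁻¹`. -/
noncomputable def T (n : ℕ) : Equiv.Perm Sq :=
  ((d.H n).symm.trans (rotSq (d.α n))).trans (d.H n)

/-- The row of height `1 / s n` that contains the image under `h_{n+1,2}` of the atom of the first
fundamental domain with column index `i` and row index `t` (when `s n ∣ s (n+1)`). -/
def row (n : ℕ) (i : Fin (d.k n)) (t : Fin (d.s (n + 1))) : Fin (d.s n) :=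
  ⟨((d.σ n (i, t)).2 : ℕ) * d.s n / d.s (n + 1), by
    rw [Nat.div_lt_iff_lt_mul (d.s_pos (n + 1)), mul_comm]
    exact Nat.mul_lt_mul_of_pos_left (d.σ n (i, t)).2.2 (d.s_pos n)⟩

/-- The sequences `(row n 0 t, …, row n (k n - 1) t)`. -/
def rowWords (n : ℕ) : Set (List (Fin (d.s n))) :=
  Set.range fun t : Fin (d.s (n + 1)) => List.ofFn fun i => d.row n i t

/-- The rows: `s n` divides `s (n+1)`, and `s n → ∞`. -/
def R1 : Prop := (∀ n, d.s n ∣ d.s (n + 1)) ∧ Tendsto d.s atTop atTop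

/-- Every symbol `u < s n` occurs exactly `k n / s n` times in every row sequence. -/
def R2 : Prop :=
  ∀ n (t : Fin (d.s (n + 1))) (u : Fin (d.s n)),
    (Finset.univ.filter fun i => d.row n i t = u).card = d.k n / d.s n

/-- Different rows have different row sequences. -/
def R3 : Prop := ∀ n, Function.Injective fun (t : Fin (d.s (n + 1))) (i : Fin (d.k n)) => d.row n i t

/-! ### Towers, their words, and the partition -/

/-- The word of the `t`-th tower of the `n`-th periodic process. -/
def word : ∀ n, Fin (d.s n) → List (Letter (Fin (d.s 0)))
  | 0, t => [Letter.sym t]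
  | n + 1, t => d.twist n fun i => if hi : i < d.k n then word n (d.row n ⟨i, hi⟩ t) else []

/-- The collection of words of stage `n`. -/
def words (n : ℕ) : Set (List (Letter (Fin (d.s 0)))) := Set.range (d.word n)

/-- The pre-words of stage `n+1`. -/
def preWords (n : ℕ) : Set (List (List (Letter (Fin (d.s 0))))) :=
  Set.range fun t : Fin (d.s (n + 1)) => List.ofFn fun i => d.word n (d.row n i t)

/-- The base `H n ([0, 1/q n) × [t/s n, (t+1)/s n))` of the `t`-th tower. -/
def towerBase (n : ℕ) (t : Fin (d.s n)) : Set Sq :=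
  d.H n '' {z | (cell (d.q n) z.1).1 = 0 ∧ (cell (d.s n) z.2).1 = t}

/-- The symbolic coding at stage `n+1` of the orbit of `[0, 1/q (n+1))`, the letters that are not
spacers being identified. -/
def spacerPattern (n : ℕ) : List (Letter Unit) :=
  d.twist n fun _ => List.replicate (d.q n) (Letter.sym ())

/-- The label that stage `n+1` gives to the points over the interval `[i/q (n+1), (i+1)/q (n+1))`,
which is the `j (n+1) i`-th one in the dynamical ordering. -/
noncomputable def stageLabel (n : ℕ) (z : Sq) : Option (Letter Unit) :=
  (d.spacerPattern n)[d.j (n + 1) (cell (d.q (n + 1)) z.1).1]?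

/-- The set of points that stage `n+1` labels with `b`. -/
def newB (n : ℕ) : Set Sq := d.H (n + 1) '' {z | d.stageLabel n z = some Letter.b}

/-- The set of points that stage `n+1` labels with `e`. -/
def newE (n : ℕ) : Set Sq := d.H (n + 1) '' {z | d.stageLabel n z = some Letter.e}

/-- The points that are labelled with `b` or `e` at some stage, but only finitely often, and for the
last time with `b`. -/
def setB : Set Sq := {z | ∃ n, z ∈ d.newB n ∧ ∀ m, n < m → z ∉ d.newB m ∪ d.newE m}

/-- The points that are labelled with `b` or `e` at some stage, but only finitely often, and for the
last time with `e`. -/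
def setE : Set Sq := {z | ∃ n, z ∈ d.newE n ∧ ∀ m, n < m → z ∉ d.newB m ∪ d.newE m}

open Classical in
/-- The partition `{A_i : i < s 0} ∪ {B, E}` of the square, where
`A_i = [0, 1) × [i/s 0, (i+1)/s 0) \ (B ∪ E)`, given by the letter of the atom of a point. -/
noncomputable def partitionLabel (z : Sq) : Letter (Fin (d.s 0)) :=
  if z ∈ d.setB then Letter.b
  else if z ∈ d.setE then Letter.e
  else Letter.sym (cell (d.s 0) z.2).1

/-- The name of a point `x` of a space `M` with coordinates `κ : M → Sq` under `S : M → M`. -/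
noncomputable def name {M : Type*} (κ : M → Sq) (S : Equiv.Perm M) (x : M) :
    ℤ → Letter (Fin (d.s 0)) :=
  fun i => d.partitionLabel (κ ((S ^ i) x))

end AbC

/-! ### Measure-theoretic notions -/

/-- Coordinates `κ = (θ, r)` on a probability space `(M, μ)`: an isomorphism modulo null sets with the
unit square. The torus, the annulus and the disk (with normalized area `μ`, and
`r` the square of the radius for the disk) have such coordinates. -/
structure IsCoordinates {M : Type*} [MeasurableSpace M] (μ : Measure M) (κ : M → Sq) : Prop where
  measurePreserving : MeasurePreserving κ μ lebSq
  injOn : ∃ M₀ : Set M, MeasurableSet M₀ ∧ μ M₀ᶜ = 0 ∧ Set.InjOn κ M₀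

/-- The transformations `S n`, written in the coordinates `κ`, converge to `T` in the weak topology:
`μ (T A ∆ S n A) → 0` for every measurable set `A`. -/
def IsWeakLimit {M : Type*} [MeasurableSpace M] (μ : Measure M) (κ : M → Sq)
    (S : ℕ → Equiv.Perm Sq) (T : M → M) : Prop :=
  ∀ A : Set Sq, MeasurableSet A →
    Tendsto (fun n => μ ((T '' (κ ⁻¹' A)) ∆ (κ ⁻¹' (S n '' A)))) atTop (𝓝 0)

/-- `f` is a measure-theoretic isomorphism from `(X, μ, T)` to `(Y, ν, S)`. -/
def IsSystemIsomorphism {X Y : Type*} [MeasurableSpace X] [MeasurableSpace Y]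
    (f : X → Y) (μ : Measure X) (T : X → X) (ν : Measure Y) (S : Y → Y) : Prop :=
  ∃ (X₀ : Set X) (Y₀ : Set Y), MeasurableSet X₀ ∧ MeasurableSet Y₀ ∧ μ X₀ᶜ = 0 ∧ ν Y₀ᶜ = 0 ∧
    (∀ x ∈ X₀, T x ∈ X₀ ∧ f (T x) = S (f x)) ∧
    ∃ g : X₀ ≃ᵐ Y₀, (∀ x : X₀, (g x : Y) = f x) ∧
      MeasurePreserving g (μ.comap Subtype.val) (ν.comap Subtype.val)

/-- `ν` is a non-atomic shift-invariant Borel probability measure on the set `K` of bi-infinite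
sequences. -/
structure IsNonatomicInvariant {A : Type} [MeasurableSpace A] (K : Set (ℤ → A))
    (ν : Measure (ℤ → A)) : Prop where
  prob : IsProbabilityMeasure ν
  concentrated : ν Kᶜ = 0
  noAtoms : ∀ x, ν {x} = 0
  invariant : MeasurePreserving (shiftMap A) ν ν

/-! ### Concatenations of strings of equal length -/

/-! The proof rests on one dictionary between geometry and words. A word of stage n + 1 is a
concatenation of q n * k n factors of length l n * q n; factor y is b^(q n - r) u^(l n - 1) e^r with
r = `offset n y` and u the n-word of the row symbol of column y mod k n. The level of a point in the
towers of stage n + 1 is a position y * (l n * q n) + o in this concatenation, and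
`level_tower_succ` shows that its level at stage n is then (o + r) mod q n and its tower the row
symbol of that column. The reason is that α (n+1) exceeds α n by 1 / q (n+1), so an orbit stays l n
* q n steps in the same column modulo 1 / q n, and that the translation number a n i of a column
becomes the spacer number ψ n i after division by p n.

Hence the letters of stages n and n + 1 agree at unlabelled points (`stageLetter_succ`), and a point
that is not labelled after stage n carries the letter of its n-word (`partitionLabel_eq`). Points
labelled at a stage have measure at most 1 / l n. The limit T moves the levels of stage n as T_n
does, except on a set of measure at most the sum of 1 / (l i * q i) over i ≥ n
(`measure_jumpSet_le`), which is summable in n even after multiplication by q n. By Borel–Cantelli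
almost every point is `Good` from some stage on (`ae_good`), and the name of a good point spells the
words of its towers (`Good.name_eq`).

Recognition of words uses runs of b. An n-word begins with exactly `lead n` = q 0 + ⋯ + q (n-1)
letters b, ends with a letter that is not a spacer, and contains no `lead n` + 1 consecutive b's
(`letter_lead`, `exists_letter_ne_b`). A copy preceded by b therefore marks the beginning of a run
of copies. This confines occurrences of n-words to runs (`occurrence_in_run`), reduces unique
readability of words to that of row sequences, and makes position and tower readable from the name
(`inRun_unique`); as q n and s n tend to infinity, the name determines the point. Without unique
readability an n-word may still occur displaced inside a run, so the uniqueness of the parsing is a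
counting argument: the bound `eps` forces as many blocks as there are copies, which leaves no room
for displacement (`Parsing.starts_eq`).

For uniqueness of the measure, a sequence of the symbolic shift that is outside the runs of
infinitely many stages is e, e, e, … to the right of 0 or eventually b. An invariant measure without
atoms gives such sequences measure zero, so runs fill the space in the limit. Inside runs all
positions are equally likely, and by R2 all words of stage n + 1 have nearly the same number of
occurrences of a given pattern, so the measure of a pattern is forced. The image of μ under the name
map is such a measure, and injectivity on standard Borel spaces gives the isomorphism. -/

theorem List.flatMap_range_mul {α : Type*} (a b : ℕ) (f : ℕ → List α) :
    (List.range (a * b)).flatMap f =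
      (List.range a).flatMap fun i => (List.range b).flatMap fun j => f (i * b + j) := by
  induction a with
  | zero => simp
  | succ a ih =>
    rw [Nat.succ_mul, List.range_add, List.flatMap_append, ih, List.range_succ, List.flatMap_append]
    simp [List.flatMap_map]

theorem List.length_flatMap_range {α : Type*} {L : ℕ} (N : ℕ) (f : ℕ → List α)
    (hf : ∀ y < N, (f y).length = L) : ((List.range N).flatMap f).length = N * L := by
  induction N with
  | zero => simp
  | succ N ih =>
    rw [List.range_succ, List.flatMap_append, List.length_append,
      ih fun y hy => hf y (by omega)]
    simp [hf N (by omega), Nat.succ_mul]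

theorem List.getElem?_flatMap_range {α : Type*} {L : ℕ} (N : ℕ) (f : ℕ → List α)
    (hf : ∀ y < N, (f y).length = L) {y o : ℕ} (hy : y < N) (ho : o < L) :
    ((List.range N).flatMap f)[y * L + o]? = (f y)[o]? := by
  induction N with
  | zero => omega
  | succ N ih =>
    have hlen := List.length_flatMap_range N f fun y hy => hf y (by omega)
    rw [List.range_succ, List.flatMap_append]
    rcases Nat.lt_succ_iff_lt_or_eq.mp hy with h | h
    · have : (y + 1) * L ≤ N * L := Nat.mul_le_mul_right _ h
      rw [List.getElem?_append_left (by rw [hlen]; rw [Nat.succ_mul] at this; omega)]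
      exact ih (fun y hy => hf y (by omega)) h
    · subst h
      rw [List.getElem?_append_right (by omega), hlen]
      simp

theorem List.getElem?_flatten_replicate {α : Type*} {w : List α} {c o : ℕ}
    (ho : o < c * w.length) : (List.replicate c w).flatten[o]? = w[o % w.length]? := by
  have hpos : 0 < w.length := Nat.pos_of_ne_zero fun h => by simp [h] at ho
  have e : (List.replicate c w).flatten = (List.range c).flatMap fun _ => w := by
    rw [List.flatMap_def]; simp [List.map_const']
  rw [e]
  conv_lhs => rw [← Nat.div_add_mod' o w.length]
  exact List.getElem?_flatMap_range c _ (fun _ _ => rfl)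
    ((Nat.div_lt_iff_lt_mul hpos).mpr ho) (Nat.mod_lt _ hpos)

/-! ### The factors of the twisting operator -/

namespace TwistCoeff

variable (c : TwistCoeff)

theorem q_succ (n : ℕ) : c.q (n + 1) = c.q n * c.k n * (c.l n * c.q n) := by
  show c.k n * c.l n * c.q n ^ 2 = _
  ring

theorem q_dvd_q_succ (n : ℕ) : c.q n ∣ c.q (n + 1) :=
  ⟨c.k n * (c.l n * c.q n), by rw [q_succ]; ring⟩

theorem lq_pos (n : ℕ) : 0 < c.l n * c.q n := Nat.mul_pos (c.l_pos n) (c.q_pos n)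

/-- `p (n + 1)` is 1 modulo k n * l n * q n, and this number has the same prime factors as `q (n +
1)`. -/
theorem coprime_p_q (n : ℕ) : Nat.Coprime (c.p n) (c.q n) := by
  cases n with
  | zero => exact Nat.coprime_one_right _
  | succ n =>
    have h1 : Nat.Coprime (c.p (n + 1)) (c.k n * c.l n * c.q n) := by
      have e : c.p (n + 1) = 1 + c.k n * c.l n * c.q n * c.p n := by
        show c.p n * c.k n * c.l n * c.q n + 1 = _
        ring
      rw [e]
      simp
    have e : c.q (n + 1) = c.k n * c.l n * c.q n * c.q n := by rw [q_succ]; ring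
    rw [e]
    exact Nat.Coprime.mul_right h1 (Nat.Coprime.coprime_dvd_right ⟨_, mul_comm _ _⟩ h1)

theorem j_lt (n i : ℕ) : c.j n i < c.q n := ZMod.val_lt _

theorem j_zero (n : ℕ) : c.j n 0 = 0 := by simp [j]

theorem p_mul_inv (n : ℕ) : (c.p n : ZMod (c.q n)) * (c.p n : ZMod (c.q n))⁻¹ = 1 :=
  ZMod.coe_mul_inv_eq_one _ (c.coprime_p_q n)

theorem j_cast (n i : ℕ) : (c.j n i : ZMod (c.q n)) = (c.p n : ZMod (c.q n))⁻¹ * i := by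
  simp [j]

theorem eq_of_cast_eq {n a b : ℕ} (ha : a < c.q n) (hb : b < c.q n)
    (h : (a : ZMod (c.q n)) = b) : a = b := by
  rw [ZMod.natCast_eq_natCast_iff] at h
  rwa [Nat.ModEq, Nat.mod_eq_of_lt ha, Nat.mod_eq_of_lt hb] at h

theorem j_mod (n i : ℕ) : c.j n (i % c.q n) = c.j n i := by
  simp [j]

theorem j_injOn {n a b : ℕ} (ha : a < c.q n) (hb : b < c.q n) (h : c.j n a = c.j n b) : a = b := by
  apply c.eq_of_cast_eq ha hb
  have h2 : (c.j n a : ZMod (c.q n)) = c.j n b := by rw [h]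
  rw [j_cast, j_cast] at h2
  calc (a : ZMod (c.q n)) = c.p n * ((c.p n : ZMod (c.q n))⁻¹ * a) := by
        rw [← mul_assoc, p_mul_inv, one_mul]
    _ = b := by rw [h2, ← mul_assoc, p_mul_inv, one_mul]

/-- The link between the operator and the map: a horizontal translation by a n i fundamental domains
is a shift of the level by its quotient by p n modulo q n. -/
theorem ψ_eq (n i : ℕ) : c.ψ n i = c.j n (c.a n i) := by
  unfold ψ a
  split_ifs <;> simp [j_mod, j_zero]

/-- The number of letters `e` in the factor with index `y` of the twisting operator. -/
def offset (n y : ℕ) : ℕ := (c.ψ n (y % c.k n / c.C n) + c.j n (y / c.k n)) % c.q n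

theorem offset_lt (n y : ℕ) : c.offset n y < c.q n := Nat.mod_lt _ (c.q_pos n)

/-- The first column of each of the q n periods is not twisted, so only the index m of the period
remains. These values tell the periods apart in the proof of unique readability. -/
theorem offset_mul_k (n m : ℕ) : c.offset n (m * c.k n) = c.j n m := by
  have h : c.ψ n 0 = 0 := by
    have : 0 < 2 ^ (n + 1) * c.q n := Nat.mul_pos (by positivity) (c.q_pos n)
    simp [ψ, this]
  rw [offset, Nat.mul_mod_left, Nat.zero_div, h, zero_add, Nat.mul_div_cancel _ (c.k_pos n),
    Nat.mod_eq_of_lt (c.j_lt n m)]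

theorem offset_zero (n : ℕ) : c.offset n 0 = 0 := by
  have := c.offset_mul_k n 0
  rwa [zero_mul, j_zero] at this

/-- The last column has translation number 1, and 1 + (q n - 1) vanishes modulo q n. Hence a word
ends with a copy and not with letters e. -/
theorem offset_last (n : ℕ) : c.offset n (c.q n * c.k n - 1) = 0 := by
  have hk := c.k_pos n
  have hq := c.q_pos n
  have hC := c.C_pos n
  have e : c.q n * c.k n - 1 = (c.k n - 1) + c.k n * (c.q n - 1) := by
    obtain ⟨a, ha⟩ : ∃ a, c.q n = a + 1 := ⟨c.q n - 1, by omega⟩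
    rw [ha, Nat.add_sub_cancel, Nat.succ_mul, mul_comm]
    omega
  have hx : (c.k n - 1) / c.C n = 2 ^ (n + 2) * c.q n - 1 := by
    have hk2 : c.k n = 2 ^ (n + 2) * c.q n * c.C n := rfl
    have hpos : 0 < 2 ^ (n + 2) * c.q n := Nat.mul_pos (by positivity) hq
    obtain ⟨a, ha⟩ : ∃ a, 2 ^ (n + 2) * c.q n = a + 1 := ⟨_, (Nat.succ_pred_eq_of_pos hpos).symm⟩
    rw [hk2, ha, Nat.add_sub_cancel, Nat.succ_mul]
    have : a * c.C n + c.C n - 1 = (c.C n - 1) + a * c.C n := by omega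
    rw [this, Nat.add_mul_div_right _ _ hC, Nat.div_eq_of_lt (by omega), zero_add]
  have hψ : c.ψ n (2 ^ (n + 2) * c.q n - 1) = c.j n 1 := by
    have h1 : 0 < 2 ^ (n + 1) * c.q n := Nat.mul_pos (by positivity) hq
    have h2 : 2 ^ (n + 2) * c.q n = 2 * (2 ^ (n + 1) * c.q n) := by ring
    have h3 : ¬ (2 ^ (n + 2) * c.q n - 1 < 2 ^ (n + 1) * c.q n) := by omega
    have h4 : ¬ Even (2 ^ (n + 2) * c.q n - 1) := by
      rw [Nat.not_even_iff_odd]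
      exact ⟨2 ^ (n + 1) * c.q n - 1, by omega⟩
    simp [ψ, h3, h4]
  rw [offset, e, Nat.add_mul_mod_self_left, Nat.mod_eq_of_lt (by omega : c.k n - 1 < c.k n), hx, hψ,
    Nat.add_mul_div_left _ _ hk, Nat.div_eq_of_lt (by omega), zero_add]
  have hz : ((c.j n 1 + c.j n (c.q n - 1) : ℕ) : ZMod (c.q n)) = 0 := by
    push_cast [j_cast]
    rw [← mul_add, Nat.cast_sub hq]
    simp
  exact Nat.mod_eq_zero_of_dvd ((ZMod.natCast_eq_zero_iff _ _).mp hz)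

/-- The factor with index `y` of the twisting operator. -/
def factor {α : Type} (n : ℕ) (w : ℕ → List (Letter α)) (y : ℕ) : List (Letter α) :=
  List.replicate (c.q n - c.offset n y) Letter.b ++
    (List.replicate (c.l n - 1) (w (y % c.k n))).flatten ++ List.replicate (c.offset n y) Letter.e

/-- The triple m, i, d is merged into the single index m * k n + (i * C n + d), which makes all
factors and all positions in the word accessible by division with remainder. -/
theorem twist_eq_flatMap {α : Type} (n : ℕ) (w : ℕ → List (Letter α)) :
    c.twist n w = (List.range (c.q n * c.k n)).flatMap (c.factor n w) := by
  have hC := c.C_pos n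
  rw [List.flatMap_range_mul]
  unfold twist
  refine List.flatMap_congr fun m hm => ?_
  conv_rhs => rw [k, List.flatMap_range_mul]
  refine List.flatMap_congr fun i hi => List.flatMap_congr fun d hd => ?_
  rw [List.mem_range] at hm hi hd
  have hlt : i * c.C n + d < c.k n := by
    have : (i + 1) * c.C n ≤ 2 ^ (n + 2) * c.q n * c.C n := Nat.mul_le_mul_right _ hi
    rw [Nat.succ_mul] at this
    show _ < 2 ^ (n + 2) * c.q n * c.C n
    omega
  have e : m * (2 ^ (n + 2) * c.q n * c.C n) + (i * c.C n + d) =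
      (i * c.C n + d) + c.k n * m := by
    rw [k]; ring
  rw [factor, offset, e, Nat.add_mul_mod_self_left, Nat.mod_eq_of_lt hlt,
    Nat.add_mul_div_left _ _ (c.k_pos n), Nat.div_eq_of_lt hlt, zero_add,
    mul_comm i, Nat.mul_add_div hC, Nat.div_eq_of_lt hd, add_zero]

theorem length_factor {α : Type} {n : ℕ} {w : ℕ → List (Letter α)} {y : ℕ}
    (hw : (w (y % c.k n)).length = c.q n) : (c.factor n w y).length = c.l n * c.q n := by
  have h1 := c.offset_lt n y
  have h2 := c.l_pos n
  obtain ⟨a, ha⟩ : ∃ a, c.l n = a + 1 := ⟨c.l n - 1, by omega⟩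
  simp only [factor, List.length_append, List.length_replicate, List.length_flatten,
    List.map_replicate, List.sum_replicate, hw, smul_eq_mul, ha, Nat.add_sub_cancel]
  rw [Nat.succ_mul]
  omega

/-- With r letters missing from a full block of b's, the place inside a copy is o + r modulo q n.
This is the same shift that relates the levels of two consecutive stages. -/
theorem getElem?_factor {α : Type} {n : ℕ} {w : ℕ → List (Letter α)} {y o : ℕ}
    (hw : (w (y % c.k n)).length = c.q n) (ho : o < c.l n * c.q n) :
    (c.factor n w y)[o]? = if o < c.q n - c.offset n y then some Letter.b
      else if o < c.l n * c.q n - c.offset n y then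
        (w (y % c.k n))[(o + c.offset n y) % c.q n]?
      else some Letter.e := by
  have h1 := c.offset_lt n y
  have h2 := c.l_pos n
  obtain ⟨a, ha⟩ : ∃ a, c.l n = a + 1 := ⟨c.l n - 1, by omega⟩
  have hlen : (List.replicate (c.l n - 1) (w (y % c.k n))).flatten.length =
      (c.l n - 1) * c.q n := by
    simp [hw]
  have hal : c.l n * c.q n = (c.l n - 1) * c.q n + c.q n := by
    rw [ha, Nat.add_sub_cancel, Nat.succ_mul]
  rw [factor, List.append_assoc]
  split_ifs with h3 h4
  · rw [List.getElem?_append_left (by simpa using h3)]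
    simp [h3]
  · rw [List.getElem?_append_right (by simpa using h3),
      List.getElem?_append_left (by rw [hlen]; simp; omega), List.length_replicate,
      List.getElem?_flatten_replicate (by rw [hw]; omega), hw]
    congr 1
    have e : o + c.offset n y = (o - (c.q n - c.offset n y)) + c.q n := by omega
    rw [e, Nat.add_mod_right]
  · rw [List.getElem?_append_right (by simpa using h3),
      List.getElem?_append_right (by rw [hlen]; simp; omega), hlen, List.length_replicate,
      List.getElem?_replicate]
    rw [if_pos (by omega)]

theorem length_twist {α : Type} {n : ℕ} {w : ℕ → List (Letter α)}
    (hw : ∀ x < c.k n, (w x).length = c.q n) : (c.twist n w).length = c.q (n + 1) := by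
  rw [twist_eq_flatMap, q_succ]
  exact List.length_flatMap_range _ _ fun y _ => c.length_factor (hw _ (Nat.mod_lt _ (c.k_pos n)))

theorem getElem?_twist {α : Type} {n : ℕ} {w : ℕ → List (Letter α)}
    (hw : ∀ x < c.k n, (w x).length = c.q n) {y o : ℕ} (hy : y < c.q n * c.k n)
    (ho : o < c.l n * c.q n) :
    (c.twist n w)[y * (c.l n * c.q n) + o]? =
      if o < c.q n - c.offset n y then some Letter.b
      else if o < c.l n * c.q n - c.offset n y then
        (w (y % c.k n))[(o + c.offset n y) % c.q n]?
      else some Letter.e := by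
  have hw' := fun y => hw (y % c.k n) (Nat.mod_lt _ (c.k_pos n))
  rw [twist_eq_flatMap, List.getElem?_flatMap_range _ _ (fun y _ => c.length_factor (hw' y)) hy ho,
    c.getElem?_factor (hw' y) ho]

end TwistCoeff

/-! ### The letters of the words -/

namespace AbC

variable (d : AbC)

/-- The row symbol of the column with index `x mod k n`. -/
def rowAt (n x : ℕ) (t : Fin (d.s (n + 1))) : Fin (d.s n) := d.row n (Fin.ofNat (d.k n) x) t

theorem rowAt_mod (n x : ℕ) (t : Fin (d.s (n + 1))) :
    d.rowAt n (x % d.k n) t = d.rowAt n x t := by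
  unfold rowAt
  congr 1
  ext
  simp [Fin.ofNat]

theorem rowAt_fin (n : ℕ) (i : Fin (d.k n)) (t : Fin (d.s (n + 1))) :
    d.rowAt n i t = d.row n i t := by
  unfold rowAt
  congr 1
  ext
  simp [Fin.ofNat, Nat.mod_eq_of_lt i.2]

theorem word_succ (n : ℕ) (t : Fin (d.s (n + 1))) :
    d.word (n + 1) t = d.twist n fun x => if x < d.k n then d.word n (d.rowAt n x t) else [] := by
  rw [word]
  congr 1
  funext x
  split_ifs with h
  · exact congrArg _ (d.rowAt_fin n ⟨x, h⟩ t).symm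
  · rfl

theorem length_word (n : ℕ) (t : Fin (d.s n)) : (d.word n t).length = d.q n := by
  induction n with
  | zero => rfl
  | succ n ih =>
    rw [word_succ]
    exact d.length_twist fun x hx => by simp [hx, ih]

/-- The letter in position `J` of the `t`-th word of stage `n`. -/
def letter (n : ℕ) (t : Fin (d.s n)) (J : ℕ) : Letter (Fin (d.s 0)) :=
  (d.word n t).getD J Letter.b

theorem getElem?_word {n : ℕ} (t : Fin (d.s n)) {J : ℕ} (hJ : J < d.q n) :
    (d.word n t)[J]? = some (d.letter n t J) := by
  rw [← d.length_word n t] at hJ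
  simp [letter, hJ]

theorem letter_zero (t : Fin (d.s 0)) : d.letter 0 t 0 = Letter.sym t := rfl

theorem factor_pos_lt {n y o : ℕ} (hy : y < d.q n * d.k n) (ho : o < d.l n * d.q n) :
    y * (d.l n * d.q n) + o < d.q (n + 1) := by
  rw [d.q_succ]
  have : (y + 1) * (d.l n * d.q n) ≤ d.q n * d.k n * (d.l n * d.q n) := Nat.mul_le_mul_right _ hy
  rw [Nat.succ_mul] at this
  omega

theorem letter_succ {n y o : ℕ} (t : Fin (d.s (n + 1))) (hy : y < d.q n * d.k n)
    (ho : o < d.l n * d.q n) :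
    d.letter (n + 1) t (y * (d.l n * d.q n) + o) =
      if o < d.q n - d.offset n y then Letter.b
      else if o < d.l n * d.q n - d.offset n y then
        d.letter n (d.rowAt n y t) ((o + d.offset n y) % d.q n)
      else Letter.e := by
  apply Option.some_injective
  rw [← d.getElem?_word t (d.factor_pos_lt hy ho), d.word_succ,
    d.getElem?_twist (fun x hx => by simp [hx, length_word]) hy ho]
  have hx : y % d.k n < d.k n := Nat.mod_lt _ (d.k_pos n)
  split_ifs
  · rfl
  · rw [rowAt_mod, d.getElem?_word _ (Nat.mod_lt _ (d.q_pos n))]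
  · rfl

theorem letter_succ_b {n y o : ℕ} (t : Fin (d.s (n + 1))) (hy : y < d.q n * d.k n)
    (ho : o < d.l n * d.q n) (h : o < d.q n - d.offset n y) :
    d.letter (n + 1) t (y * (d.l n * d.q n) + o) = Letter.b := by
  rw [d.letter_succ t hy ho, if_pos h]

theorem letter_succ_e {n y o : ℕ} (t : Fin (d.s (n + 1))) (hy : y < d.q n * d.k n)
    (ho : o < d.l n * d.q n) (h : d.l n * d.q n - d.offset n y ≤ o) :
    d.letter (n + 1) t (y * (d.l n * d.q n) + o) = Letter.e := by
  have h1 : d.q n ≤ d.l n * d.q n := Nat.le_mul_of_pos_left _ (d.l_pos n)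
  rw [d.letter_succ t hy ho, if_neg (by omega), if_neg (by omega)]

/-- The letters in the copies of the words of stage `n`. -/
theorem letter_succ_copy {n y g i : ℕ} (t : Fin (d.s (n + 1))) (hy : y < d.q n * d.k n)
    (hg : g < d.l n - 1) (hi : i < d.q n) :
    d.letter (n + 1) t
        (y * (d.l n * d.q n) + (d.q n - d.offset n y) + g * d.q n + i) =
      d.letter n (d.rowAt n y t) i := by
  have h1 := d.offset_lt n y
  have h2 : (g + 1) * d.q n ≤ (d.l n - 1) * d.q n := Nat.mul_le_mul_right _ hg
  have h3 : (d.l n - 1) * d.q n + d.q n = d.l n * d.q n := by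
    rw [← Nat.succ_mul]; congr 1; have := d.l_pos n; omega
  rw [Nat.succ_mul] at h2
  rw [add_assoc, add_assoc, d.letter_succ t hy (by omega), if_neg (by omega), if_pos (by omega)]
  congr 1
  have e : d.q n - d.offset n y + (g * d.q n + i) + d.offset n y = i + (g + 1) * d.q n := by
    rw [Nat.succ_mul]; omega
  rw [e, Nat.add_mul_mod_self_right, Nat.mod_eq_of_lt hi]

theorem exists_factor_pos {n J : ℕ} (hJ : J < d.q (n + 1)) :
    ∃ y o, y < d.q n * d.k n ∧ o < d.l n * d.q n ∧ J = y * (d.l n * d.q n) + o := by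
  refine ⟨J / (d.l n * d.q n), J % (d.l n * d.q n), ?_, Nat.mod_lt _ (d.lq_pos n),
    (Nat.div_add_mod' _ _).symm⟩
  rw [Nat.div_lt_iff_lt_mul (d.lq_pos n), ← d.q_succ]
  exact hJ

end AbC


/-! ### The shape of the words -/

namespace TwistCoeff

variable (c : TwistCoeff)

theorem two_mul_q_le (n : ℕ) : 2 * c.q n ≤ c.q (n + 1) := by
  have hk : 4 ≤ c.k n := by
    have h1 := c.q_pos n
    have h2 := c.C_pos n
    have h3 : 1 ≤ 2 ^ n := Nat.one_le_two_pow
    calc 4 = 4 * 1 * 1 * 1 := rfl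
      _ ≤ 4 * 2 ^ n * c.q n * c.C n := by gcongr <;> omega
      _ = c.k n := by rw [k]; ring
  rw [q_succ]
  have h4 := c.lq_pos n
  calc 2 * c.q n ≤ c.q n * 4 * 1 := by omega
    _ ≤ c.q n * c.k n * (c.l n * c.q n) := by gcongr; omega

/-- The number of letters `b` at the beginning of a word of stage `n`. -/
def lead (n : ℕ) : ℕ := ∑ m ∈ Finset.range n, c.q m

theorem lead_succ (n : ℕ) : c.lead (n + 1) = c.lead n + c.q n := Finset.sum_range_succ _ _

theorem lead_lt (n : ℕ) : c.lead n < c.q n := by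
  induction n with
  | zero => exact c.q_pos 0
  | succ n ih =>
    rw [lead_succ]
    have := c.two_mul_q_le n
    omega

theorem le_lead (n : ℕ) : n ≤ c.lead n := by
  induction n with
  | zero => simp
  | succ n ih =>
    rw [lead_succ]
    have := c.q_pos n
    omega

/-- The position in a word of stage `n + 1` at which the copies of the word of stage `n` in the
factor with index `y` begin. -/
def runStart (n y : ℕ) : ℕ := y * (c.l n * c.q n) + (c.q n - c.offset n y)

theorem runStart_pos (n y : ℕ) : 0 < c.runStart n y := by
  have := c.offset_lt n y
  unfold runStart
  omega

theorem pred_l_mul_q (n : ℕ) : (c.l n - 1) * c.q n + c.q n = c.l n * c.q n := by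
  rw [← Nat.succ_mul]; congr 1; have := c.l_pos n; omega

theorem runStart_add_run (n y : ℕ) :
    c.runStart n y + (c.l n - 1) * c.q n + c.offset n y = (y + 1) * (c.l n * c.q n) := by
  have h1 := c.offset_lt n y
  have h2 := c.pred_l_mul_q n
  rw [runStart, Nat.succ_mul]
  omega

theorem run_le {n y : ℕ} (hy : y < c.q n * c.k n) :
    c.runStart n y + (c.l n - 1) * c.q n ≤ c.q (n + 1) := by
  have h1 := c.runStart_add_run n y
  have h2 : (y + 1) * (c.l n * c.q n) ≤ c.q n * c.k n * (c.l n * c.q n) :=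
    Nat.mul_le_mul_right _ hy
  rw [q_succ]
  omega

end TwistCoeff

namespace AbC

variable (d : AbC)

/-- The trichotomy initial spacer, run of copies, final spacer, on which the arguments about
positions in words depend. -/
theorem exists_pos_cases {n J : ℕ} (hJ : J < d.q (n + 1)) :
    ∃ y < d.q n * d.k n,
      (y * (d.l n * d.q n) ≤ J ∧ J < d.runStart n y) ∨
      (∃ g i, g < d.l n - 1 ∧ i < d.q n ∧ J = d.runStart n y + g * d.q n + i) ∨
      (d.runStart n y + (d.l n - 1) * d.q n ≤ J ∧ J < (y + 1) * (d.l n * d.q n)) := by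
  obtain ⟨y, o, hy, ho, rfl⟩ := d.exists_factor_pos hJ
  have h1 := d.runStart_add_run n y
  have h2 := d.offset_lt n y
  refine ⟨y, hy, ?_⟩
  rcases lt_or_ge (y * (d.l n * d.q n) + o) (d.runStart n y) with h | h
  · exact Or.inl ⟨by omega, h⟩
  rcases lt_or_ge (y * (d.l n * d.q n) + o) (d.runStart n y + (d.l n - 1) * d.q n) with h3 | h3
  · refine Or.inr (Or.inl ⟨(y * (d.l n * d.q n) + o - d.runStart n y) / d.q n,
      (y * (d.l n * d.q n) + o - d.runStart n y) % d.q n, ?_, Nat.mod_lt _ (d.q_pos n), ?_⟩)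
    · rw [Nat.div_lt_iff_lt_mul (d.q_pos n)]; omega
    · rw [add_assoc, Nat.div_add_mod']; omega
  · exact Or.inr (Or.inr ⟨h3, by rw [Nat.succ_mul]; omega⟩)

theorem letter_copy {n y g i : ℕ} (t : Fin (d.s (n + 1))) (hy : y < d.q n * d.k n)
    (hg : g < d.l n - 1) (hi : i < d.q n) :
    d.letter (n + 1) t (d.runStart n y + g * d.q n + i) = d.letter n (d.rowAt n y t) i :=
  d.letter_succ_copy t hy hg hi

theorem letter_run {n y o : ℕ} (t : Fin (d.s (n + 1))) (hy : y < d.q n * d.k n)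
    (ho : o < (d.l n - 1) * d.q n) :
    d.letter (n + 1) t (d.runStart n y + o) = d.letter n (d.rowAt n y t) (o % d.q n) := by
  rw [← d.letter_copy t hy ((Nat.div_lt_iff_lt_mul (d.q_pos n)).mpr ho) (Nat.mod_lt _ (d.q_pos n)),
    add_assoc, Nat.div_add_mod']

theorem letter_before_run {n y J : ℕ} (t : Fin (d.s (n + 1))) (hy : y < d.q n * d.k n)
    (h1 : y * (d.l n * d.q n) ≤ J) (h2 : J < d.runStart n y) :
    d.letter (n + 1) t J = Letter.b := by
  obtain ⟨o, rfl⟩ := Nat.exists_eq_add_of_le h1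
  have h3 : d.q n ≤ d.l n * d.q n := Nat.le_mul_of_pos_left _ (d.l_pos n)
  unfold TwistCoeff.runStart at h2
  exact d.letter_succ_b t hy (by omega) (by omega)

theorem letter_after_run {n y J : ℕ} (t : Fin (d.s (n + 1))) (hy : y < d.q n * d.k n)
    (h1 : d.runStart n y + (d.l n - 1) * d.q n ≤ J) (h2 : J < (y + 1) * (d.l n * d.q n)) :
    d.letter (n + 1) t J = Letter.e := by
  have h3 := d.runStart_add_run n y
  have h4 := d.offset_lt n y
  have h5 : d.q n ≤ d.l n * d.q n := Nat.le_mul_of_pos_left _ (d.l_pos n)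
  rw [Nat.succ_mul] at h2 h3
  obtain ⟨o, rfl⟩ := Nat.exists_eq_add_of_le (by omega : y * (d.l n * d.q n) ≤ J)
  exact d.letter_succ_e t hy (by omega) (by omega)

variable {d}

/-- The first and the last factor have offset 0: a word of the next stage starts with q n letters b
and a copy, and it ends with a copy. Induction adds up the letters b. -/
theorem letter_lead (hl : ∀ n, 2 ≤ d.l n) (n : ℕ) (t : Fin (d.s n)) :
    (∀ i < d.lead n, d.letter n t i = Letter.b) ∧
      (∃ a, d.letter n t (d.lead n) = Letter.sym a) ∧
      ∃ a, d.letter n t (d.q n - 1) = Letter.sym a := by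
  induction n with
  | zero => exact ⟨by simp [TwistCoeff.lead], ⟨t, rfl⟩, ⟨t, rfl⟩⟩
  | succ n ih =>
    have hq := d.q_pos n
    have hl' : 0 < d.l n - 1 := by have := hl n; omega
    have hN : 0 < d.q n * d.k n := Nat.mul_pos hq (d.k_pos n)
    have hS : d.runStart n 0 = d.q n := by simp [TwistCoeff.runStart, d.offset_zero]
    have hlt := d.lead_lt n
    have hc : ∀ i < d.q n, d.letter (n + 1) t (d.q n + i) = d.letter n (d.rowAt n 0 t) i := by
      intro i hi
      have := d.letter_copy t hN hl' hi
      rwa [hS, zero_mul, add_zero] at this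
    obtain ⟨ih1, ih2, -⟩ := ih (d.rowAt n 0 t)
    refine ⟨fun i hi => ?_, ?_, ?_⟩
    · rw [d.lead_succ] at hi
      rcases lt_or_ge i (d.q n) with h | h
      · exact d.letter_before_run t hN (by simp) (by rw [hS]; exact h)
      · obtain ⟨o, rfl⟩ := Nat.exists_eq_add_of_le h
        rw [hc o (by omega), ih1 o (by omega)]
    · rw [d.lead_succ, add_comm (d.lead n), hc _ hlt]
      exact ih2
    · have hlast : d.q n * d.k n - 1 < d.q n * d.k n := by omega
      have e : d.q (n + 1) - 1 = d.runStart n (d.q n * d.k n - 1) + (d.l n - 2) * d.q n +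
          (d.q n - 1) := by
        have h1 := d.runStart_add_run n (d.q n * d.k n - 1)
        rw [d.offset_last, Nat.sub_add_cancel hN, ← d.q_succ] at h1
        have h2 : (d.l n - 1) * d.q n = (d.l n - 2) * d.q n + d.q n := by
          rw [← Nat.succ_mul]; congr 1; omega
        omega
      rw [e, d.letter_copy t hlast (by omega) (by omega)]
      exact (ih _).2.2

theorem letter_first_ne_e (hl : ∀ n, 2 ≤ d.l n) (n : ℕ) (t : Fin (d.s n)) :
    d.letter n t 0 ≠ Letter.e := by
  obtain ⟨h1, ⟨a, h2⟩, -⟩ := letter_lead hl n t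
  rcases Nat.eq_zero_or_pos (d.lead n) with h | h
  · rw [h] at h2; rw [h2]; simp
  · rw [h1 0 h]; simp

/-- The first copy in a run begins with `lead n` letters b itself, so the initial spacer of a factor
appears longer by that amount. -/
theorem letter_near_run (hl : ∀ n, 2 ≤ d.l n) {n y J : ℕ} (t : Fin (d.s (n + 1)))
    (hy : y < d.q n * d.k n) (h1 : y * (d.l n * d.q n) ≤ J) (h2 : J < d.runStart n y + d.lead n) :
    d.letter (n + 1) t J = Letter.b := by
  rcases lt_or_ge J (d.runStart n y) with h | h
  · exact d.letter_before_run t hy h1 h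
  · obtain ⟨o, rfl⟩ := Nat.exists_eq_add_of_le h
    have h3 := d.lead_lt n
    have := d.letter_copy t hy (g := 0) (i := o) (by have := hl n; omega) (by omega)
    rw [zero_mul, add_zero] at this
    rw [this, (letter_lead hl n _).1 o (by omega)]

theorem letter_run_lead (hl : ∀ n, 2 ≤ d.l n) {n y : ℕ} (t : Fin (d.s (n + 1)))
    (hy : y < d.q n * d.k n) : ∃ a, d.letter (n + 1) t (d.runStart n y + d.lead n) = Letter.sym a := by
  have := d.letter_copy t hy (g := 0) (i := d.lead n) (by have := hl n; omega) (d.lead_lt n)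
  rw [zero_mul, add_zero] at this
  rw [this]
  exact (letter_lead hl n _).2.1

theorem run_lead_lt (hl : ∀ n, 2 ≤ d.l n) {n y : ℕ} (hy : y < d.q n * d.k n) :
    d.runStart n y + d.lead n < d.q (n + 1) := by
  have h1 := d.run_le hy
  have h2 := d.lead_lt n
  have h3 : d.q n ≤ (d.l n - 1) * d.q n := Nat.le_mul_of_pos_left _ (by have := hl n; omega)
  omega

/-- A word of stage `n` has no run of `lead n + 1` letters `b`. -/
theorem exists_letter_ne_b (hl : ∀ n, 2 ≤ d.l n) (n : ℕ) (t : Fin (d.s n)) {i : ℕ}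
    (hi : i < d.q n) (hi' : i + d.lead n < d.q n) : ∃ j ≤ d.lead n, d.letter n t (i + j) ≠ Letter.b := by
  cases n with
  | zero =>
    have : i = 0 := Nat.lt_one_iff.mp hi
    exact ⟨0, by simp, by subst this; rw [letter_zero]; simp⟩
  | succ n =>
    rw [d.lead_succ]
    obtain ⟨y, hy, h | ⟨g, i', hg, hi', rfl⟩ | h⟩ := d.exists_pos_cases hi
    · obtain ⟨a, ha⟩ := letter_run_lead hl t hy
      refine ⟨d.runStart n y + d.lead n - i, ?_, ?_⟩
      · have h1 := h.1
        have h2 := d.offset_lt n y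
        unfold TwistCoeff.runStart
        omega
      · rw [Nat.add_sub_cancel' (by omega), ha]; simp
    · refine ⟨d.q n - 1 - i', by omega, ?_⟩
      have e : d.runStart n y + g * d.q n + i' + (d.q n - 1 - i') =
          d.runStart n y + g * d.q n + (d.q n - 1) := by omega
      obtain ⟨a, ha⟩ := (letter_lead hl n (d.rowAt n y t)).2.2
      rw [e, d.letter_copy t hy hg (by omega), ha]
      simp
    · exact ⟨0, by omega, by rw [add_zero, d.letter_after_run t hy h.1 h.2]; simp⟩

/-- An occurrence of a word of stage `n` in a word of stage `n + 1` lies in one of the runs of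
copies of words of stage `n`. -/
theorem occurrence_in_run (hl : ∀ n, 2 ≤ d.l n) {n P : ℕ} (t : Fin (d.s (n + 1))) (u : Fin (d.s n))
    (hP : P + d.q n ≤ d.q (n + 1)) (h : ∀ i < d.q n, d.letter (n + 1) t (P + i) = d.letter n u i) :
    ∃ y < d.q n * d.k n, d.runStart n y ≤ P ∧
      P + d.q n ≤ d.runStart n y + (d.l n - 1) * d.q n := by
  have hq := d.q_pos n
  have hlead := d.lead_lt n
  obtain ⟨hb, ⟨a, ha⟩, ⟨a', ha'⟩⟩ := letter_lead hl n u
  obtain ⟨y, hy, hc | ⟨g, i, hg, hi, hPe⟩ | hc⟩ := d.exists_pos_cases (by omega : P < d.q (n + 1))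
  · have h1 := h _ hlead
    rw [ha, letter_near_run hl t hy (by omega) (by omega)] at h1
    simp at h1
  · refine ⟨y, hy, by omega, ?_⟩
    by_contra hcon
    have hrun := d.runStart_add_run n y
    have hlast := h (d.q n - 1) (by omega)
    rw [ha'] at hlast
    -- The last factor has no e after its run, so there an occurrence that leaves the run also
    -- leaves the word.
    have hy' : y + 1 < d.q n * d.k n := by
      by_contra hcon2
      have e : y = d.q n * d.k n - 1 := by omega
      have e2 : y + 1 = d.q n * d.k n := by omega
      have h3 := d.offset_last n
      rw [← e] at h3
      rw [h3, e2, ← d.q_succ] at hrun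
      omega
    -- The last letter of the occurrence is no spacer, so it lies beyond the e's of factor y and
    -- beyond the b's that begin the next run.
    have hge : d.runStart n (y + 1) + d.lead n ≤ P + (d.q n - 1) := by
      by_contra hcon3
      rcases lt_or_ge (P + (d.q n - 1)) ((y + 1) * (d.l n * d.q n)) with h4 | h4
      · rw [d.letter_after_run t hy (by omega) h4] at hlast
        simp at hlast
      · rw [letter_near_run hl t hy' h4 (by omega)] at hlast
        simp at hlast
    have hbig : (y + 1) * (d.l n * d.q n) < d.runStart n (y + 1) := by
      have := d.offset_lt n (y + 1)
      unfold TwistCoeff.runStart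
      omega
    have h2 : (g + 1) * d.q n ≤ (d.l n - 1) * d.q n := Nat.mul_le_mul_right _ hg
    rw [Nat.succ_mul] at h2
    -- The occurrence thus contains the b before the next run and the `lead n` letters b of the
    -- first copy in it, one more than an n-word allows.
    obtain ⟨j, hj, hne⟩ := exists_letter_ne_b hl n u (i := d.runStart n (y + 1) - 1 - P)
      (by omega) (by omega)
    apply hne
    rw [← h _ (by omega)]
    exact letter_near_run hl t hy' (by omega) (by omega)
  · have h1 := h 0 hq
    rw [add_zero, d.letter_after_run t hy hc.1 hc.2] at h1
    exact absurd h1.symm (letter_first_ne_e hl n u)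

end AbC


/-! ### Injectivity of the twisting operator -/

/-- The spacers do not depend on the words, and the first k n factors already show each word at a
known place, because l n ≥ 2 leaves at least one copy. -/
theorem TwistCoeff.twist_injOn (c : TwistCoeff) {α : Type} {n : ℕ} (hl : 2 ≤ c.l n)
    {w w' : ℕ → List (Letter α)} (hw : ∀ x < c.k n, (w x).length = c.q n)
    (hw' : ∀ x < c.k n, (w' x).length = c.q n) (h : c.twist n w = c.twist n w') {x : ℕ}
    (hx : x < c.k n) : w x = w' x := by
  have hq := c.q_pos n
  have hr := c.offset_lt n x
  have hpl := c.pred_l_mul_q n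
  have hle : c.q n ≤ (c.l n - 1) * c.q n := Nat.le_mul_of_pos_left _ (by omega)
  have hxN : x < c.q n * c.k n := lt_of_lt_of_le hx (Nat.le_mul_of_pos_left _ hq)
  apply List.ext_getElem?
  intro i
  rcases lt_or_ge i (c.q n) with hi | hi
  · have e := c.getElem?_twist hw hxN (o := c.q n - c.offset n x + i) (by omega)
    have e' := c.getElem?_twist hw' hxN (o := c.q n - c.offset n x + i) (by omega)
    have hm : (c.q n - c.offset n x + i + c.offset n x) % c.q n = i := by
      rw [show c.q n - c.offset n x + i + c.offset n x = i + c.q n by omega, Nat.add_mod_right,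
        Nat.mod_eq_of_lt hi]
    rw [if_neg (by omega), if_pos (by omega), Nat.mod_eq_of_lt hx, hm] at e e'
    rw [← e, ← e', h]
  · rw [List.getElem?_eq_none (by rw [hw x hx]; exact hi),
      List.getElem?_eq_none (by rw [hw' x hx]; exact hi)]

namespace AbC

variable {d : AbC}

theorem word_eq_of_letter_eq {n : ℕ} {t t' : Fin (d.s n)}
    (h : ∀ i < d.q n, d.letter n t i = d.letter n t' i) : d.word n t = d.word n t' := by
  apply List.ext_getElem?
  intro i
  rcases lt_or_ge i (d.q n) with hi | hi
  · rw [d.getElem?_word t hi, d.getElem?_word t' hi, h i hi]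
  · rw [List.getElem?_eq_none (by rwa [length_word]), List.getElem?_eq_none (by rwa [length_word])]

/-- Untwisting recovers the sequence of n-words, by induction the row sequence, and by R3 the row.
-/
theorem word_injective (hl : ∀ n, 2 ≤ d.l n) (hR3 : d.R3) (n : ℕ) :
    Function.Injective (d.word n) := by
  induction n with
  | zero =>
    intro t t' h
    simpa [word] using h
  | succ n ih =>
    intro t t' h
    apply hR3 n
    funext i
    apply ih
    rw [word_succ, word_succ] at h
    have := d.twist_injOn (hl n) (fun x hx => by simp [hx, length_word])
      (fun x hx => by simp [hx, length_word]) h i.2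
    simpa [rowAt_fin] using this

theorem word_twist_ofFn (n : ℕ) (t : Fin (d.s (n + 1))) :
    d.word (n + 1) t =
      d.twist n fun i => (List.ofFn fun i => d.word n (d.row n i t)).getD i [] := by
  rw [word]
  congr 1
  funext i
  split_ifs with hi
  · simp [hi]
  · simp [hi]

theorem isBuiltFrom_preWords : d.IsBuiltFrom d.words d.preWords where
  zero := rfl
  tuples := by
    rintro n _ ⟨t, rfl⟩
    refine ⟨List.length_ofFn, fun w hw => ?_⟩
    obtain ⟨i, rfl⟩ := List.mem_ofFn.mp hw
    exact ⟨_, rfl⟩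
  succ n := by
    rw [words, preWords, ← Set.range_comp]
    congr 1
    funext t
    exact word_twist_ofFn n t

/-- The sets of pre-words are determined by the words. -/
theorem eq_preWords_of_isBuiltFrom (hl : ∀ n, 2 ≤ d.l n) {P : ℕ → Set (List (List (Letter (Fin (d.s 0)))))}
    (hP : d.IsBuiltFrom d.words P) (n : ℕ) : P n = d.preWords n := by
  have hlen : ∀ Q, d.IsBuiltFrom d.words Q → ∀ t ∈ Q n, ∀ x < d.k n, (t.getD x []).length = d.q n := by
    intro Q hQ t ht x hx
    obtain ⟨h1, h2⟩ := hQ.tuples n t ht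
    rw [← h1] at hx
    obtain ⟨u, hu⟩ := h2 t[x] (List.getElem_mem hx)
    simp only [List.getD_eq_getElem _ _ hx, ← hu, length_word]
  have key : ∀ Q Q', d.IsBuiltFrom d.words Q → d.IsBuiltFrom d.words Q' → Q n ⊆ Q' n := by
    intro Q Q' hQ hQ' t ht
    have h1 : d.twist n (fun i => t.getD i []) ∈ d.words (n + 1) := by
      rw [hQ.succ]; exact ⟨t, ht, rfl⟩
    rw [hQ'.succ] at h1
    obtain ⟨t', ht', h2⟩ := h1
    have l1 := (hQ.tuples n t ht).1
    have l2 := (hQ'.tuples n t' ht').1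
    have : t' = t := by
      apply List.ext_getElem (l2.trans l1.symm)
      intro x hx hx'
      have := d.twist_injOn (hl n) (hlen Q' hQ' t' ht') (hlen Q hQ t ht) h2 (x := x) (by omega)
      simpa [hx, hx'] using this
    rwa [← this]
  exact Set.Subset.antisymm (key _ _ hP isBuiltFrom_preWords) (key _ _ isBuiltFrom_preWords hP)

end AbC

/-! ### Unique readability -/

theorem UniquelyReadable.image_map_iff {A B : Type} {f : A → B} (hf : Function.Injective f)
    (W : Set (List A)) : UniquelyReadable (List.map f '' W) ↔ UniquelyReadable W := by
  constructor
  · intro h u hu v hv w hw p t e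
    have := h _ ⟨u, hu, rfl⟩ _ ⟨v, hv, rfl⟩ _ ⟨w, hw, rfl⟩ (p.map f) (t.map f)
      (by rw [← List.map_append, e, List.map_append, List.map_append])
    simpa using this
  · rintro h _ ⟨u, hu, rfl⟩ _ ⟨v, hv, rfl⟩ _ ⟨w, hw, rfl⟩ p t e
    rw [← List.map_append, List.map_eq_append_iff] at e
    obtain ⟨l₁, r, h1, h2, rfl⟩ := e
    rw [List.map_eq_append_iff] at h2
    obtain ⟨p', w', rfl, rfl, h4⟩ := h2
    have h5 := List.map_injective_iff.mpr hf h4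
    subst h5
    simpa using h u hu v hv w' hw p' r h1

/-- Unique readability of a set of words of the same length, in terms of their letters. -/
theorem uniquelyReadable_range_iff {A ι : Type} {K : ℕ} {w : ι → List A} (F : ι → ℕ → A)
    (hlen : ∀ t, (w t).length = K) (hF : ∀ t, ∀ i < K, (w t)[i]? = some (F t i)) :
    UniquelyReadable (Set.range w) ↔ ∀ t₁ t₂ t₃ X, 0 < X → X < K →
      ¬ ∀ i < K, (if X + i < K then F t₁ (X + i) else F t₂ (X + i - K)) = F t₃ i := by
  have hcat : ∀ t₁ t₂ i, i < K + K →
      (w t₁ ++ w t₂)[i]? = some (if i < K then F t₁ i else F t₂ (i - K)) := by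
    intro t₁ t₂ i hi
    split_ifs with h
    · rw [List.getElem?_append_left (by rwa [hlen]), hF _ _ h]
    · rw [List.getElem?_append_right (by rw [hlen]; omega), hlen, hF _ _ (by omega)]
  constructor
  · intro h t₁ t₂ t₃ X hX hXK e
    have h1 : (w t₁ ++ w t₂) = (w t₁ ++ w t₂).take X ++ w t₃ ++ (w t₁ ++ w t₂).drop (X + K) := by
      have h2 : ((w t₁ ++ w t₂).drop X).take K = w t₃ := by
        apply List.ext_getElem?
        intro i
        rcases lt_or_ge i K with hi | hi
        · rw [List.getElem?_take_of_lt hi, List.getElem?_drop, hcat _ _ _ (by omega), hF _ _ hi,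
            e i hi]
        · rw [List.getElem?_eq_none (by rw [List.length_take]; omega),
            List.getElem?_eq_none (by rw [hlen]; exact hi)]
      rw [← h2, List.append_assoc, ← List.drop_drop, List.take_append_drop, List.take_append_drop]
    have h3 := h _ ⟨t₁, rfl⟩ _ ⟨t₂, rfl⟩ _ ⟨t₃, rfl⟩ _ _ h1
    rcases h3 with h3 | h3
    · have := congrArg List.length h3
      simp [hlen] at this
      omega
    · have := congrArg List.length h3
      simp [hlen] at this
      omega
  · rintro h _ ⟨t₁, rfl⟩ _ ⟨t₂, rfl⟩ _ ⟨t₃, rfl⟩ p s e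
    by_contra hcon
    push Not at hcon
    have hl := congrArg List.length e
    simp only [List.length_append, hlen] at hl
    have h1 := List.length_pos_iff.mpr hcon.1
    have h2 := List.length_pos_iff.mpr hcon.2
    refine h t₁ t₂ t₃ p.length h1 (by omega) fun i hi => ?_
    apply Option.some_injective
    rw [← hcat _ _ _ (by omega), e, ← hF _ _ hi, List.append_assoc,
      List.getElem?_append_right (by omega), Nat.add_sub_cancel_left,
      List.getElem?_append_left (by rwa [hlen])]

namespace AbC

variable {d : AbC}

/-- Replacing row symbols by their n-words is an injective change of alphabet. -/
theorem uniquelyReadable_preWords_iff (hl : ∀ n, 2 ≤ d.l n) (hR3 : d.R3) (n : ℕ) :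
    UniquelyReadable (d.preWords n) ↔ UniquelyReadable (d.rowWords n) := by
  rw [← UniquelyReadable.image_map_iff (word_injective hl hR3 n) (d.rowWords n), rowWords,
    ← Set.range_comp, preWords]
  simp [Function.comp_def, List.map_ofFn]

/-- Two factors with the same letters have the same spacers and consist of copies of the
same word. -/
theorem factor_eq (hl : ∀ n, 2 ≤ d.l n) (hR3 : d.R3) {n y y' : ℕ} {t t' : Fin (d.s (n + 1))}
    (hy : y < d.q n * d.k n) (hy' : y' < d.q n * d.k n)
    (h : ∀ o < d.l n * d.q n, d.letter (n + 1) t (y * (d.l n * d.q n) + o) =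
      d.letter (n + 1) t' (y' * (d.l n * d.q n) + o)) :
    d.offset n y = d.offset n y' ∧ d.rowAt n y t = d.rowAt n y' t' := by
  have hr := d.offset_lt n y
  have hr' := d.offset_lt n y'
  have hlt := d.lead_lt n
  have h2 : d.q n ≤ (d.l n - 1) * d.q n := Nat.le_mul_of_pos_left _ (by have := hl n; omega)
  have h3 := d.pred_l_mul_q n
  have hoff : d.offset n y = d.offset n y' := by
    obtain ⟨a, ha⟩ := letter_run_lead hl t hy
    obtain ⟨a', ha'⟩ := letter_run_lead hl t' hy'
    -- The factor with the smaller offset has the longer initial spacer, so it still reads b where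
    -- the other one shows its first letter different from b.
    rcases lt_trichotomy (d.offset n y) (d.offset n y') with hlt' | heq | hlt'
    · have := h (d.q n - d.offset n y' + d.lead n) (by omega)
      rw [letter_near_run hl t hy (by omega) (by unfold TwistCoeff.runStart; omega), ← add_assoc] at this
      unfold TwistCoeff.runStart at ha'
      rw [ha'] at this
      simp at this
    · exact heq
    · have := h (d.q n - d.offset n y + d.lead n) (by omega)
      rw [letter_near_run hl t' hy' (by omega) (by unfold TwistCoeff.runStart; omega), ← add_assoc] at this
      unfold TwistCoeff.runStart at ha
      rw [ha] at this
      simp at this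
  refine ⟨hoff, word_injective hl hR3 n (word_eq_of_letter_eq fun i hi => ?_)⟩
  have hl' : 0 < d.l n - 1 := by have := hl n; omega
  have h5 := d.letter_copy t hy hl' hi
  have h6 := d.letter_copy t' hy' hl' hi
  rw [← h5, ← h6, TwistCoeff.runStart, TwistCoeff.runStart, hoff]
  have := h (d.q n - d.offset n y' + i) (by omega)
  simpa [add_assoc] using this

/-- A displaced occurrence must begin at a factor, since no other position is followed by `lead (n +
1)` letters b. Comparison factor by factor then shows that the displacement preserves rows and,
within the first word, offsets. A displacement by whole periods of k n columns changes the offset at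
the start of a period; any other displacement makes row sequences overlap. -/
theorem uniquelyReadable_words (hl : ∀ n, 2 ≤ d.l n) (hR3 : d.R3)
    (h : ∀ n, UniquelyReadable (d.rowWords n)) (n : ℕ) : UniquelyReadable (d.words n) := by
  rw [words, uniquelyReadable_range_iff (K := d.q n) (fun t i => d.letter n t i)
    (fun t => d.length_word n t) (fun t i hi => d.getElem?_word t hi)]
  cases n with
  | zero =>
    intro t₁ t₂ t₃ X hX hX1
    have : X < 1 := hX1
    omega
  | succ n =>
    intro t₁ t₂ t₃ X hX hXK e
    have hq := d.q_pos n
    have hk := d.k_pos n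
    have hlt := d.lead_lt n
    have hlt1 := d.lead_lt (n + 1)
    have hlq := d.lq_pos n
    have hls := d.lead_succ n
    obtain ⟨hb, -, -⟩ := letter_lead hl (n + 1) t₃
    -- the occurrence begins at a factor
    have hstart : ∃ y < d.q n * d.k n, X = y * (d.l n * d.q n) := by
      obtain ⟨y, hy, hc | ⟨g, i, hg, hi, hPe⟩ | hc⟩ := d.exists_pos_cases hXK
      · refine ⟨y, hy, ?_⟩
        obtain ⟨a, ha⟩ := letter_run_lead hl t₁ hy
        have hlt2 := run_lead_lt hl hy
        by_contra hne
        have h1 : d.runStart n y + d.lead n - X < d.lead (n + 1) := by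
          have := d.offset_lt n y
          unfold TwistCoeff.runStart
          omega
        have h2 := e (d.runStart n y + d.lead n - X) (by omega)
        rw [hb _ h1, Nat.add_sub_cancel' (by omega), if_pos hlt2, ha] at h2
        simp at h2
      · have h1 : (g + 1) * d.q n ≤ (d.l n - 1) * d.q n := Nat.mul_le_mul_right _ hg
        rw [Nat.succ_mul] at h1
        have h3 := d.run_le hy
        have h2 := e (d.q n - 1 - i) (by omega)
        have e1 : X + (d.q n - 1 - i) = d.runStart n y + g * d.q n + (d.q n - 1) := by omega
        obtain ⟨a, ha⟩ := (letter_lead hl n (d.rowAt n y t₁)).2.2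
        rw [hb _ (by omega), if_pos (by omega), e1, d.letter_copy t₁ hy hg (by omega), ha] at h2
        simp at h2
      · have h2 := e 0 (by omega)
        rw [hb _ (by omega), add_zero, if_pos hXK, d.letter_after_run t₁ hy hc.1 hc.2] at h2
        simp at h2
    obtain ⟨y₀, hy₀, rfl⟩ := hstart
    have hy₀pos : 0 < y₀ := Nat.pos_of_mul_pos_right hX
    -- comparison of the factors
    have hcmp1 : ∀ y, y₀ + y < d.q n * d.k n →
        d.offset n (y₀ + y) = d.offset n y ∧ d.rowAt n (y₀ + y) t₁ = d.rowAt n y t₃ := by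
      intro y hy
      refine factor_eq hl hR3 hy (by omega) fun o ho => ?_
      have h1 := d.factor_pos_lt hy ho
      have h2 := d.factor_pos_lt (n := n) (by omega : y < d.q n * d.k n) ho
      have h3 := e _ h2
      rw [← add_assoc, ← add_mul, if_pos h1] at h3
      exact h3
    have hcmp2 : ∀ y y', y < d.q n * d.k n → y₀ + y = d.q n * d.k n + y' →
        d.rowAt n y' t₂ = d.rowAt n y t₃ := by
      intro y y' hy hy'
      refine (factor_eq hl hR3 (by omega) hy fun o ho => ?_).2
      have h2 := d.factor_pos_lt hy ho
      have h3 := e _ h2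
      have h4 : y₀ * (d.l n * d.q n) + (y * (d.l n * d.q n) + o) =
          d.q (n + 1) + (y' * (d.l n * d.q n) + o) := by
        rw [← add_assoc, ← add_mul, hy', add_mul, ← d.q_succ, add_assoc]
      rw [h4, if_neg (by omega), Nat.add_sub_cancel_left] at h3
      exact h3
    obtain ⟨m₀, Y, hY, hm₀⟩ : ∃ m₀ Y, Y < d.k n ∧ y₀ = m₀ * d.k n + Y :=
      ⟨y₀ / d.k n, y₀ % d.k n, Nat.mod_lt _ hk, (Nat.div_add_mod' _ _).symm⟩
    have hm₀q : m₀ < d.q n := by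
      by_contra hcon
      have : d.q n * d.k n ≤ m₀ * d.k n := Nat.mul_le_mul_right _ (by omega)
      omega
    rcases Nat.eq_zero_or_pos Y with hY0 | hY0
    · have h1 := (hcmp1 0 (by omega)).1
      rw [add_zero, hm₀, hY0, add_zero, d.offset_mul_k, d.offset_zero, ← d.j_zero n] at h1
      have := d.j_injOn hm₀q hq h1
      simp [this, hY0] at hm₀
      omega
    · have hur := (uniquelyReadable_range_iff (K := d.k n)
        (fun (t : Fin (d.s (n + 1))) i => d.rowAt n i t)
        (fun t => List.length_ofFn) (fun t i hi => by
          rw [List.getElem?_ofFn, dif_pos hi]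
          exact congrArg some (d.rowAt_fin n ⟨i, hi⟩ t).symm)).mp (h n)
      -- The first period of the third word is read across the periods m₀ and m₀ + 1; the latter
      -- belongs to the second word if m₀ is the last period of the first.
      refine hur t₁ (if m₀ + 1 < d.q n then t₁ else t₂) t₃ Y hY0 hY fun x hx => ?_
      have hkN : d.k n ≤ d.q n * d.k n := Nat.le_mul_of_pos_left _ hq
      have hm1 : (m₀ + 1) * d.k n ≤ d.q n * d.k n := Nat.mul_le_mul_right _ hm₀q
      have hm1' : (m₀ + 1) * d.k n = m₀ * d.k n + d.k n := Nat.succ_mul _ _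
      have hmod : ∀ m z t, d.rowAt n (m * d.k n + z) t = d.rowAt n z t := by
        intro m z t
        rw [← d.rowAt_mod, ← d.rowAt_mod n z, add_comm, Nat.add_mul_mod_self_right]
      split_ifs with h1 h2
      · rw [← (hcmp1 x (by omega)).2, hm₀, add_assoc, hmod]
      · have hm2 : (m₀ + 2) * d.k n ≤ d.q n * d.k n := Nat.mul_le_mul_right _ h2
        have hm2' : (m₀ + 2) * d.k n = (m₀ + 1) * d.k n + d.k n := Nat.succ_mul _ _
        rw [← (hcmp1 x (by omega)).2, ← hmod (m₀ + 1)]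
        congr 1
        omega
      · have hm2 : m₀ + 1 = d.q n := by omega
        apply hcmp2 x _ (by omega)
        rw [← hm2]
        omega

end AbC


/-! ### Counting copies -/

namespace AbC

variable {d : AbC}

/-- By R2 each of the q n periods of columns contributes every symbol k n / s n times, so sums over
columns do not depend on the row. -/
theorem sum_rowAt (hR2 : d.R2) (n : ℕ) (t : Fin (d.s (n + 1))) (G : Fin (d.s n) → ℕ) :
    ∑ y ∈ Finset.range (d.q n * d.k n), G (d.rowAt n y t) =
      d.q n * (d.k n / d.s n) * ∑ u, G u := by
  have h1 : ∑ x ∈ Finset.range (d.k n), G (d.rowAt n x t) = d.k n / d.s n * ∑ u, G u := by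
    rw [Finset.sum_range]
    simp only [rowAt_fin]
    rw [Finset.sum_comp G (fun i => d.row n i t), Finset.mul_sum, eq_comm]
    refine Finset.sum_subset_zero_on_sdiff (Finset.subset_univ _) ?_ ?_ |>.symm
    · intro u hu
      simp only [Finset.mem_sdiff, Finset.mem_univ, Finset.mem_image, true_and, not_exists] at hu
      rw [← hR2 n t u, Finset.card_eq_zero.mpr, zero_mul]
      exact Finset.filter_eq_empty_iff.mpr fun i _ => hu i
    · intro u _
      rw [hR2 n t u, smul_eq_mul]
  have h2 : ∀ a, ∑ y ∈ Finset.range (a * d.k n), G (d.rowAt n y t) =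
      a * (d.k n / d.s n * ∑ u, G u) := by
    intro a
    induction a with
    | zero => simp
    | succ a ih =>
      rw [Nat.succ_mul, Finset.sum_range_add, ih, Nat.succ_mul, ← h1]
      congr 1
      refine Finset.sum_congr rfl fun x _ => ?_
      rw [← d.rowAt_mod n (a * d.k n + x), Nat.mul_add_mod_self_right, d.rowAt_mod]
  rw [h2, mul_assoc]

theorem card_rowAt (hR2 : d.R2) (n : ℕ) (t : Fin (d.s (n + 1))) (u : Fin (d.s n)) :
    ((Finset.range (d.q n * d.k n)).filter fun y => d.rowAt n y t = u).card =
      d.q n * (d.k n / d.s n) := by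
  rw [Finset.card_filter]
  have := sum_rowAt hR2 n t (fun v => if v = u then 1 else 0)
  simpa using this

theorem q_mul_k_div_s_pos (hC : ∀ n, d.s n ^ 2 ∣ d.C n) (n : ℕ) :
    0 < d.q n * (d.k n / d.s n) := by
  refine Nat.mul_pos (d.q_pos n) (Nat.div_pos ?_ (d.s_pos n))
  have h1 : d.s n ∣ d.k n :=
    (dvd_trans (dvd_pow_self _ two_ne_zero) (hC n)).trans ⟨_, mul_comm _ _⟩
  exact Nat.le_of_dvd (d.k_pos n) h1

/-- The number of occurrences of a word as a subword, in terms of positions. -/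
theorem subwordCount_eq {n : ℕ} (t : Fin (d.s (n + 1))) (u : Fin (d.s n)) :
    subwordCount (d.word n u) (d.word (n + 1) t) =
      {X | X + d.q n ≤ d.q (n + 1) ∧
        ∀ i < d.q n, d.letter (n + 1) t (X + i) = d.letter n u i}.ncard := by
  have hinj : Set.InjOn List.length {p | ∃ s, d.word (n + 1) t = p ++ d.word n u ++ s} := by
    rintro p ⟨s, hs⟩ p' ⟨s', hs'⟩ hp
    rw [hs, List.append_assoc, List.append_assoc] at hs'
    exact (List.append_inj hs' hp).1
  rw [subwordCount, ← hinj.ncard_image]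
  congr 1
  ext X
  constructor
  · rintro ⟨p, ⟨s, hs⟩, rfl⟩
    have hlen := congrArg List.length hs
    simp only [List.length_append, length_word] at hlen
    refine ⟨by omega, fun i hi => Option.some_injective _ ?_⟩
    rw [← d.getElem?_word t (by omega), ← d.getElem?_word u hi, hs, List.append_assoc,
      List.getElem?_append_right (by omega), Nat.add_sub_cancel_left,
      List.getElem?_append_left (by rwa [length_word])]
  · rintro ⟨hX, h⟩
    refine ⟨(d.word (n + 1) t).take X, ⟨(d.word (n + 1) t).drop (X + d.q n), ?_⟩, ?_⟩
    · have h2 : ((d.word (n + 1) t).drop X).take (d.q n) = d.word n u := by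
        apply List.ext_getElem?
        intro i
        rcases lt_or_ge i (d.q n) with hi | hi
        · rw [List.getElem?_take_of_lt hi, List.getElem?_drop, d.getElem?_word t (by omega),
            d.getElem?_word u hi, h i hi]
        · rw [List.getElem?_eq_none (by rw [List.length_take]; omega),
            List.getElem?_eq_none (by rw [length_word]; exact hi)]
      rw [← h2, List.append_assoc, ← List.drop_drop, List.take_append_drop, List.take_append_drop]
    · rw [List.length_take, length_word]
      omega

/-- Occurrences lie in runs, and unique readability of the n-words aligns them with the copies, so
that counting subwords is counting copies. -/
theorem isStronglyUniform (hl : ∀ n, 2 ≤ d.l n) (hC : ∀ n, d.s n ^ 2 ∣ d.C n) (hR2 : d.R2)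
    (hR3 : d.R3) (h : ∀ n, UniquelyReadable (d.rowWords n)) : IsStronglyUniform d.words := by
  intro n
  have hl' : 0 < d.l n - 1 := by have := hl n; omega
  refine ⟨d.q n * (d.k n / d.s n) * (d.l n - 1), Nat.mul_pos (q_mul_k_div_s_pos hC n) hl', ?_⟩
  rintro _ ⟨t, rfl⟩ _ ⟨u, rfl⟩
  have hq := d.q_pos n
  have hur := uniquelyReadable_words hl hR3 h n
  rw [words, uniquelyReadable_range_iff (K := d.q n) (fun t i => d.letter n t i)
    (fun t => d.length_word n t) (fun t i hi => d.getElem?_word t hi)] at hur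
  rw [subwordCount_eq, ← card_rowAt hR2 n t u]
  conv_rhs => rw [← Finset.card_range (d.l n - 1), ← Finset.card_product]
  have hbound : ∀ y g, g < d.l n - 1 → y * (d.l n * d.q n) ≤ d.runStart n y + g * d.q n ∧
      d.runStart n y + g * d.q n + d.q n ≤ (y + 1) * (d.l n * d.q n) := by
    intro y g hg
    have h1 : (g + 1) * d.q n ≤ (d.l n - 1) * d.q n := Nat.mul_le_mul_right _ hg
    have h2 := d.runStart_add_run n y
    rw [Nat.succ_mul] at h1
    exact ⟨by unfold TwistCoeff.runStart; omega, by omega⟩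
  have hinj : Set.InjOn (fun z : ℕ × ℕ => d.runStart n z.1 + z.2 * d.q n)
      ((((Finset.range (d.q n * d.k n)).filter fun y => d.rowAt n y t = u) ×ˢ
        Finset.range (d.l n - 1) : Finset (ℕ × ℕ)) : Set (ℕ × ℕ)) := by
    rintro ⟨y, g⟩ hz ⟨y', g'⟩ hz' e
    simp only [Finset.coe_product, Set.mem_prod, Finset.mem_coe, Finset.mem_range] at hz hz' e
    have b1 := hbound y g hz.2
    have b2 := hbound y' g' hz'.2
    have hyy : y = y' := by
      rcases lt_trichotomy y y' with h1 | h1 | h1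
      · have := Nat.mul_le_mul_right (d.l n * d.q n) h1
        simp only [Nat.succ_eq_add_one] at this
        omega
      · exact h1
      · have := Nat.mul_le_mul_right (d.l n * d.q n) h1
        simp only [Nat.succ_eq_add_one] at this
        omega
    subst hyy
    have : g * d.q n = g' * d.q n := by omega
    rw [Nat.eq_of_mul_eq_mul_right hq this]
  rw [← Set.ncard_coe_finset, ← hinj.ncard_image]
  congr 1
  ext X
  simp only [Set.mem_ofPred_eq, Set.mem_image, Finset.coe_product, Set.mem_prod, Finset.mem_coe,
    Finset.mem_filter, Finset.mem_range, Prod.exists]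
  constructor
  · rintro ⟨hX, hocc⟩
    obtain ⟨y, hy, h1, h2⟩ := occurrence_in_run hl t u hX hocc
    obtain ⟨o, rfl⟩ := Nat.exists_eq_add_of_le h1
    have e := Nat.div_add_mod' o (d.q n)
    have hi : o % d.q n < d.q n := Nat.mod_lt _ hq
    have hg : o / d.q n < d.l n - 1 := (Nat.div_lt_iff_lt_mul hq).mpr (by omega)
    -- A misaligned occurrence would straddle two adjacent copies of the same word.
    have hmod : o % d.q n = 0 := by
      by_contra hne
      have hg1 : o / d.q n + 1 < d.l n - 1 := by
        by_contra hcon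
        have : (d.l n - 1) * d.q n ≤ (o / d.q n + 1) * d.q n := Nat.mul_le_mul_right _ (by omega)
        rw [Nat.succ_mul] at this
        omega
      refine hur (d.rowAt n y t) (d.rowAt n y t) u (o % d.q n) (by omega) hi fun i hi' => ?_
      rw [← hocc i hi']
      split_ifs with h3
      · rw [← d.letter_copy t hy hg h3]
        congr 1
        omega
      · rw [← d.letter_copy t hy hg1 (by omega), Nat.succ_mul]
        congr 1
        omega
    refine ⟨y, o / d.q n, ⟨⟨hy, ?_⟩, hg⟩, by omega⟩
    apply word_injective hl hR3 n
    apply word_eq_of_letter_eq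
    intro i hi'
    rw [← hocc i hi', ← d.letter_copy t hy hg hi']
    congr 1
    omega
  · rintro ⟨y, g, ⟨⟨hy, hrow⟩, hg⟩, rfl⟩
    have h1 := (hbound y g hg).2
    have h2 : (y + 1) * (d.l n * d.q n) ≤ d.q n * d.k n * (d.l n * d.q n) :=
      Nat.mul_le_mul_right _ hy
    rw [← d.q_succ] at h2
    refine ⟨by omega, fun i hi => ?_⟩
    rw [d.letter_copy t hy hg hi, hrow]

end AbC

/-! ### Parsings -/

namespace Parsing

variable {A : Type}

/-- The starting positions of the blocks of a parsing, after a prefix of length `D`. -/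
def starts : ℕ → List (List A × List A) → List ℕ
  | _, [] => []
  | D, x :: r => (D + x.1.length) :: starts (D + x.1.length + x.2.length) r

/-- A parsing into blocks of the same length is determined by the starting positions. -/
theorem eq_of_starts_eq {q : ℕ} {xs xs' : List (List A × List A)} {s s' : List A} {D : ℕ}
    (hx : ∀ x ∈ xs, x.2.length = q) (hx' : ∀ x ∈ xs', x.2.length = q)
    (htot : total (xs, s) = total (xs', s')) (hst : starts D xs = starts D xs') :
    (xs, s) = (xs', s') := by
  induction xs generalizing xs' D with
  | nil =>
    cases xs' with
    | nil => simpa [total] using htot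
    | cons x' r' => simp [starts] at hst
  | cons x r ih =>
    cases xs' with
    | nil => simp [starts] at hst
    | cons x' r' =>
      simp only [starts, List.cons.injEq, Nat.add_left_cancel_iff] at hst
      have h2 : x.2.length = x'.2.length := by
        rw [hx x (by simp), hx' x' (by simp)]
      simp only [total, List.map_cons, List.flatten_cons, List.append_assoc] at htot
      obtain ⟨e1, e2⟩ := List.append_inj htot hst.1
      obtain ⟨e3, e4⟩ := List.append_inj e2 h2
      have := ih (fun x hx0 => hx x (by simp [hx0])) (fun x hx0 => hx' x (by simp [hx0])) e4
        (by have := hst.2; rwa [hst.1, h2] at this)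
      rw [Prod.mk.injEq] at this ⊢
      exact ⟨by rw [this.1, Prod.ext e1 e3], this.2⟩

theorem length_total {q : ℕ} (P : Parsing A) (h : ∀ w ∈ P.blocks, w.length = q) :
    P.total.length = P.spacerLength + P.1.length * q := by
  obtain ⟨xs, s⟩ := P
  induction xs with
  | nil => simp [total, spacerLength]
  | cons x r ih =>
    have h1 := ih fun w hw => h w (by simp only [blocks, List.map_cons, List.mem_cons] at hw ⊢; tauto)
    have h2 := h x.2 (by simp [blocks])
    simp only [total, spacerLength, List.map_cons, List.flatten_cons, List.length_append,
      List.sum_cons, List.length_cons, Nat.succ_mul] at h1 ⊢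
    omega

theorem infix_total (P : Parsing A) {w : List A} (h : w ∈ P.blocks) : w <:+: P.total := by
  obtain ⟨x, hx, rfl⟩ := List.mem_map.mp h
  obtain ⟨r₁, r₂, hr⟩ := List.append_of_mem hx
  refine ⟨(r₁.map fun x => x.1 ++ x.2).flatten ++ x.1,
    (r₂.map fun x => x.1 ++ x.2).flatten ++ P.2, ?_⟩
  simp [total, hr]

/-- Suppose that every occurrence in `S` of a word of `W` begins in one of the intervals
`[c g, c g + q)`, `g < N`, and at its left end if the next interval is not adjacent. Then the blocks
of a parsing with `N` blocks begin at the numbers `c g`. -/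
theorem starts_eq {W : Set (List A)} {q N : ℕ} (hW : ∀ w ∈ W, w.length = q) {S : List A}
    (c : ℕ → ℕ) (hc : ∀ g, c g + q ≤ c (g + 1))
    (hocc : ∀ p v s, v ∈ W → S = p ++ v ++ s → ∃ g < N, c g ≤ p.length ∧ p.length < c g + q ∧
      (p.length = c g ∨ g + 1 < N ∧ c (g + 1) = c g + q))
    {xs : List (List A × List A)} {pre s : List A} {g : ℕ} (hS : S = pre ++ total (xs, s))
    (hxs : ∀ x ∈ xs, x.2 ∈ W) (hg : ∀ g₀ < g, c g₀ + q ≤ pre.length) (hlen : N - g ≤ xs.length) :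
    N - g = xs.length ∧ starts pre.length xs = (List.range' g (N - g)).map c := by
  have hmono : Monotone c := monotone_nat_of_le_succ fun g => by have := hc g; omega
  induction xs generalizing pre g with
  | nil =>
    simp only [List.length_nil, Nat.le_zero] at hlen
    simp [hlen, starts]
  | cons x r ih =>
    have hx := hxs x (by simp)
    have hxl := hW _ hx
    have hS' : S = (pre ++ x.1) ++ x.2 ++ total (r, s) := by
      rw [hS]; simp [total]
    obtain ⟨g', hg'N, h1, h2, h3⟩ := hocc _ _ _ hx hS'
    simp only [List.length_append] at h1 h2 h3
    have hgg' : g ≤ g' := by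
      by_contra hcon
      have := hg g' (by omega)
      omega
    obtain ⟨h4, h5⟩ := ih (pre := pre ++ x.1 ++ x.2) (g := g' + 1) hS'
      (fun x hx => hxs x (by simp [hx]))
      (fun g₀ hg₀ => by
        have := hmono (Nat.lt_succ_iff.mp hg₀)
        simp only [List.length_append]
        omega)
      (by simp only [List.length_cons] at hlen; omega)
    simp only [List.length_cons] at hlen ⊢
    -- At least as many blocks as intervals are left and each block uses up a new interval, so none
    -- is skipped.
    have heq : g' = g := by omega
    subst heq
    refine ⟨by omega, ?_⟩
    have e1 : N - g' = (N - (g' + 1)) + 1 := by omega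
    simp only [List.length_append] at h5
    rw [starts, h5, e1, List.range'_succ, List.map_cons]
    congr 1
    -- If the next interval is adjacent, the next block begins at its left end, so the present block
    -- cannot reach beyond that point and is not displaced.
    rcases h3 with h3 | ⟨h3, h6⟩
    · exact h3
    · cases r with
      | nil => simp at h4; omega
      | cons x' r' =>
        have e2 : N - (g' + 1) = (N - (g' + 2)) + 1 := by omega
        rw [e2, List.range'_succ, List.map_cons, starts, List.cons.injEq] at h5
        have := h5.1
        omega

end Parsing

namespace AbC

variable {d : AbC}

/-- The parsing of the factors with indices in a list, after a spacer `pend`. -/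
def factorParsing (d : AbC) (n : ℕ) (t : Fin (d.s (n + 1))) :
    List (Letter (Fin (d.s 0))) → List ℕ → Parsing (Letter (Fin (d.s 0)))
  | pend, [] => ([], pend)
  -- The letters e at the end of a factor and the letters b at the start of the next one form a
  -- single spacer; `pend` carries the former.
  | pend, y :: ys =>
    ((pend ++ List.replicate (d.q n - d.offset n y) Letter.b, d.word n (d.rowAt n y t)) ::
        (List.replicate (d.l n - 2) ([], d.word n (d.rowAt n y t)) ++
          (factorParsing d n t (List.replicate (d.offset n y) Letter.e) ys).1),
      (factorParsing d n t (List.replicate (d.offset n y) Letter.e) ys).2)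

theorem total_factorParsing (hl : ∀ n, 2 ≤ d.l n) (n : ℕ) (t : Fin (d.s (n + 1)))
    (pend : List (Letter (Fin (d.s 0)))) (ys : List ℕ) :
    (d.factorParsing n t pend ys).total = pend ++ ys.flatMap
      (d.factor n fun x => if x < d.k n then d.word n (d.rowAt n x t) else []) := by
  induction ys generalizing pend with
  | nil => simp [factorParsing, Parsing.total]
  | cons y ys ih =>
    have h := ih (List.replicate (d.offset n y) Letter.e)
    have hx : y % d.k n < d.k n := Nat.mod_lt _ (d.k_pos n)
    have e : d.l n - 1 = (d.l n - 2) + 1 := by have := hl n; omega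
    rw [Parsing.total] at h ⊢
    simp only [factorParsing, List.map_cons, List.map_append, List.flatten_cons,
      List.flatten_append, List.append_assoc, List.map_replicate, List.nil_append] at h ⊢
    rw [h, List.flatMap_cons, TwistCoeff.factor, if_pos hx, rowAt_mod, e, List.replicate_succ,
      List.flatten_cons]
    simp only [List.append_assoc]

theorem blocks_factorParsing (hl : ∀ n, 2 ≤ d.l n) (n : ℕ) (t : Fin (d.s (n + 1)))
    (pend : List (Letter (Fin (d.s 0)))) (ys : List ℕ) :
    (d.factorParsing n t pend ys).blocks =
      ys.flatMap fun y => List.replicate (d.l n - 1) (d.word n (d.rowAt n y t)) := by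
  induction ys generalizing pend with
  | nil => simp [factorParsing, Parsing.blocks]
  | cons y ys ih =>
    have h := ih (List.replicate (d.offset n y) Letter.e)
    have e : d.l n - 1 = (d.l n - 2) + 1 := by have := hl n; omega
    rw [Parsing.blocks] at h ⊢
    simp only [factorParsing, List.map_cons, List.map_append, List.map_replicate]
    rw [h, List.flatMap_cons]
    conv_rhs => rw [e, List.replicate_succ]
    rw [← e]
    rfl

/-- The bounds for the proportion of spacers in the parsings. -/
noncomputable def eps (d : AbC) : ℕ → ℝ
  | 0 => 1
  | n + 1 => 1 / (d.l n : ℝ) + 1 / (d.q (n + 1) : ℝ)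

theorem two_pow_le_q (n : ℕ) : 2 ^ n ≤ d.q n := by
  induction n with
  | zero => exact d.q_pos 0
  | succ n ih =>
    have := d.two_mul_q_le n
    rw [pow_succ]
    omega

theorem summable_inv_q : Summable fun n => 1 / (d.q n : ℝ) := by
  refine Summable.of_nonneg_of_le (fun n => by positivity) (fun n => ?_) summable_geometric_two
  rw [div_pow, one_pow]
  refine one_div_le_one_div_of_le (by positivity) ?_
  exact_mod_cast two_pow_le_q n

/-- A parsing satisfies the bound for the spacers if and only if it has at least
`q n * k n * (l n - 1)` blocks. -/
theorem isParsing_iff {n : ℕ} (t : Fin (d.s (n + 1)))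
    (P : Parsing (Letter (Fin (d.s 0)))) :
    IsParsing (d.words n) (d.eps (n + 1)) (d.word (n + 1) t) P ↔
      P.total = d.word (n + 1) t ∧ (∀ w ∈ P.blocks, w ∈ d.words n) ∧
        d.q n * d.k n * (d.l n - 1) ≤ P.1.length := by
  unfold IsParsing
  refine and_congr_right fun h1 => and_congr_right fun h2 => ?_
  have hlen := P.length_total (q := d.q n) fun w hw => by
    obtain ⟨u, rfl⟩ := h2 w hw
    exact d.length_word n u
  rw [h1, length_word] at hlen
  have hq := d.q_pos n
  have hq' := d.q_pos (n + 1)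
  have hl := d.l_pos n
  -- The first summand counts the letters in copies, the second the spacers, q n in each factor. The
  -- term 1 / q (n+1) in `eps` allows exactly this many spacers under a strict inequality.
  have hsucc : d.q (n + 1) = d.q n * d.k n * (d.l n - 1) * d.q n + d.q n * d.k n * d.q n := by
    rw [d.q_succ, ← d.pred_l_mul_q]; ring
  have hsucc' : d.q (n + 1) = d.q n * d.k n * d.q n * d.l n := by
    rw [d.q_succ]; ring
  have e : d.eps (n + 1) * d.q (n + 1) = ((d.q n * d.k n * d.q n + 1 : ℕ) : ℝ) := by
    rw [eps, add_mul, one_div_mul_cancel (by positivity)]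
    conv_lhs => rw [hsucc']
    push_cast
    field_simp
  rw [length_word, div_lt_iff₀ (by exact_mod_cast hq'), e, Nat.cast_lt]
  constructor
  · intro h
    refine Nat.le_of_mul_le_mul_right (?_ : _ * d.q n ≤ _) hq
    omega
  · intro h
    have := Nat.mul_le_mul_right (d.q n) h
    omega

/-- Displaced occurrences inside a run are not excluded, as unique readability is not assumed. A
parsing has at least as many blocks as there are copies, however, and `Parsing.starts_eq` then puts
every block on a copy. -/
theorem existsUnique_parsing (hl : ∀ n, 2 ≤ d.l n) (n : ℕ) (t : Fin (d.s (n + 1))) :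
    IsParsing (d.words n) (d.eps (n + 1)) (d.word (n + 1) t)
        (d.factorParsing n t [] (List.range (d.q n * d.k n))) ∧
      ∀ P, IsParsing (d.words n) (d.eps (n + 1)) (d.word (n + 1) t) P →
        P = d.factorParsing n t [] (List.range (d.q n * d.k n)) := by
  have hq := d.q_pos n
  have hl1 : 0 < d.l n - 1 := by have := hl n; omega
  have hcan : IsParsing (d.words n) (d.eps (n + 1)) (d.word (n + 1) t)
        (d.factorParsing n t [] (List.range (d.q n * d.k n))) := by
    rw [isParsing_iff]
    have hb := blocks_factorParsing hl n t [] (List.range (d.q n * d.k n))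
    refine ⟨?_, ?_, ?_⟩
    · rw [total_factorParsing hl, word_succ, TwistCoeff.twist_eq_flatMap]
      rfl
    · rw [hb]
      intro w hw
      obtain ⟨y, -, hy⟩ := List.mem_flatMap.mp hw
      rw [List.eq_of_mem_replicate hy]
      exact ⟨_, rfl⟩
    · have := congrArg List.length hb
      rw [Parsing.blocks, List.length_map,
        List.length_flatMap_range (L := d.l n - 1) _ _ (fun _ _ => List.length_replicate)] at this
      exact this.ge
  refine ⟨hcan, ?_⟩
  -- The left ends of all copies in increasing order, l n - 1 of them in each factor.
  obtain ⟨c, hc0⟩ : ∃ c : ℕ → ℕ, ∀ y g, g < d.l n - 1 →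
      c (y * (d.l n - 1) + g) = d.runStart n y + g * d.q n := by
    refine ⟨fun g => d.runStart n (g / (d.l n - 1)) + g % (d.l n - 1) * d.q n, fun y g hg => ?_⟩
    dsimp only
    rw [mul_comm y, Nat.mul_add_div hl1, Nat.div_eq_of_lt hg, add_zero, Nat.mul_add_mod,
      Nat.mod_eq_of_lt hg]
  have hc : ∀ g, c g + d.q n ≤ c (g + 1) := by
    intro G
    obtain ⟨y, g, hg, rfl⟩ : ∃ y g, g < d.l n - 1 ∧ G = y * (d.l n - 1) + g :=
      ⟨_, _, Nat.mod_lt _ hl1, (Nat.div_add_mod' _ _).symm⟩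
    rcases lt_or_ge (g + 1) (d.l n - 1) with h | h
    · rw [hc0 y g hg, add_assoc (y * (d.l n - 1)), hc0 y (g + 1) h, Nat.succ_mul]
      omega
    · have e : y * (d.l n - 1) + g + 1 = (y + 1) * (d.l n - 1) + 0 := by rw [Nat.succ_mul]; omega
      have e2 : g + 1 = d.l n - 1 := by omega
      have h1 := d.runStart_add_run n y
      have h2 := d.offset_lt n (y + 1)
      rw [hc0 y g hg, e, hc0 _ _ hl1, add_assoc, ← Nat.succ_mul, Nat.succ_eq_add_one, e2]
      conv_rhs => rw [TwistCoeff.runStart]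
      omega
  have key : ∀ P, IsParsing (d.words n) (d.eps (n + 1)) (d.word (n + 1) t) P →
      Parsing.starts 0 P.1 = (List.range' 0 (d.q n * d.k n * (d.l n - 1) - 0)).map c ∧
        ∀ x ∈ P.1, x.2.length = d.q n := by
    intro P hP
    rw [isParsing_iff] at hP
    obtain ⟨h1, h2, h3⟩ := hP
    have h4 : ∀ x ∈ P.1, x.2 ∈ d.words n := fun x hx => h2 _ (List.mem_map_of_mem hx)
    have hW : ∀ w ∈ d.words n, w.length = d.q n := by
      rintro _ ⟨u, rfl⟩; exact d.length_word n u
    refine ⟨(Parsing.starts_eq (S := d.word (n + 1) t) hW c hc ?_ (pre := []) (s := P.2) (g := 0)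
      h1.symm h4 (by simp) (by simpa using h3)).2,
      fun x hx => hW _ (h4 x hx)⟩
    rintro p _ s ⟨u, rfl⟩ hS
    have hlen := congrArg List.length hS
    simp only [List.length_append, length_word] at hlen
    obtain ⟨y, hy, h5, h6⟩ := occurrence_in_run hl t u (P := p.length) (by omega) fun i hi => by
      apply Option.some_injective
      rw [← d.getElem?_word t (by omega), ← d.getElem?_word u hi, hS, List.append_assoc,
        List.getElem?_append_right (by omega), Nat.add_sub_cancel_left,
        List.getElem?_append_left (by rwa [length_word])]
    obtain ⟨o, ho⟩ := Nat.exists_eq_add_of_le h5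
    have e := Nat.div_add_mod' o (d.q n)
    have hi : o % d.q n < d.q n := Nat.mod_lt _ hq
    have hg : o / d.q n < d.l n - 1 := (Nat.div_lt_iff_lt_mul hq).mpr (by omega)
    have hN : (y + 1) * (d.l n - 1) ≤ d.q n * d.k n * (d.l n - 1) := Nat.mul_le_mul_right _ hy
    rw [Nat.succ_mul] at hN
    refine ⟨y * (d.l n - 1) + o / d.q n, by omega, by rw [hc0 _ _ hg]; omega,
      by rw [hc0 _ _ hg]; omega, ?_⟩
    rcases Nat.eq_zero_or_pos (o % d.q n) with h0 | h0
    · left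
      rw [hc0 _ _ hg]
      omega
    · right
      have hg1 : o / d.q n + 1 < d.l n - 1 := by
        by_contra hcon
        have : (d.l n - 1) * d.q n ≤ (o / d.q n + 1) * d.q n := Nat.mul_le_mul_right _ (by omega)
        rw [Nat.succ_mul] at this
        omega
      refine ⟨by omega, ?_⟩
      rw [hc0 _ _ hg, add_assoc (y * (d.l n - 1)), hc0 _ _ hg1, Nat.succ_mul]
      omega
  intro P hP
  obtain ⟨k1, k2⟩ := key P hP
  obtain ⟨k3, k4⟩ := key _ hcan
  exact Parsing.eq_of_starts_eq (D := 0) k2 k4 (hP.1.trans hcan.1.symm) (k1.trans k3.symm)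

theorem count_factorParsing (hl : ∀ n, 2 ≤ d.l n) (hR2 : d.R2) (hR3 : d.R3) (n : ℕ)
    (t : Fin (d.s (n + 1))) (u : Fin (d.s n)) :
    (d.factorParsing n t [] (List.range (d.q n * d.k n))).blocks.count (d.word n u) =
      d.q n * (d.k n / d.s n) * (d.l n - 1) := by
  rw [blocks_factorParsing hl, ← card_rowAt hR2 n t u, List.count_flatMap, Finset.card_filter,
    Finset.sum_mul, Finset.sum_range, ← List.sum_ofFn, List.ofFn_eq_map, ← List.map_coe_finRange_eq_range,
    List.map_map]
  congr 1
  refine List.map_congr_left fun y _ => ?_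
  simp only [Function.comp, List.count_replicate, beq_iff_eq, ite_mul, one_mul, zero_mul]
  exact if_congr (word_injective hl hR3 n).eq_iff rfl rfl

theorem isConstructionSequence (hl : ∀ n, 2 ≤ d.l n) (hsum : Summable fun n => 1 / (d.l n : ℝ))
    (hC : ∀ n, d.s n ^ 2 ∣ d.C n) (hR2 : d.R2) (hR3 : d.R3) :
    IsConstructionSequence d.words d.q d.eps where
  length_eq := by
    rintro n _ ⟨t, rfl⟩
    exact d.length_word n t
  occurs := by
    rintro n _ ⟨u, rfl⟩ _ ⟨t, rfl⟩
    rw [← (existsUnique_parsing hl n t).1.1]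
    apply Parsing.infix_total
    rw [← List.count_pos_iff, count_factorParsing hl hR2 hR3]
    exact Nat.mul_pos (q_mul_k_div_s_pos hC n) (by have := hl n; omega)
  eps_pos n := by
    cases n with
    | zero => exact one_pos
    | succ n =>
      have h1 : (0 : ℝ) < d.l n := by exact_mod_cast d.l_pos n
      have h2 : (0 : ℝ) < d.q (n + 1) := by exact_mod_cast d.q_pos (n + 1)
      unfold eps
      positivity
  eps_summable := by
    rw [← summable_nat_add_iff 1]
    exact hsum.add ((summable_nat_add_iff 1).mpr summable_inv_q)
  parsing := by
    rintro n _ ⟨t, rfl⟩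
    exact ⟨_, existsUnique_parsing hl n t⟩

theorem isStronglyUniformParsed (hl : ∀ n, 2 ≤ d.l n) (hC : ∀ n, d.s n ^ 2 ∣ d.C n)
    (hR2 : d.R2) (hR3 : d.R3) : IsStronglyUniformParsed d.words d.eps := by
  refine fun n => ⟨d.q n * (d.k n / d.s n) * (d.l n - 1),
    Nat.mul_pos (q_mul_k_div_s_pos hC n) (by have := hl n; omega), ?_⟩
  rintro _ ⟨t, rfl⟩ P hP _ ⟨u, rfl⟩
  rw [(existsUnique_parsing hl n t).2 P hP]
  exact count_factorParsing hl hR2 hR3 n t u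

/-- The existential quantifier over pre-words in the definition is harmless, because the injectivity
of the twisting operator determines them from the words. -/
theorem isTwisted_iff (hl : ∀ n, 2 ≤ d.l n) (hsum : Summable fun n => 1 / (d.l n : ℝ))
    (hC : ∀ n, d.s n ^ 2 ∣ d.C n) (hR2 : d.R2) (hR3 : d.R3) :
    d.IsTwisted d.words ↔ ∀ n, UniquelyReadable (d.rowWords n) := by
  constructor
  · rintro ⟨-, -, P, hP, hur⟩ n
    rw [← uniquelyReadable_preWords_iff hl hR3, ← eq_preWords_of_isBuiltFrom hl hP]
    exact hur n
  · intro h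
    exact ⟨hsum, ⟨_, isConstructionSequence hl hsum hC hR2 hR3⟩, _, isBuiltFrom_preWords,
      fun n => (uniquelyReadable_preWords_iff hl hR3 n).mpr (h n)⟩

end AbC


/-! ### Intervals of equal length -/

/-- The index of the interval `[i/N, (i+1)/N)` that contains `x`. -/
noncomputable def cellIndex (N : ℕ) (x : I01) : ℕ := ⌊(N : ℝ) * (x : ℝ)⌋₊

theorem cell_fst (N : ℕ) [NeZero N] (x : I01) : ((cell N x).1 : ℕ) = cellIndex N x := rfl

theorem cellIndex_lt {N : ℕ} (hN : 0 < N) (x : I01) : cellIndex N x < N := by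
  have : NeZero N := ⟨hN.ne'⟩
  rw [← cell_fst]
  exact (cell N x).1.2

theorem cellIndex_mul (N D : ℕ) [NeZero N] (x : I01) :
    cellIndex (N * D) x = cellIndex N x * D + cellIndex D (cell N x).2 := by
  have h0 : 0 ≤ (N : ℝ) * (x : ℝ) := mul_nonneg (Nat.cast_nonneg _) x.2.1
  unfold cellIndex
  have e : ((N * D : ℕ) : ℝ) * (x : ℝ) =
      (D : ℝ) * ((cell N x).2 : ℝ) + ((⌊(N : ℝ) * (x : ℝ)⌋₊ * D : ℕ) : ℝ) := by
    show _ = (D : ℝ) * Int.fract ((N : ℝ) * (x : ℝ)) + _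
    have := Int.floor_add_fract ((N : ℝ) * (x : ℝ))
    rw [← natCast_floor_eq_intCast_floor h0] at this
    push_cast
    linear_combination -(D : ℝ) * this
  rw [e, Nat.floor_add_natCast (mul_nonneg (Nat.cast_nonneg _) (cell N x).2.2.1), add_comm]

theorem cellIndex_mul_eq_iff (N D : ℕ) [NeZero N] (hD : 0 < D) (x x' : I01) :
    cellIndex (N * D) x = cellIndex (N * D) x' ↔ (cell N x).1 = (cell N x').1 ∧
      cellIndex D (cell N x).2 = cellIndex D (cell N x').2 := by
  have h1 := cellIndex_lt hD (cell N x).2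
  have h2 := cellIndex_lt hD (cell N x').2
  rw [cellIndex_mul, cellIndex_mul, Fin.ext_iff, cell_fst, cell_fst]
  constructor
  · intro h
    have e1 := congrArg (· / D) h
    simp only [mul_comm _ D, Nat.mul_add_div hD, Nat.div_eq_of_lt h1, Nat.div_eq_of_lt h2,
      add_zero] at e1
    rw [e1] at h
    exact ⟨e1, by omega⟩
  · rintro ⟨e1, e2⟩
    rw [e1, e2]

theorem cellIndex_mul_div {N D : ℕ} [NeZero N] (hD : 0 < D) (x : I01) :
    cellIndex (N * D) x / D = cellIndex N x := by
  rw [cellIndex_mul, mul_comm _ D, Nat.mul_add_div hD,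
    Nat.div_eq_of_lt (cellIndex_lt hD _), add_zero]

theorem cellIndex_mul_mod {N D : ℕ} [NeZero N] (hD : 0 < D) (x : I01) :
    cellIndex (N * D) x % D = cellIndex D (cell N x).2 := by
  rw [cellIndex_mul, mul_comm _ D, Nat.mul_add_mod, Nat.mod_eq_of_lt (cellIndex_lt hD _)]

theorem cellIndex_rot {q : ℕ} (hq : 0 < q) (p : ℕ) (x : I01) :
    cellIndex q (rot ((p : ℝ) / q) x) = (cellIndex q x + p) % q := by
  have hq' : (0 : ℝ) < q := Nat.cast_pos.mpr hq
  have hx : 0 ≤ (x : ℝ) := x.2.1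
  have hy : 0 ≤ (x : ℝ) + (p : ℝ) / q := by positivity
  show ⌊(q : ℝ) * Int.fract ((x : ℝ) + (p : ℝ) / q)⌋₊ = _
  have e1 : ⌊(q : ℝ) * ((x : ℝ) + (p : ℝ) / q)⌋₊ = cellIndex q x + p := by
    rw [mul_add, mul_div_cancel₀ _ hq'.ne', Nat.floor_add_natCast (by positivity)]
    rfl
  have e2 : (cellIndex q x + p) / q = ⌊(x : ℝ) + (p : ℝ) / q⌋₊ := by
    rw [← e1, ← Nat.floor_div_natCast, mul_div_cancel_left₀ _ hq'.ne']
  have e3 : (q : ℝ) * Int.fract ((x : ℝ) + (p : ℝ) / q) =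
      (q : ℝ) * ((x : ℝ) + (p : ℝ) / q) - ((q * ((cellIndex q x + p) / q) : ℕ) : ℝ) := by
    rw [Int.fract, e2, ← natCast_floor_eq_intCast_floor hy]
    push_cast
    ring
  rw [e3, Nat.floor_sub_natCast, e1, Nat.mod_eq_sub]

/-! ### Levels and towers -/

theorem TwistCoeff.j_mul_p (c : TwistCoeff) {n i : ℕ} (hi : i < c.q n) :
    (c.j n i * c.p n) % c.q n = i := by
  apply c.eq_of_cast_eq (Nat.mod_lt _ (c.q_pos n)) hi
  rw [ZMod.natCast_mod]
  push_cast [c.j_cast]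
  rw [mul_right_comm, mul_comm (c.p n : ZMod (c.q n))⁻¹, c.p_mul_inv, one_mul]

namespace AbC

variable (d : AbC)

/-- The level of a point in the towers of stage `n`. -/
noncomputable def level (n : ℕ) (z : Sq) : ℕ := d.j n (cellIndex (d.q n) ((d.H n).symm z).1)

/-- The index of the tower of stage `n` that contains a point. -/
noncomputable def tower (n : ℕ) (z : Sq) : Fin (d.s n) := (cell (d.s n) ((d.H n).symm z).2).1

theorem level_lt (n : ℕ) (z : Sq) : d.level n z < d.q n := d.j_lt _ _

/-- The rotation adds p n to the index of the interval and `j` divides by p n modulo q n, so the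
level counts time along the periodic orbit. -/
theorem level_T (n : ℕ) (z : Sq) : d.level n (d.T n z) = (d.level n z + 1) % d.q n := by
  have e : (d.H n).symm (d.T n z) = rotSq (d.α n) ((d.H n).symm z) := by simp [T]
  have e2 : ((d.H n).symm (d.T n z)).1 = rot ((d.p n : ℝ) / d.q n) ((d.H n).symm z).1 := by
    rw [e]; rfl
  apply d.eq_of_cast_eq (d.level_lt _ _) (Nat.mod_lt _ (d.q_pos n))
  rw [level, e2, cellIndex_rot (d.q_pos n), d.j_mod, ZMod.natCast_mod, level]
  push_cast [d.j_cast]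
  rw [mul_add, mul_comm _ (d.p n : ZMod (d.q n)), d.p_mul_inv]

theorem tower_T (n : ℕ) (z : Sq) : d.tower n (d.T n z) = d.tower n z := by
  have e : (d.H n).symm (d.T n z) = rotSq (d.α n) ((d.H n).symm z) := by simp [T]
  rw [tower, e]
  rfl

theorem level_T_pow (n i : ℕ) (z : Sq) :
    d.level n ((d.T n ^ i) z) = (d.level n z + i) % d.q n := by
  induction i with
  | zero => simp [Nat.mod_eq_of_lt (d.level_lt n z)]
  | succ i ih => rw [pow_succ', Equiv.Perm.mul_apply, level_T, ih, Nat.mod_add_mod, add_assoc]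

theorem tower_T_pow (n i : ℕ) (z : Sq) : d.tower n ((d.T n ^ i) z) = d.tower n z := by
  induction i with
  | zero => simp
  | succ i ih => rw [pow_succ', Equiv.Perm.mul_apply, tower_T, ih]

theorem level_tower_of_mem_tower {n i : ℕ} {t : Fin (d.s n)} {z : Sq} (hi : i < d.q n)
    (hz : z ∈ (d.T n ^ i) '' d.towerBase n t) : d.level n z = i ∧ d.tower n z = t := by
  obtain ⟨_, ⟨w, ⟨h1, h2⟩, rfl⟩, rfl⟩ := hz
  rw [level_T_pow, tower_T_pow]
  constructor
  · have : cellIndex (d.q n) w.1 = 0 := by rw [← cell_fst, h1]; rfl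
    rw [level, Equiv.symm_apply_apply, this, d.j_zero, zero_add, Nat.mod_eq_of_lt hi]
  · rw [tower, Equiv.symm_apply_apply]
    exact h2

theorem grid_h (n : ℕ) (z : Sq) :
    d.grid n (d.h n z) = d.rowPerm n (d.twistPerm n (d.grid n z)) := by
  simp [h]

theorem h_H_succ_symm (n : ℕ) (z : Sq) : d.h n ((d.H (n + 1)).symm z) = (d.H n).symm z := by
  simp [H]

variable {d}

/-- The levels and towers of stage `n` in terms of those of stage `n + 1`. -/
theorem level_tower_succ (hR1 : d.R1) (n : ℕ) (z : Sq) {y o : ℕ} (hy : y < d.q n * d.k n)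
    (ho : o < d.l n * d.q n) (hJ : d.level (n + 1) z = y * (d.l n * d.q n) + o) :
    d.level n z = (o + d.offset n y) % d.q n ∧
      d.tower n z = d.rowAt n y (d.tower (n + 1) z) := by
  have hq := d.q_pos n
  have hk := d.k_pos n
  have hlq := d.lq_pos n
  set z' := (d.H (n + 1)).symm z with hz'
  have hh : d.h n z' = (d.H n).symm z := d.h_H_succ_symm n z
  have hgrid := d.grid_h n z'
  rw [hh] at hgrid
  obtain ⟨m, x, hx, rfl⟩ : ∃ m x, x < d.k n ∧ y = m * d.k n + x :=
    ⟨y / d.k n, y % d.k n, Nat.mod_lt _ hk, (Nat.div_add_mod' _ _).symm⟩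
  have hm : m < d.q n := by
    by_contra hcon
    have : d.q n * d.k n ≤ m * d.k n := Nat.mul_le_mul_right _ (by omega)
    omega
  set J := d.level (n + 1) z with hJdef
  -- the column of the point
  have hcol : cellIndex (d.q (n + 1)) z'.1 =
      (((J * d.p n + m) % d.q n) * d.k n + x) * (d.l n * d.q n) + o := by
    rw [← d.j_mul_p (cellIndex_lt (d.q_pos (n + 1)) z'.1)]
    show (J * d.p (n + 1)) % d.q (n + 1) = _
    have hp : d.p (n + 1) = d.p n * (d.k n * (d.l n * d.q n)) + 1 := by
      show d.p n * d.k n * d.l n * d.q n + 1 = _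
      ring
    -- The summand 1 in p (n+1) leaves the position inside a fundamental domain; the rest, together
    -- with the period m, selects the domain.
    have e1 : J * d.p (n + 1) = (J * d.p n + m) * (d.k n * (d.l n * d.q n)) +
        (x * (d.l n * d.q n) + o) := by
      rw [hp, mul_add, mul_one]
      conv_lhs => rw [hJ]
      conv_rhs => rw [hJ]
      ring
    have e2 : d.q (n + 1) = d.k n * (d.l n * d.q n) * d.q n := by rw [d.q_succ]; ring
    have hlt : x * (d.l n * d.q n) + o < d.k n * (d.l n * d.q n) := by
      have := Nat.mul_le_mul_right (d.l n * d.q n) hx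
      rw [Nat.succ_mul] at this
      omega
    rw [e1, e2, Nat.mod_mul, mul_comm (J * d.p n + m), Nat.mul_add_mod, Nat.mod_eq_of_lt hlt,
      Nat.mul_add_div (by positivity), Nat.div_eq_of_lt hlt, add_zero]
    ring
  have hcol2 : cellIndex (d.q n * d.k n) z'.1 = ((J * d.p n + m) % d.q n) * d.k n + x := by
    have : NeZero (d.q n * d.k n) := ⟨(Nat.mul_pos hq hk).ne'⟩
    have := cellIndex_mul_div (N := d.q n * d.k n) hlq z'.1
    rw [← d.q_succ, hcol, mul_comm _ (d.l n * d.q n), Nat.mul_add_div hlq, Nat.div_eq_of_lt ho,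
      add_zero] at this
    exact this.symm
  have hi₁ : cellIndex (d.q n) z'.1 = (J * d.p n + m) % d.q n := by
    rw [← cellIndex_mul_div hk, hcol2, mul_comm _ (d.k n), Nat.mul_add_div hk,
      Nat.div_eq_of_lt hx, add_zero]
  have hx' : (cell (d.k n) (cell (d.q n) z'.1).2).1 = Fin.ofNat (d.k n) x := by
    ext
    rw [cell_fst, ← cellIndex_mul_mod hk, hcol2, mul_comm _ (d.k n), Nat.mul_add_mod]
    rfl
  have hymod : (m * d.k n + x) % d.k n = x := by
    rw [mul_comm, Nat.mul_add_mod, Nat.mod_eq_of_lt hx]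
  have hydiv : (m * d.k n + x) / d.k n = m := by
    rw [mul_comm, Nat.mul_add_div hk, Nat.div_eq_of_lt hx, add_zero]
  constructor
  · have h1 : (cell (d.q n) ((d.H n).symm z).1).1 = (cell (d.q n) z'.1).1 +
        Fin.ofNat (d.q n) (d.a n (((cell (d.k n) (cell (d.q n) z'.1).2).1 : ℕ) / d.C n)) :=
      congrArg (fun w => w.1.1) hgrid
    have h2 : cellIndex (d.q n) ((d.H n).symm z).1 =
        ((J * d.p n + m) % d.q n + d.a n (x / d.C n) % d.q n) % d.q n := by
      rw [← cell_fst, h1, Fin.val_add, cell_fst, hi₁, hx']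
      simp [Fin.ofNat, Nat.mod_eq_of_lt hx]
    apply d.eq_of_cast_eq (d.level_lt _ _) (Nat.mod_lt _ hq)
    -- The factor length l n * q n vanishes modulo q n. Dividing J * p n + m plus the translation
    -- number by p n therefore gives o + j n m + ψ n, which is o plus the offset.
    have hJo : (J : ZMod (d.q n)) = o := by
      rw [hJ]; push_cast; simp
    rw [level, h2, d.j_cast, TwistCoeff.offset, hymod, hydiv, d.ψ_eq]
    push_cast [d.j_cast, ZMod.natCast_mod]
    rw [hJo]
    linear_combination (o : ZMod (d.q n)) * d.p_mul_inv n
  · have h1 : (cell (d.s (n + 1)) ((d.H n).symm z).2).1 =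
        (d.σ n ((cell (d.k n) (cell (d.q n) z'.1).2).1, (cell (d.s (n + 1)) z'.2).1)).2 :=
      congrArg (fun w => w.2.1) hgrid
    rw [← d.rowAt_mod, hymod]
    ext
    obtain ⟨D, hD⟩ := hR1.1 n
    have hDpos : 0 < D := Nat.pos_of_ne_zero fun h0 => by
      have := d.s_pos (n + 1)
      rw [hD, h0, mul_zero] at this
      omega
    show cellIndex (d.s n) ((d.H n).symm z).2 =
      ((d.σ n (Fin.ofNat (d.k n) x, (cell (d.s (n + 1)) z'.2).1)).2 : ℕ) * d.s n / d.s (n + 1)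
    rw [← hx', ← h1, cell_fst]
    conv_rhs => rw [hD]
    rw [mul_comm (cellIndex _ _), Nat.mul_div_mul_left _ _ (d.s_pos n), cellIndex_mul_div hDpos]

/-! ### The letters of the points -/

/-- The letter that the towers of stage `n` assign to a point. -/
noncomputable def stageLetter (d : AbC) (n : ℕ) (z : Sq) : Letter (Fin (d.s 0)) :=
  d.letter n (d.tower n z) (d.level n z)

theorem getElem?_spacerPattern {n y o : ℕ} (hy : y < d.q n * d.k n) (ho : o < d.l n * d.q n) :
    (d.spacerPattern n)[y * (d.l n * d.q n) + o]? =
      if o < d.q n - d.offset n y then some Letter.b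
      else if o < d.l n * d.q n - d.offset n y then some (Letter.sym ())
      else some Letter.e := by
  rw [spacerPattern, d.getElem?_twist (fun _ _ => List.length_replicate) hy ho,
    List.getElem?_replicate, if_pos (Nat.mod_lt _ (d.q_pos n))]

theorem mem_newB_iff {n y o : ℕ} {z : Sq} (hy : y < d.q n * d.k n) (ho : o < d.l n * d.q n)
    (hJ : d.level (n + 1) z = y * (d.l n * d.q n) + o) :
    z ∈ d.newB n ↔ o < d.q n - d.offset n y := by
  rw [newB, Equiv.image_eq_preimage_symm]
  show d.stageLabel n ((d.H (n + 1)).symm z) = some Letter.b ↔ _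
  have e : d.stageLabel n ((d.H (n + 1)).symm z) = (d.spacerPattern n)[d.level (n + 1) z]? := rfl
  rw [e, hJ, getElem?_spacerPattern hy ho]
  split_ifs <;> simp [*]

theorem mem_newE_iff {n y o : ℕ} {z : Sq} (hy : y < d.q n * d.k n) (ho : o < d.l n * d.q n)
    (hJ : d.level (n + 1) z = y * (d.l n * d.q n) + o) :
    z ∈ d.newE n ↔ d.l n * d.q n - d.offset n y ≤ o := by
  have h1 : d.q n ≤ d.l n * d.q n := Nat.le_mul_of_pos_left _ (d.l_pos n)
  rw [newE, Equiv.image_eq_preimage_symm]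
  show d.stageLabel n ((d.H (n + 1)).symm z) = some Letter.e ↔ _
  have e : d.stageLabel n ((d.H (n + 1)).symm z) = (d.spacerPattern n)[d.level (n + 1) z]? := rfl
  rw [e, hJ, getElem?_spacerPattern hy ho]
  split_ifs <;> simp <;> omega

/-- The letters of the words and the levels of the points obey the same case distinction with the
same shift by the offset, so the two descriptions match. -/
theorem stageLetter_succ (hR1 : d.R1) (n : ℕ) (z : Sq) :
    (z ∈ d.newB n → d.stageLetter (n + 1) z = Letter.b) ∧
      (z ∈ d.newE n → d.stageLetter (n + 1) z = Letter.e ∧ z ∉ d.newB n) ∧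
      (z ∉ d.newB n ∪ d.newE n → d.stageLetter (n + 1) z = d.stageLetter n z) := by
  obtain ⟨y, o, hy, ho, hJ⟩ := d.exists_factor_pos (d.level_lt (n + 1) z)
  have h1 : d.q n ≤ d.l n * d.q n := Nat.le_mul_of_pos_left _ (d.l_pos n)
  obtain ⟨h2, h3⟩ := level_tower_succ hR1 n z hy ho hJ
  rw [Set.mem_union, mem_newB_iff hy ho hJ, mem_newE_iff hy ho hJ, stageLetter, stageLetter, hJ, h2,
    h3, d.letter_succ _ hy ho]
  refine ⟨fun h => by rw [if_pos h], fun h => ?_, fun h => ?_⟩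
  · rw [if_neg (by omega), if_neg (by omega)]
    exact ⟨rfl, by omega⟩
  · rw [if_neg (by omega), if_pos (by omega)]

/-- The letter of a point that is not labelled after stage `n`. -/
theorem partitionLabel_eq (hR1 : d.R1) (n : ℕ) (z : Sq)
    (h : ∀ m, n ≤ m → z ∉ d.newB m ∪ d.newE m) : d.partitionLabel z = d.stageLetter n z := by
  induction n with
  | zero =>
    have hB : z ∉ d.setB := fun ⟨m, hm, _⟩ => h m (Nat.zero_le _) (Or.inl hm)
    have hE : z ∉ d.setE := fun ⟨m, hm, _⟩ => h m (Nat.zero_le _) (Or.inr hm)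
    rw [partitionLabel, if_neg hB, if_neg hE, stageLetter,
      Nat.lt_one_iff.mp (d.level_lt 0 z), letter_zero]
    rfl
  | succ n ih =>
    obtain ⟨h1, h2, h3⟩ := stageLetter_succ hR1 n z
    -- No later stage labels the point, so a label given here is the last one; if there is none, the
    -- letter is that of the preceding stage.
    by_cases hb : z ∈ d.newB n
    · rw [h1 hb, partitionLabel, if_pos ⟨n, hb, h⟩]
    by_cases he : z ∈ d.newE n
    · have hB : z ∉ d.setB := by
        rintro ⟨m, hm, hm'⟩
        rcases lt_trichotomy m n with hlt | heq | hlt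
        · exact hm' n hlt (Or.inr he)
        · exact hb (heq ▸ hm)
        · exact h m hlt (Or.inl hm)
      rw [(h2 he).1, partitionLabel, if_neg hB, if_pos ⟨n, he, h⟩]
    · have hn : z ∉ d.newB n ∪ d.newE n := fun hc => hc.elim hb he
      rw [h3 hn, ih]
      intro m hm
      rcases Nat.eq_or_lt_of_le hm with rfl | hlt
      · exact hn
      · exact h m hlt

end AbC


/-! ### The measure of the atoms -/

theorem measurable_cellIndex (N : ℕ) : Measurable (cellIndex N) :=
  Nat.measurable_floor.comp (measurable_const.mul measurable_subtype_coe)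

theorem volume_cellIndex_eq {N i : ℕ} (hN : 0 < N) (hi : i < N) :
    ((volume : Measure ℝ).comap Subtype.val) {x : I01 | cellIndex N x = i} =
      ENNReal.ofReal (1 / N) := by
  have hN' : (0 : ℝ) < N := Nat.cast_pos.mpr hN
  rw [(MeasurableEmbedding.subtype_coe measurableSet_Ico).comap_apply]
  have : Subtype.val '' {x : I01 | cellIndex N x = i} =
      Set.Ico ((i : ℝ) / N) ((i + 1 : ℝ) / N) := by
    ext x
    have hiN : (i : ℝ) + 1 ≤ N := by exact_mod_cast hi
    constructor
    · rintro ⟨y, hy, rfl⟩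
      have h0 : 0 ≤ (N : ℝ) * (y : ℝ) := mul_nonneg hN'.le y.2.1
      have h1 := (Nat.floor_eq_iff h0).mp hy
      constructor
      · rw [div_le_iff₀ hN']; linarith
      · rw [lt_div_iff₀ hN']; linarith
    · rintro ⟨h1, h2⟩
      rw [div_le_iff₀ hN'] at h1
      have h2' := h2
      rw [lt_div_iff₀ hN'] at h2
      have hx0 : 0 ≤ x := by
        have : (0 : ℝ) ≤ i := Nat.cast_nonneg i
        by_contra hneg
        nlinarith
      have hx1 : x < 1 := lt_of_lt_of_le h2' ((div_le_one hN').mpr hiN)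
      refine ⟨⟨x, hx0, hx1⟩, ?_, rfl⟩
      show ⌊(N : ℝ) * x⌋₊ = i
      rw [Nat.floor_eq_iff (by positivity)]
      constructor <;> linarith
  rw [this, Real.volume_Ico]
  congr 1
  ring

instance isProbabilityMeasure_comap_I01 :
    IsProbabilityMeasure ((volume : Measure ℝ).comap (Subtype.val : I01 → ℝ)) :=
  ⟨by
    rw [(MeasurableEmbedding.subtype_coe measurableSet_Ico).comap_apply, Set.image_univ,
      Subtype.range_coe, Real.volume_Ico]
    simp⟩

theorem lebSq_cellIndex_eq {Q S i t : ℕ} (hQ : 0 < Q) (hS : 0 < S) (hi : i < Q) (ht : t < S) :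
    lebSq {z | cellIndex Q z.1 = i ∧ cellIndex S z.2 = t} = ENNReal.ofReal (1 / (Q * S)) := by
  have : {z : Sq | cellIndex Q z.1 = i ∧ cellIndex S z.2 = t} =
      {x | cellIndex Q x = i} ×ˢ {x | cellIndex S x = t} := rfl
  rw [this, lebSq, Measure.prod_prod, volume_cellIndex_eq hQ hi, volume_cellIndex_eq hS ht,
    ← ENNReal.ofReal_mul (by positivity)]
  congr 1
  field_simp

theorem dist_le_of_cellIndex_eq {N : ℕ} (hN : 0 < N) {x y : I01}
    (h : cellIndex N x = cellIndex N y) : |(x : ℝ) - y| ≤ 1 / N := by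
  have hN' : (0 : ℝ) < N := Nat.cast_pos.mpr hN
  have hx := (Nat.floor_eq_iff (mul_nonneg hN'.le x.2.1)).mp (rfl : cellIndex N x = _)
  have hy := (Nat.floor_eq_iff (mul_nonneg hN'.le y.2.1)).mp (h.symm : cellIndex N y = _)
  rw [abs_le]
  constructor
  · rw [← sub_nonneg]
    have : 0 ≤ ((x : ℝ) - y - -(1 / N)) * N := by
      have e : ((x : ℝ) - y - -(1 / N)) * N = N * x - N * y + 1 := by field_simp; ring
      rw [e]; linarith
    exact nonneg_of_mul_nonneg_left this hN'
  · rw [← sub_nonneg]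
    have : 0 ≤ (1 / N - ((x : ℝ) - y)) * N := by
      have e : (1 / N - ((x : ℝ) - y)) * N = 1 - N * x + N * y := by field_simp; ring
      rw [e]; linarith
    exact nonneg_of_mul_nonneg_left this hN'

namespace AbC

variable {d : AbC}

/-- `h` translates the atoms of a grid and keeps the relative position in each of them, so it
respects every refinement of that grid. -/
theorem h_respects {n Q S : ℕ} (hQ : d.q n * d.k n ∣ Q) (hS : d.s (n + 1) ∣ S) (hQ0 : 0 < Q)
    (hS0 : 0 < S) {z w : Sq} (h1 : cellIndex Q z.1 = cellIndex Q w.1)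
    (h2 : cellIndex S z.2 = cellIndex S w.2) :
    cellIndex Q (d.h n z).1 = cellIndex Q (d.h n w).1 ∧
      cellIndex S (d.h n z).2 = cellIndex S (d.h n w).2 := by
  obtain ⟨D, rfl⟩ := hQ
  obtain ⟨D', rfl⟩ := hS
  have hD : 0 < D := Nat.pos_of_mul_pos_left hQ0
  have hD' : 0 < D' := Nat.pos_of_mul_pos_left hS0
  have hkD : 0 < d.k n * D := Nat.mul_pos (d.k_pos n) hD
  rw [mul_assoc] at h1 ⊢
  rw [cellIndex_mul_eq_iff _ _ hkD, cellIndex_mul_eq_iff _ _ hD] at h1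
  rw [cellIndex_mul_eq_iff _ _ hD'] at h2
  rw [cellIndex_mul_eq_iff _ _ hkD, cellIndex_mul_eq_iff _ _ hD, cellIndex_mul_eq_iff _ _ hD']
  have gz := d.grid_h n z
  have gw := d.grid_h n w
  have e : ∀ v : Sq, d.grid n v = (((cell (d.q n) v.1).1, cell (d.k n) (cell (d.q n) v.1).2),
    cell (d.s (n + 1)) v.2) := fun _ => rfl
  rw [e, e] at gz gw
  simp only [rowPerm, twistPerm, Equiv.coe_fn_mk, Prod.ext_iff] at gz gw
  obtain ⟨⟨a1, a2, a3⟩, a4, a5⟩ := gz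
  obtain ⟨⟨b1, b2, b3⟩, b4, b5⟩ := gw
  rw [a1, b1, a2, b2, a3, b3, a4, b4, a5, b5, h1.1, h1.2.1, h2.1]
  exact ⟨⟨rfl, rfl, h1.2.2⟩, rfl, h2.2⟩

theorem s_dvd_s (hR1 : d.R1) {m n : ℕ} (h : m ≤ n) : d.s m ∣ d.s n := by
  induction n, h using Nat.le_induction with
  | base => exact dvd_rfl
  | succ n _ ih => exact ih.trans (hR1.1 n)

theorem _root_.TwistCoeff.q_dvd_q (c : TwistCoeff) {m n : ℕ} (h : m ≤ n) : c.q m ∣ c.q n := by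
  induction n, h using Nat.le_induction with
  | base => exact dvd_rfl
  | succ n _ ih => exact ih.trans (c.q_dvd_q_succ n)

/-- The indices of the atom `[i/q n, (i+1)/q n) × [t/s n, (t+1)/s n)` that contains a point. -/
noncomputable def atomIndex (d : AbC) (n : ℕ) (z : Sq) : Fin (d.q n) × Fin (d.s n) :=
  ((cell (d.q n) z.1).1, (cell (d.s n) z.2).1)

theorem atomIndex_eq_iff {n : ℕ} {z w : Sq} : d.atomIndex n z = d.atomIndex n w ↔
    cellIndex (d.q n) z.1 = cellIndex (d.q n) w.1 ∧
      cellIndex (d.s n) z.2 = cellIndex (d.s n) w.2 := by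
  rw [atomIndex, atomIndex, Prod.mk.injEq, Fin.ext_iff, Fin.ext_iff]
  rfl

theorem H_respects (hR1 : d.R1) {n m : ℕ} (hnm : n ≤ m) {z w : Sq}
    (h : d.atomIndex m z = d.atomIndex m w) :
    d.atomIndex m (d.H n z) = d.atomIndex m (d.H n w) := by
  induction n generalizing z w with
  | zero => exact h
  | succ n ih =>
    refine ih (by omega) ?_
    rw [atomIndex_eq_iff] at h ⊢
    have h1 : d.q n * d.k n ∣ d.q m :=
      (show d.q n * d.k n ∣ d.q (n + 1) from ⟨_, d.q_succ n⟩).trans (d.q_dvd_q hnm)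
    exact h_respects h1 (s_dvd_s hR1 hnm) (d.q_pos m) (d.s_pos m) h.1 h.2

theorem atomIndex_surjective (n : ℕ) : Function.Surjective (d.atomIndex n) := by
  rintro ⟨i, t⟩
  let x₀ : I01 := ⟨0, le_rfl, one_pos⟩
  exact ⟨((cell (d.q n)).symm (i, x₀), (cell (d.s n)).symm (t, x₀)), by simp [atomIndex]⟩

/-- The level and the tower of a point. -/
noncomputable def levelTower (d : AbC) (n : ℕ) (z : Sq) : Fin (d.q n) × Fin (d.s n) :=
  (⟨d.level n z, d.level_lt n z⟩, d.tower n z)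

/-- The levels of the towers of stage `n` are the atoms of the partition into rectangles. -/
theorem exists_perm_levelTower (hR1 : d.R1) (n : ℕ) :
    ∃ F : Equiv.Perm (Fin (d.q n) × Fin (d.s n)), ∀ z, d.levelTower n z = F (d.atomIndex n z) := by
  let r := Function.surjInv (d.atomIndex_surjective n)
  have hr : ∀ c, d.atomIndex n (r c) = c := Function.surjInv_eq _
  let F₁ : Fin (d.q n) × Fin (d.s n) → Fin (d.q n) × Fin (d.s n) := fun c => d.atomIndex n (d.H n (r c))
  have hF₁ : ∀ z, d.atomIndex n (d.H n z) = F₁ (d.atomIndex n z) := fun z =>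
    H_respects hR1 le_rfl (hr _).symm
  have hF₁s : Function.Surjective F₁ := by
    intro c
    obtain ⟨z, rfl⟩ := d.atomIndex_surjective n c
    exact ⟨d.atomIndex n ((d.H n).symm z), by rw [← hF₁, Equiv.apply_symm_apply]⟩
  let E₁ := Equiv.ofBijective F₁ (Finite.surjective_iff_bijective.mp hF₁s)
  let G : Fin (d.q n) × Fin (d.s n) → Fin (d.q n) × Fin (d.s n) :=
    fun c => (⟨d.j n c.1, d.j_lt n c.1⟩, c.2)
  have hG : Function.Injective G := by
    rintro ⟨i, t⟩ ⟨i', t'⟩ h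
    simp only [G, Prod.mk.injEq, Fin.mk.injEq] at h
    rw [Prod.mk.injEq]
    exact ⟨Fin.ext (d.j_injOn i.2 i'.2 h.1), h.2⟩
  let E₂ := Equiv.ofBijective G (Finite.injective_iff_bijective.mp hG)
  refine ⟨E₁.symm.trans E₂, fun z => ?_⟩
  have : E₁.symm (d.atomIndex n z) = d.atomIndex n ((d.H n).symm z) := by
    rw [Equiv.symm_apply_eq]
    show _ = F₁ _
    rw [← hF₁, Equiv.apply_symm_apply]
  rw [Equiv.trans_apply, this]
  rfl

theorem measurable_atomIndex (n : ℕ) : Measurable (d.atomIndex n) := by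
  refine measurable_to_countable' fun c => ?_
  have : d.atomIndex n ⁻¹' {c} = {z | cellIndex (d.q n) z.1 = c.1} ∩ {z | cellIndex (d.s n) z.2 = c.2} := by
    ext z
    simp [atomIndex, Prod.ext_iff, Fin.ext_iff, cell_fst]
  rw [this]
  exact (measurableSet_eq_fun ((measurable_cellIndex _).comp measurable_fst) measurable_const).inter
    (measurableSet_eq_fun ((measurable_cellIndex _).comp measurable_snd) measurable_const)

theorem measurable_levelTower (hR1 : d.R1) (n : ℕ) : Measurable (d.levelTower n) := by
  obtain ⟨F, hF⟩ := exists_perm_levelTower hR1 n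
  rw [show d.levelTower n = F ∘ d.atomIndex n from funext hF]
  exact (measurable_of_countable _).comp (measurable_atomIndex n)

theorem measurable_level (hR1 : d.R1) (n : ℕ) : Measurable (d.level n) :=
  (measurable_of_countable (fun c : Fin (d.q n) × Fin (d.s n) => (c.1 : ℕ))).comp
    (measurable_levelTower hR1 n)

theorem measurable_tower (hR1 : d.R1) (n : ℕ) : Measurable (d.tower n) :=
  measurable_snd.comp (measurable_levelTower hR1 n)

theorem lebSq_levelTower (hR1 : d.R1) (n : ℕ) (c : Fin (d.q n) × Fin (d.s n)) :
    lebSq {z | d.levelTower n z = c} = ENNReal.ofReal (1 / (d.q n * d.s n)) := by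
  obtain ⟨F, hF⟩ := exists_perm_levelTower hR1 n
  rw [← lebSq_cellIndex_eq (d.q_pos n) (d.s_pos n) (F.symm c).1.2 (F.symm c).2.2]
  congr 1
  ext z
  show d.levelTower n z = c ↔ cellIndex (d.q n) z.1 = _ ∧ cellIndex (d.s n) z.2 = _
  rw [hF, ← Equiv.eq_symm_apply, Prod.ext_iff, Fin.ext_iff, Fin.ext_iff]
  rfl

theorem lebSq_level_mem_le (hR1 : d.R1) (n : ℕ) (S : Finset ℕ) :
    lebSq {z | d.level n z ∈ S} ≤ ENNReal.ofReal (S.card / d.q n) := by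
  classical
  have hq : (0 : ℝ) < d.q n := by exact_mod_cast d.q_pos n
  have hs : (0 : ℝ) < d.s n := by exact_mod_cast d.s_pos n
  let S' : Finset (Fin (d.q n)) := Finset.univ.filter fun i => (i : ℕ) ∈ S
  have hcard : S'.card ≤ S.card :=
    Finset.card_le_card_of_injOn (fun i => (i : ℕ)) (fun i hi => (Finset.mem_filter.mp hi).2)
      (fun i _ j _ h => Fin.ext h)
  have hsub : {z | d.level n z ∈ S} ⊆
      ⋃ c ∈ S' ×ˢ (Finset.univ : Finset (Fin (d.s n))), {z | d.levelTower n z = c} := by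
    intro z hz
    simp only [Set.mem_iUnion]
    exact ⟨d.levelTower n z, by simpa [S', levelTower] using hz, rfl⟩
  calc lebSq {z | d.level n z ∈ S}
      ≤ ∑ c ∈ S' ×ˢ (Finset.univ : Finset (Fin (d.s n))), lebSq {z | d.levelTower n z = c} :=
        (measure_mono hsub).trans (measure_biUnion_finset_le _ _)
    _ = ((S'.card * d.s n : ℕ) : ENNReal) * ENNReal.ofReal (1 / (d.q n * d.s n)) := by
        simp [lebSq_levelTower hR1, Finset.card_product]
    _ ≤ ((S.card * d.s n : ℕ) : ENNReal) * ENNReal.ofReal (1 / (d.q n * d.s n)) := by gcongr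
    _ = ENNReal.ofReal (S.card / d.q n) := by
        rw [← ENNReal.ofReal_natCast, ← ENNReal.ofReal_mul (by positivity)]
        congr 1
        push_cast
        field_simp

/-- The proportion of the points that are labelled at a stage. -/
theorem lebSq_newB_union_newE_le (hR1 : d.R1) (n : ℕ) :
    lebSq (d.newB n ∪ d.newE n) ≤ ENNReal.ofReal (1 / d.l n) := by
  classical
  have hq := d.q_pos n
  have hk := d.k_pos n
  have hl := d.l_pos n
  -- A labelled position is coded by its factor and by the number of its letter among the q n
  -- spacers of that factor, those with b counted first.
  let f : ℕ × ℕ → ℕ := fun c => c.1 * (d.l n * d.q n) +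
    if c.2 < d.q n - d.offset n c.1 then c.2 else (d.l n - 1) * d.q n + c.2
  let S : Finset ℕ := (Finset.range (d.q n * d.k n) ×ˢ Finset.range (d.q n)).image f
  have hsub : d.newB n ∪ d.newE n ⊆ {z | d.level (n + 1) z ∈ S} := by
    intro z hz
    obtain ⟨y, o, hy, ho, hJ⟩ := d.exists_factor_pos (d.level_lt (n + 1) z)
    have h1 := d.pred_l_mul_q n
    have h2 := d.offset_lt n y
    rw [Set.mem_union, mem_newB_iff hy ho hJ, mem_newE_iff hy ho hJ] at hz
    show d.level (n + 1) z ∈ S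
    rw [hJ]
    simp only [S, Finset.mem_image, Finset.mem_product, Finset.mem_range, Prod.exists]
    rcases hz with hz | hz
    · exact ⟨y, o, ⟨hy, by omega⟩, by simp [f, hz]⟩
    · refine ⟨y, o - (d.l n - 1) * d.q n, ⟨hy, by omega⟩, ?_⟩
      simp only [f]
      rw [if_neg (by omega)]
      omega
  have hcard : S.card ≤ d.q n * d.k n * d.q n :=
    Finset.card_image_le.trans (by simp [Finset.card_product])
  refine (measure_mono hsub).trans ((lebSq_level_mem_le hR1 _ _).trans (ENNReal.ofReal_le_ofReal ?_))
  rw [div_le_div_iff₀ (by exact_mod_cast d.q_pos (n + 1)) (by exact_mod_cast hl)]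
  rw [d.q_succ, one_mul]
  exact_mod_cast (Nat.mul_le_mul_right (d.l n) hcard).trans (le_of_eq (by ring))

/-- The proportion of the points at the beginning of a factor. -/
theorem lebSq_level_dvd_le (hR1 : d.R1) (n : ℕ) :
    lebSq {z | d.l n * d.q n ∣ d.level (n + 1) z} ≤ ENNReal.ofReal (1 / (d.l n * d.q n)) := by
  classical
  have hlq := d.lq_pos n
  let S : Finset ℕ := (Finset.range (d.q n * d.k n)).image fun y => y * (d.l n * d.q n)
  have hsub : {z | d.l n * d.q n ∣ d.level (n + 1) z} ⊆ {z | d.level (n + 1) z ∈ S} := by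
    rintro z ⟨y, hy⟩
    have hlt := d.level_lt (n + 1) z
    rw [hy, d.q_succ, mul_comm] at hlt
    show d.level (n + 1) z ∈ S
    exact Finset.mem_image.mpr
      ⟨y, Finset.mem_range.mpr (Nat.lt_of_mul_lt_mul_right hlt), by rw [hy, mul_comm]⟩
  have hcard : S.card ≤ d.q n * d.k n := Finset.card_image_le.trans (by simp)
  refine (measure_mono hsub).trans ((lebSq_level_mem_le hR1 _ _).trans (ENNReal.ofReal_le_ofReal ?_))
  have hlq' : (0 : ℝ) < (d.l n : ℝ) * d.q n := by exact_mod_cast hlq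
  rw [div_le_div_iff₀ (by exact_mod_cast d.q_pos (n + 1)) hlq', d.q_succ, one_mul]
  exact_mod_cast Nat.mul_le_mul_right (d.l n * d.q n) hcard

/-- The proportion of the points near the ends of the towers. -/
theorem lebSq_level_ends_le (hR1 : d.R1) (n B : ℕ) :
    lebSq {z | d.level n z < B ∨ d.q n ≤ d.level n z + B} ≤
      ENNReal.ofReal (2 * B / d.q n) := by
  classical
  let S : Finset ℕ := Finset.range B ∪ Finset.Ico (d.q n - B) (d.q n)
  have hsub : {z | d.level n z < B ∨ d.q n ≤ d.level n z + B} ⊆ {z | d.level n z ∈ S} := by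
    intro z hz
    have := d.level_lt n z
    simp only [S, Set.mem_ofPred_eq, Finset.mem_union, Finset.mem_range, Finset.mem_Ico] at hz ⊢
    omega
  have hcard : S.card ≤ 2 * B := by
    refine (Finset.card_union_le _ _).trans ?_
    simp only [Finset.card_range, Nat.card_Ico]
    omega
  refine (measure_mono hsub).trans ((lebSq_level_mem_le hR1 _ _).trans (ENNReal.ofReal_le_ofReal ?_))
  gcongr
  exact_mod_cast hcard

end AbC


/-! ### The periodic approximations -/

namespace AbC

variable {d : AbC}

/-- The next level of the same tower, cyclically. -/
def nextLevel (d : AbC) (n : ℕ) (c : Fin (d.q n) × Fin (d.s n)) : Fin (d.q n) × Fin (d.s n) :=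
  (⟨(c.1 + 1) % d.q n, Nat.mod_lt _ (d.q_pos n)⟩, c.2)

theorem nextLevel_injective (n : ℕ) : Function.Injective (d.nextLevel n) := by
  rintro ⟨i, t⟩ ⟨i', t'⟩ h
  simp only [nextLevel, Prod.mk.injEq, Fin.mk.injEq] at h
  have h1 : (i : ℕ) ≡ i' [MOD d.q n] := Nat.ModEq.add_right_cancel' 1 h.1
  rw [Nat.ModEq, Nat.mod_eq_of_lt i.2, Nat.mod_eq_of_lt i'.2] at h1
  rw [Prod.mk.injEq]
  exact ⟨Fin.ext h1, h.2⟩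

theorem levelTower_T (n : ℕ) (z : Sq) :
    d.levelTower n (d.T n z) = d.nextLevel n (d.levelTower n z) := by
  simp only [levelTower, nextLevel, level_T, tower_T]

theorem levelTower_eq_of_succ (hR1 : d.R1) {n : ℕ} {z w : Sq}
    (h : d.levelTower (n + 1) z = d.levelTower (n + 1) w) : d.levelTower n z = d.levelTower n w := by
  simp only [levelTower, Prod.mk.injEq, Fin.mk.injEq] at h ⊢
  obtain ⟨y, o, hy, ho, hJ⟩ := d.exists_factor_pos (d.level_lt (n + 1) z)
  have h1 := level_tower_succ hR1 n z hy ho hJ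
  have h2 := level_tower_succ hR1 n w hy ho (h.1 ▸ hJ)
  rw [h1.1, h1.2, h2.1, h2.2, h.2]
  exact ⟨rfl, rfl⟩

theorem levelTower_eq_of_le (hR1 : d.R1) {n m : ℕ} (hnm : n ≤ m) {z w : Sq}
    (h : d.levelTower m z = d.levelTower m w) : d.levelTower n z = d.levelTower n w := by
  induction m, hnm using Nat.le_induction with
  | base => exact h
  | succ m _ ih => exact ih (levelTower_eq_of_succ hR1 h)

/-- Away from the beginnings of the factors, two consecutive approximations move the
levels in the same way. -/
theorem levelTower_T_succ_symm (hR1 : d.R1) (n : ℕ) (w : Sq)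
    (hw : ¬ d.l n * d.q n ∣ d.level (n + 1) w) :
    d.levelTower n ((d.T (n + 1)).symm w) = d.levelTower n ((d.T n).symm w) := by
  apply nextLevel_injective
  rw [← levelTower_T n ((d.T n).symm w), Equiv.apply_symm_apply]
  set v := (d.T (n + 1)).symm w with hv
  have hw' : w = d.T (n + 1) v := by rw [hv, Equiv.apply_symm_apply]
  have h1 : d.level (n + 1) w = (d.level (n + 1) v + 1) % d.q (n + 1) := by rw [hw', level_T]
  have h2 : d.tower (n + 1) w = d.tower (n + 1) v := by rw [hw', tower_T]
  have h3 := d.level_lt (n + 1) v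
  -- From the top of a tower the approximation returns to level 0, which is the beginning of a
  -- factor and so excluded.
  have h4 : d.level (n + 1) v + 1 < d.q (n + 1) := by
    by_contra hcon
    have e : d.level (n + 1) v + 1 = d.q (n + 1) := by omega
    rw [e, Nat.mod_self] at h1
    exact hw (h1 ▸ dvd_zero _)
  rw [Nat.mod_eq_of_lt h4] at h1
  obtain ⟨y, o, hy, ho, hJ⟩ := d.exists_factor_pos (d.level_lt (n + 1) w)
  have ho0 : o ≠ 0 := fun h0 => hw ⟨y, by rw [hJ, h0, add_zero, mul_comm]⟩
  have hv1 := level_tower_succ hR1 n v hy (o := o - 1) (by omega) (by omega)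
  have hw1 := level_tower_succ hR1 n w hy ho hJ
  simp only [levelTower, nextLevel, Prod.mk.injEq, Fin.mk.injEq]
  rw [hv1.1, hv1.2, hw1.1, hw1.2, h2, Nat.mod_add_mod]
  refine ⟨?_, rfl⟩
  congr 1
  omega

/-- The comparisons of consecutive approximations telescope, because the towers of a later stage
determine those of an earlier one. With inverses the exceptional set is a condition on w alone that
serves all m at once. -/
theorem levelTower_T_symm (hR1 : d.R1) {n m : ℕ} (hnm : n ≤ m) (w : Sq)
    (hw : ∀ i, n ≤ i → ¬ d.l i * d.q i ∣ d.level (i + 1) w) :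
    d.nextLevel n (d.levelTower n ((d.T m).symm w)) = d.levelTower n w := by
  induction m, hnm using Nat.le_induction with
  | base => rw [← levelTower_T, Equiv.apply_symm_apply]
  | succ m hm ih =>
    rw [← ih]
    congr 1
    exact levelTower_eq_of_le hR1 hm (levelTower_T_succ_symm hR1 m w (hw m hm))

theorem image_T_eq (m : ℕ) (A : Set Sq) : d.T m '' A = {w | (d.T m).symm w ∈ A} :=
  Equiv.image_eq_preimage_symm _ _

end AbC

/-! ### The limit transformation -/

namespace AbC

variable {d : AbC} {M : Type*}

/-- The points at which a map does not move the levels of the towers of stage `n` upwards. -/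
def jumpSet (d : AbC) (κ : M → Sq) (T : M → M) (n : ℕ) : Set M :=
  {x | d.levelTower n (κ (T x)) ≠ d.nextLevel n (d.levelTower n (κ x))}

variable {κ : M → Sq}

/-- The orbit of `x` passes through its tower of stage `n` from the bottom to the top. -/
def Tracks (d : AbC) (κ : M → Sq) (T : Equiv.Perm M) (n : ℕ) (x : M) : Prop :=
  ∀ j : ℤ, 0 ≤ d.level n (κ x) + j → d.level n (κ x) + j < d.q n →
    (d.level n (κ ((T ^ j) x)) : ℤ) = d.level n (κ x) + j ∧
      d.tower n (κ ((T ^ j) x)) = d.tower n (κ x)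

/-- As long as the passage has not left the tower, the cyclic successor is the ordinary one, upwards
as well as downwards; at most q n steps in either direction are needed. -/
theorem tracks_of_notMem_jumpSet {n : ℕ} {T : Equiv.Perm M} {x : M}
    (h : ∀ j : ℤ, |j| ≤ d.q n → (T ^ j) x ∉ d.jumpSet κ T n) : d.Tracks κ T n x := by
  have hstep : ∀ j : ℤ, |j| ≤ d.q n →
      d.level n (κ ((T ^ (j + 1)) x)) = (d.level n (κ ((T ^ j) x)) + 1) % d.q n ∧
        d.tower n (κ ((T ^ (j + 1)) x)) = d.tower n (κ ((T ^ j) x)) := by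
    intro j hj
    have h1 := h j hj
    rw [jumpSet, Set.mem_ofPred_eq, not_not, ← Equiv.Perm.mul_apply, ← zpow_one_add, add_comm] at h1
    simp only [levelTower, nextLevel, Prod.mk.injEq, Fin.mk.injEq] at h1
    exact h1
  have hup : ∀ a : ℕ, d.level n (κ x) + a < d.q n →
      d.level n (κ ((T ^ (a : ℤ)) x)) = d.level n (κ x) + a ∧
        d.tower n (κ ((T ^ (a : ℤ)) x)) = d.tower n (κ x) := by
    intro a
    induction a with
    | zero => simp
    | succ a ih =>
      intro ha
      obtain ⟨h1, h2⟩ := ih (by omega)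
      obtain ⟨h3, h4⟩ := hstep a (by rw [abs_of_nonneg (by positivity)]; omega)
      rw [Nat.cast_succ, h3, h4, h1, h2, Nat.mod_eq_of_lt (by omega)]
      exact ⟨rfl, rfl⟩
  have hdown : ∀ a : ℕ, a ≤ d.level n (κ x) →
      d.level n (κ ((T ^ (-(a : ℤ))) x)) = d.level n (κ x) - a ∧
        d.tower n (κ ((T ^ (-(a : ℤ))) x)) = d.tower n (κ x) := by
    intro a
    induction a with
    | zero => simp
    | succ a ih =>
      intro ha
      obtain ⟨h1, h2⟩ := ih (by omega)
      have hlt := d.level_lt n (κ x)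
      obtain ⟨h3, h4⟩ := hstep (-((a + 1 : ℕ) : ℤ)) (by rw [abs_neg, Nat.abs_cast]; omega)
      have e : -((a + 1 : ℕ) : ℤ) + 1 = -(a : ℤ) := by push_cast; ring
      rw [e] at h3 h4
      rw [← h4, h2]
      refine ⟨?_, rfl⟩
      have hlt2 := d.level_lt n (κ ((T ^ (-((a + 1 : ℕ) : ℤ))) x))
      rw [h1] at h3
      rcases Nat.lt_or_ge (d.level n (κ ((T ^ (-((a + 1 : ℕ) : ℤ))) x)) + 1) (d.q n) with h5 | h5
      · rw [Nat.mod_eq_of_lt h5] at h3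
        omega
      · have h6 : d.level n (κ ((T ^ (-((a + 1 : ℕ) : ℤ))) x)) + 1 = d.q n := by omega
        rw [h6, Nat.mod_self] at h3
        omega
  intro j h0 h1
  obtain ⟨a, rfl | rfl⟩ := j.eq_nat_or_neg
  · obtain ⟨h2, h3⟩ := hup a (by omega)
    exact ⟨by rw [h2]; push_cast; rfl, h3⟩
  · obtain ⟨h2, h3⟩ := hdown a (by omega)
    exact ⟨by rw [h2]; omega, h3⟩

variable [MeasurableSpace M] {μ : Measure M}

theorem measurableSet_jumpSet (hR1 : d.R1) (hκ : Measurable κ) (T : M ≃ᵐ M) (n : ℕ) :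
    MeasurableSet (d.jumpSet κ T n) := by
  have h1 : Measurable fun x => d.levelTower n (κ (T x)) :=
    (measurable_levelTower hR1 n).comp (hκ.comp T.measurable)
  have h2 : Measurable fun x => d.nextLevel n (d.levelTower n (κ x)) :=
    (measurable_of_countable (d.nextLevel n)).comp ((measurable_levelTower hR1 n).comp hκ)
  exact (measurableSet_eq_fun h1 h2).compl

/-- T_m moves the levels of stage n correctly outside a set that does not depend on m. As there are
finitely many levels, weak convergence makes the discrepancy between T and T_m on them vanish as m
tends to infinity. -/
theorem measure_jumpSet_le (hR1 : d.R1) (hκ : MeasurePreserving κ μ lebSq) (T : M ≃ᵐ M)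
    (hT : MeasurePreserving T μ μ) (hlim : IsWeakLimit μ κ d.T T) (n : ℕ) :
    μ (d.jumpSet κ T n) ≤ ∑' i, ENNReal.ofReal (1 / (d.l (n + i) * d.q (n + i))) := by
  set Z : Set Sq := ⋃ i, {z | d.l (n + i) * d.q (n + i) ∣ d.level (n + i + 1) z} with hZ
  have hZm : MeasurableSet Z := MeasurableSet.iUnion fun i =>
    measurable_level hR1 _ (measurableSet_setOfPred (p := fun J => d.l (n + i) * d.q (n + i) ∣ J)
      |>.mpr (measurable_of_countable _))
  have hZle : μ (κ ⁻¹' Z) ≤ ∑' i, ENNReal.ofReal (1 / (d.l (n + i) * d.q (n + i))) := by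
    rw [hκ.measure_preimage hZm.nullMeasurableSet]
    exact (measure_iUnion_le _).trans (ENNReal.tsum_le_tsum fun i => lebSq_level_dvd_le hR1 _)
  let A : Fin (d.q n) × Fin (d.s n) → Set Sq := fun c => {z | d.levelTower n z = c}
  have hA : ∀ c, MeasurableSet (A c) := fun c =>
    measurable_levelTower hR1 n (measurableSet_singleton c)
  have hbound : ∀ m, n ≤ m → μ (d.jumpSet κ T n) ≤
      μ (κ ⁻¹' Z) + ∑ c, μ ((T '' (κ ⁻¹' A c)) ∆ (κ ⁻¹' (d.T m '' A c))) := by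
    intro m hm
    have hsub : T '' d.jumpSet κ T n ⊆
        κ ⁻¹' Z ∪ ⋃ c ∈ (Finset.univ : Finset (Fin (d.q n) × Fin (d.s n))),
          (T '' (κ ⁻¹' A c)) ∆ (κ ⁻¹' (d.T m '' A c)) := by
      rintro _ ⟨x, hx, rfl⟩
      by_cases hz : κ (T x) ∈ Z
      · exact Or.inl hz
      right
      simp only [Set.mem_iUnion]
      -- With A c the level of x, the point T x lies in the image of A c under T but not in its
      -- image under T_m.
      refine ⟨d.levelTower n (κ x), Finset.mem_univ _, Or.inl ⟨⟨x, rfl, rfl⟩, ?_⟩⟩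
      intro hmem
      rw [Set.mem_preimage, image_T_eq] at hmem
      have hmem' : d.levelTower n ((d.T m).symm (κ (T x))) = d.levelTower n (κ x) := hmem
      apply hx
      rw [← hmem', levelTower_T_symm hR1 hm]
      intro i hi hdvd
      obtain ⟨j, rfl⟩ := Nat.exists_eq_add_of_le hi
      exact hz (Set.mem_iUnion.mpr ⟨j, hdvd⟩)
    have he : μ (d.jumpSet κ T n) = μ (T '' d.jumpSet κ T n) := by
      rw [← hT.measure_preimage_emb T.measurableEmbedding (T '' _),
        Set.preimage_image_eq _ T.injective]
    rw [he]
    exact (measure_mono hsub).trans ((measure_union_le _ _).trans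
      (add_le_add_right (measure_biUnion_finset_le _ _) _))
  have htend : Tendsto (fun m => μ (κ ⁻¹' Z) +
      ∑ c, μ ((T '' (κ ⁻¹' A c)) ∆ (κ ⁻¹' (d.T m '' A c)))) atTop (𝓝 (μ (κ ⁻¹' Z) + 0)) := by
    refine Tendsto.add tendsto_const_nhds ?_
    rw [show (0 : ENNReal) = ∑ _c : Fin (d.q n) × Fin (d.s n), 0 by simp]
    exact tendsto_finsetSum _ fun c _ => hlim (A c) (hA c)
  rw [add_zero] at htend
  exact (ge_of_tendsto htend (eventually_atTop.mpr ⟨n, hbound⟩)).trans hZle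

theorem two_pow_mul_q_le (n i : ℕ) : 2 ^ i * d.q n ≤ d.q (n + i) := by
  induction i with
  | zero => simp
  | succ i ih =>
    have := d.two_mul_q_le (n + i)
    rw [pow_succ, ← add_assoc]
    nlinarith

/-- Since q (n+i) ≥ 2^i * q n, the double sum is bounded by a geometric series times the sum of 1 /
l n. The weight q n pays for the length of the orbit segments that must avoid the jump set. -/
theorem tsum_q_mul_jump_ne_top (hsum : Summable fun n => 1 / (d.l n : ℝ)) :
    ∑' n, (d.q n : ENNReal) * ∑' i, ENNReal.ofReal (1 / (d.l (n + i) * d.q (n + i))) ≠ ⊤ := by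
  have h1 : ∀ n i, (d.q n : ENNReal) * ENNReal.ofReal (1 / (d.l (n + i) * d.q (n + i))) ≤
      ENNReal.ofReal ((1 / 2) ^ i) * ENNReal.ofReal (1 / d.l (n + i)) := by
    intro n i
    rw [← ENNReal.ofReal_natCast, ← ENNReal.ofReal_mul (by positivity),
      ← ENNReal.ofReal_mul (by positivity)]
    apply ENNReal.ofReal_le_ofReal
    have hl : (0 : ℝ) < d.l (n + i) := by exact_mod_cast d.l_pos _
    have hq : (0 : ℝ) < d.q (n + i) := by exact_mod_cast d.q_pos _
    have h2 : (2 : ℝ) ^ i * d.q n ≤ d.q (n + i) := by exact_mod_cast two_pow_mul_q_le n i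
    rw [div_pow, one_pow, ← mul_div_assoc, mul_one, div_mul_div_comm, one_mul,
      div_le_div_iff₀ (by positivity) (by positivity)]
    calc (d.q n : ℝ) * (2 ^ i * d.l (n + i)) = (2 ^ i * d.q n) * d.l (n + i) := by ring
      _ ≤ d.q (n + i) * d.l (n + i) := by gcongr
      _ = 1 * (d.l (n + i) * d.q (n + i)) := by ring
  have h3 : ∑' n, (d.q n : ENNReal) * ∑' i, ENNReal.ofReal (1 / (d.l (n + i) * d.q (n + i))) ≤
      (∑' i : ℕ, ENNReal.ofReal ((1 / 2) ^ i)) * ∑' n, ENNReal.ofReal (1 / d.l n) := by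
    rw [← ENNReal.tsum_mul_right]
    simp_rw [← ENNReal.tsum_mul_left (a := (d.q _ : ENNReal))]
    rw [ENNReal.tsum_comm]
    refine ENNReal.tsum_le_tsum fun i => (ENNReal.tsum_le_tsum fun n => h1 n i).trans ?_
    rw [ENNReal.tsum_mul_left]
    exact mul_le_mul' le_rfl (ENNReal.tsum_comp_le_tsum_of_injective (add_left_injective i)
      (fun n => ENNReal.ofReal (1 / d.l n)))
  exact ne_top_of_le_ne_top
    (ENNReal.mul_ne_top summable_geometric_two.tsum_ofReal_ne_top hsum.tsum_ofReal_ne_top) h3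

theorem _root_.MeasurableEquiv.measurePreserving_zpow {T : M ≃ᵐ M} (hT : MeasurePreserving T μ μ) (j : ℤ) :
    MeasurePreserving (T.toEquiv ^ j) μ μ := by
  have hn : ∀ a : ℕ, MeasurePreserving (T.toEquiv ^ a) μ μ := by
    intro a
    rw [Equiv.Perm.coe_pow]
    exact hT.iterate a
  have hs : ∀ a : ℕ, MeasurePreserving ((T.toEquiv)⁻¹ ^ a) μ μ := by
    intro a
    rw [Equiv.Perm.coe_pow]
    exact (hT.symm T).iterate a
  obtain ⟨a, rfl | rfl⟩ := j.eq_nat_or_neg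
  · rw [zpow_natCast]; exact hn a
  · rw [zpow_neg, zpow_natCast, ← inv_pow]; exact hs a

/-- Borel–Cantelli for the event that the orbit meets the jump set of stage n at a time between -q n
and q n. -/
theorem ae_eventually_tracks (hsum : Summable fun n => 1 / (d.l n : ℝ)) (hR1 : d.R1)
    (hκ : MeasurePreserving κ μ lebSq) (T : M ≃ᵐ M)
    (hT : MeasurePreserving T μ μ) (hlim : IsWeakLimit μ κ d.T T) :
    ∀ᵐ x ∂μ, ∀ᶠ n in atTop, d.Tracks κ T.toEquiv n x := by
  let Bad : ℕ → Set M := fun n => ⋃ j ∈ Finset.Icc (-(d.q n : ℤ)) (d.q n),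
    (T.toEquiv ^ j) ⁻¹' d.jumpSet κ T n
  have hBad : ∀ n, μ (Bad n) ≤
      3 * ((d.q n : ENNReal) * ∑' i, ENNReal.ofReal (1 / (d.l (n + i) * d.q (n + i)))) := by
    intro n
    have h1 : ∀ j : ℤ, μ ((T.toEquiv ^ j) ⁻¹' d.jumpSet κ T n) = μ (d.jumpSet κ T n) := fun j =>
      (MeasurableEquiv.measurePreserving_zpow hT j).measure_preimage
        (measurableSet_jumpSet hR1 hκ.measurable T n).nullMeasurableSet
    have h2 : (Finset.Icc (-(d.q n : ℤ)) (d.q n)).card ≤ 3 * d.q n := by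
      rw [Int.card_Icc]
      have := d.q_pos n
      omega
    calc μ (Bad n) ≤ ∑ j ∈ Finset.Icc (-(d.q n : ℤ)) (d.q n), μ ((T.toEquiv ^ j) ⁻¹' d.jumpSet κ T n) :=
          measure_biUnion_finset_le _ _
      _ = ((Finset.Icc (-(d.q n : ℤ)) (d.q n)).card : ENNReal) * μ (d.jumpSet κ T n) := by
          simp only [h1, Finset.sum_const, nsmul_eq_mul]
      _ ≤ ((3 * d.q n : ℕ) : ENNReal) * μ (d.jumpSet κ T n) := by gcongr
      _ = 3 * ((d.q n : ENNReal) * μ (d.jumpSet κ T n)) := by push_cast; ring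
      _ ≤ _ := by
          gcongr
          exact measure_jumpSet_le hR1 hκ T hT hlim n
  have hfin : ∑' n, μ (Bad n) ≠ ⊤ := by
    refine ne_top_of_le_ne_top ?_ (ENNReal.tsum_le_tsum hBad)
    rw [ENNReal.tsum_mul_left]
    exact ENNReal.mul_ne_top (by simp) (tsum_q_mul_jump_ne_top hsum)
  filter_upwards [ae_eventually_notMem hfin] with x hx
  filter_upwards [hx] with n hn
  apply tracks_of_notMem_jumpSet
  intro j hj hmem
  rw [abs_le] at hj
  exact hn (Set.mem_biUnion (Finset.mem_coe.mpr (Finset.mem_Icc.mpr hj)) hmem)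

end AbC


/-! ### Recognition of the runs of copies -/

namespace AbC

variable {d : AbC}

/-- The coordinate `0` of the sequence `z` is the one with index `o` in a run of `l n - 1` copies
of the word of stage `n` with index `u` that is preceded by a letter `b`. -/
def InRun (d : AbC) (n : ℕ) (u : Fin (d.s n)) (o : ℕ) (z : ℤ → Letter (Fin (d.s 0))) : Prop :=
  z (-(o : ℤ) - 1) = Letter.b ∧
    ∀ i < (d.l n - 1) * d.q n, z ((i : ℤ) - o) = d.letter n u (i % d.q n)

/-- If the second run began later, inside the first, then the b before it and the first `lead n`
letters of its word would be `lead n` + 1 consecutive b's there. They fit neither into one copy nor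
across the end of a copy, whose last letter is no spacer. -/
theorem inRun_le (hl : ∀ n, 2 ≤ d.l n) {n : ℕ} {u u' : Fin (d.s n)} {o o' : ℕ}
    (ho : o < (d.l n - 1) * d.q n)
    {z : ℤ → Letter (Fin (d.s 0))} (h : d.InRun n u o z) (h' : d.InRun n u' o' z) : o ≤ o' := by
  by_contra hcon
  have hq := d.q_pos n
  have hlt := d.lead_lt n
  have hqle : d.q n ≤ (d.l n - 1) * d.q n := Nat.le_mul_of_pos_left _ (by have := hl n; omega)
  -- a run of `lead n + 1` letters `b`
  have hb : ∀ j ≤ d.lead n, z (((o - o' - 1 + j : ℕ) : ℤ) - o) = Letter.b := by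
    intro j hj
    rcases Nat.eq_zero_or_pos j with h0 | h0
    · rw [← h'.1]
      congr 1
      omega
    · have h1 := h'.2 (j - 1) (by omega)
      rw [Nat.mod_eq_of_lt (by omega), (letter_lead hl n u').1 _ (by omega)] at h1
      rw [← h1]
      congr 1
      omega
  obtain ⟨g, i, hi, he⟩ : ∃ g i, i < d.q n ∧ o - o' - 1 = g * d.q n + i :=
    ⟨_, _, Nat.mod_lt _ hq, (Nat.div_add_mod' _ _).symm⟩
  have hg : g < d.l n - 1 := by
    by_contra hg
    have : (d.l n - 1) * d.q n ≤ g * d.q n := Nat.mul_le_mul_right _ (by omega)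
    omega
  have hg' : (g + 1) * d.q n ≤ (d.l n - 1) * d.q n := Nat.mul_le_mul_right _ hg
  rw [Nat.succ_mul] at hg'
  have hlet : ∀ i < d.q n, z (((g * d.q n + i : ℕ) : ℤ) - o) = d.letter n u i := by
    intro i hi
    rw [h.2 _ (by omega), mul_comm, Nat.mul_add_mod, Nat.mod_eq_of_lt hi]
  rcases Nat.lt_or_ge (i + d.lead n) (d.q n) with h1 | h1
  · obtain ⟨j, hj, hne⟩ := exists_letter_ne_b hl n u hi h1
    apply hne
    rw [← hlet _ (by omega), ← hb j hj, he, add_assoc]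
  · obtain ⟨a, ha⟩ := (letter_lead hl n u).2.2
    have h2 := hb (d.q n - 1 - i) (by omega)
    rw [he, add_assoc, hlet _ (by omega), show i + (d.q n - 1 - i) = d.q n - 1 by omega, ha] at h2
    simp at h2

theorem inRun_unique (hl : ∀ n, 2 ≤ d.l n) (hR3 : d.R3) {n : ℕ} {u u' : Fin (d.s n)} {o o' : ℕ}
    (ho : o < (d.l n - 1) * d.q n) (ho' : o' < (d.l n - 1) * d.q n)
    {z : ℤ → Letter (Fin (d.s 0))} (h : d.InRun n u o z) (h' : d.InRun n u' o' z) :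
    o = o' ∧ u = u' := by
  have e := le_antisymm (inRun_le hl ho h h') (inRun_le hl ho' h' h)
  subst e
  refine ⟨rfl, word_injective hl hR3 n (word_eq_of_letter_eq fun i hi => ?_)⟩
  have hqle : d.q n ≤ (d.l n - 1) * d.q n := Nat.le_mul_of_pos_left _ (by have := hl n; omega)
  have h1 := h.2 i (by omega)
  have h2 := h'.2 i (by omega)
  rw [Nat.mod_eq_of_lt hi] at h1 h2
  rw [← h1, ← h2]

/-! ### Names -/

variable {M : Type*} {κ : M → Sq} {T : Equiv.Perm M}

/-- From stage `n` on, the orbit of `x` passes through the towers as in the periodic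
approximations, `x` is not labelled, and it is not near the ends of the towers. -/
def Good (d : AbC) (κ : M → Sq) (T : Equiv.Perm M) (n : ℕ) (x : M) : Prop :=
  ∀ m, n ≤ m → d.Tracks κ T m x ∧ κ x ∉ d.newB m ∪ d.newE m ∧
    m ≤ d.level m (κ x) ∧ d.level m (κ x) + m < d.q m

theorem Good.mono {n m : ℕ} {x : M} (h : d.Good κ T n x) (hnm : n ≤ m) : d.Good κ T m x :=
  fun N hN => h N (hnm.trans hN)

/-- A point that is not labelled lies in a run of copies. -/
theorem exists_run_of_notMem (hR1 : d.R1) {n : ℕ} {z : Sq} (h : z ∉ d.newB n ∪ d.newE n) :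
    ∃ y < d.q n * d.k n, ∃ o < (d.l n - 1) * d.q n, d.level (n + 1) z = d.runStart n y + o ∧
      d.level n z = o % d.q n ∧ d.tower n z = d.rowAt n y (d.tower (n + 1) z) := by
  obtain ⟨y, o, hy, ho, hJ⟩ := d.exists_factor_pos (d.level_lt (n + 1) z)
  obtain ⟨h1, h2⟩ := level_tower_succ hR1 n z hy ho hJ
  rw [Set.mem_union, mem_newB_iff hy ho hJ, mem_newE_iff hy ho hJ] at h
  have h3 := d.pred_l_mul_q n
  have h4 := d.offset_lt n y
  refine ⟨y, hy, o - (d.q n - d.offset n y), by omega, by unfold TwistCoeff.runStart; omega, ?_, h2⟩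
  rw [h1, show o + d.offset n y = o - (d.q n - d.offset n y) + d.q n by omega, Nat.add_mod_right]

theorem notMem_of_run {n : ℕ} {z : Sq} {y o : ℕ} (hy : y < d.q n * d.k n)
    (ho : o < (d.l n - 1) * d.q n) (hJ : d.level (n + 1) z = d.runStart n y + o) :
    z ∉ d.newB n ∪ d.newE n := by
  have h3 := d.pred_l_mul_q n
  have h4 := d.offset_lt n y
  have hJ' : d.level (n + 1) z = y * (d.l n * d.q n) + (d.q n - d.offset n y + o) := by
    rw [hJ, TwistCoeff.runStart, add_assoc]
  rw [Set.mem_union, mem_newB_iff hy (by omega) hJ', mem_newE_iff hy (by omega) hJ']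
  omega

/-- The passage of a good point through its tower of stage `n` is part of its passage through its
tower of stage `m`, and it is not labelled at this stage. -/
theorem Good.passage (hR1 : d.R1) {n : ℕ} {x : M} (h : d.Good κ T n x) {j : ℤ}
    (h0 : 0 ≤ d.level n (κ x) + j) (h1 : d.level n (κ x) + j < d.q n) {m : ℕ} (hm : n ≤ m) :
    (0 ≤ d.level m (κ x) + j ∧ d.level m (κ x) + j < d.q m) ∧
      κ ((T ^ j) x) ∉ d.newB m ∪ d.newE m := by
  have hstep : ∀ m, n ≤ m → 0 ≤ d.level m (κ x) + j → d.level m (κ x) + j < d.q m →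
      (0 ≤ d.level (m + 1) (κ x) + j ∧ d.level (m + 1) (κ x) + j < d.q (m + 1)) ∧
      κ ((T ^ j) x) ∉ d.newB m ∪ d.newE m := by
    intro m hm h0 h1
    obtain ⟨y, hy, o, ho, hJ, hlev, -⟩ := exists_run_of_notMem hR1 (h m hm).2.1
    have hrun := d.run_le hy
    have hdm := Nat.div_add_mod' o (d.q m)
    -- The copy that contains x lies in the run as a whole, so a move within the copy stays in the
    -- run and meets no spacer.
    have hg : (o / d.q m + 1) * d.q m ≤ (d.l m - 1) * d.q m :=
      Nat.mul_le_mul_right _ ((Nat.div_lt_iff_lt_mul (d.q_pos m)).mpr ho)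
    rw [Nat.succ_mul] at hg
    rw [hlev] at h0 h1
    obtain ⟨o', ho'⟩ : ∃ o' : ℕ, (o' : ℤ) = o + j := ⟨(o + j).toNat, by
      rw [Int.toNat_of_nonneg]; omega⟩
    have hlt : o' < (d.l m - 1) * d.q m := by omega
    have hrange : 0 ≤ (d.level (m + 1) (κ x) : ℤ) + j ∧
        (d.level (m + 1) (κ x) : ℤ) + j < d.q (m + 1) := by
      rw [hJ]; push_cast; constructor <;> omega
    refine ⟨hrange, notMem_of_run hy hlt ?_⟩
    have h5 := ((h (m + 1) (by omega)).1 j hrange.1 hrange.2).1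
    rw [hJ] at h5
    push_cast at h5
    omega
  have hr : 0 ≤ (d.level m (κ x) : ℤ) + j ∧ (d.level m (κ x) : ℤ) + j < d.q m := by
    induction m, hm using Nat.le_induction with
    | base => exact ⟨h0, h1⟩
    | succ m hm ih => exact (hstep m hm ih.1 ih.2).1
  exact ⟨hr, (hstep m hm hr.1 hr.2).2⟩

/-- The name of a good point along its passage through its tower of stage `n`. -/
theorem Good.name_eq (hR1 : d.R1) {n : ℕ} {x : M} (h : d.Good κ T n x) {j : ℤ} {J : ℕ}
    (hJ : d.level n (κ x) + j = J) (hJ' : J < d.q n) :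
    d.name κ T x j = d.letter n (d.tower n (κ x)) J := by
  have h0 : 0 ≤ (d.level n (κ x) : ℤ) + j := by omega
  have h1 : (d.level n (κ x) : ℤ) + j < d.q n := by omega
  rw [name, partitionLabel_eq hR1 n _ fun m hm => (h.passage hR1 h0 h1 hm).2, stageLetter]
  obtain ⟨h2, h3⟩ := (h n le_rfl).1 j h0 h1
  rw [h3]
  congr 1
  omega

/-- The point is not labelled at stage n + 1, so it sits in a run of its word of that stage, and its
name spells the whole word, including the b in front of the run. -/
theorem Good.inRun (hR1 : d.R1) {n : ℕ} {x : M} (h : d.Good κ T n x) :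
    ∃ o < (d.l n - 1) * d.q n, d.level n (κ x) = o % d.q n ∧
      d.InRun n (d.tower n (κ x)) o (d.name κ T x) := by
  obtain ⟨y, hy, o, ho, hJ, hlev, htow⟩ := exists_run_of_notMem hR1 (h n le_rfl).2.1
  have hrun := d.run_le hy
  have hpos := d.runStart_pos n y
  have h' : d.Good κ T (n + 1) x := h.mono (Nat.le_succ n)
  refine ⟨o, ho, hlev, ?_, fun i hi => ?_⟩
  · rw [h'.name_eq hR1 (J := d.runStart n y - 1) (by rw [hJ]; push_cast; omega) (by omega)]
    refine d.letter_before_run _ hy ?_ (by omega)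
    have := d.offset_lt n y
    unfold TwistCoeff.runStart
    omega
  · rw [h'.name_eq hR1 (J := d.runStart n y + i) (by rw [hJ]; push_cast; omega) (by omega),
      d.letter_run _ hy hi, htow]

/-- `InRun` is a condition on the sequence alone, and it determines the tower and the position in
the run, hence the level. -/
theorem levelTower_eq_of_name_eq (hl : ∀ n, 2 ≤ d.l n) (hR1 : d.R1) (hR3 : d.R3) {n : ℕ} {x x' : M}
    (h : d.Good κ T n x) (h' : d.Good κ T n x') (he : d.name κ T x = d.name κ T x') :
    d.levelTower n (κ x) = d.levelTower n (κ x') := by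
  obtain ⟨o, ho, hlev, hrun⟩ := h.inRun hR1
  obtain ⟨o', ho', hlev', hrun'⟩ := h'.inRun hR1
  rw [he] at hrun
  obtain ⟨e1, e2⟩ := inRun_unique hl hR3 ho ho' hrun hrun'
  simp only [levelTower, Prod.mk.injEq, Fin.mk.injEq]
  exact ⟨by rw [hlev, hlev', e1], e2⟩

theorem eq_of_forall_abs_sub_le {f : ℕ → ℕ} (hf : Tendsto f atTop atTop) {x y : I01}
    (h : ∀ᶠ n in atTop, |(x : ℝ) - y| ≤ 1 / f n) : x = y := by
  have h1 : Tendsto (fun n => 1 / (f n : ℝ)) atTop (𝓝 0) :=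
    tendsto_one_div_atTop_nhds_zero_nat.comp hf
  have h2 := ge_of_tendsto h1 h
  exact Subtype.ext (sub_eq_zero.mp (abs_nonpos_iff.mp h2))

theorem tendsto_q : Tendsto d.q atTop atTop :=
  tendsto_atTop_mono (fun n => (Nat.lt_two_pow_self.le.trans (two_pow_le_q n))) tendsto_id

/-- The levels of the towers are the atoms of the grids, up to relabelling, and the side lengths 1 /
q n and 1 / s n tend to 0. -/
theorem eq_of_levelTower_eq (hR1 : d.R1) {z w : Sq}
    (h : ∀ᶠ n in atTop, d.levelTower n z = d.levelTower n w) : z = w := by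
  have h1 : ∀ᶠ n in atTop, cellIndex (d.q n) z.1 = cellIndex (d.q n) w.1 ∧
      cellIndex (d.s n) z.2 = cellIndex (d.s n) w.2 := by
    filter_upwards [h] with n hn
    obtain ⟨F, hF⟩ := exists_perm_levelTower hR1 n
    rw [hF, hF] at hn
    exact atomIndex_eq_iff.mp (F.injective hn)
  refine Prod.ext (eq_of_forall_abs_sub_le (tendsto_q (d := d)) ?_) (eq_of_forall_abs_sub_le hR1.2 ?_)
  · filter_upwards [h1] with n hn using dist_le_of_cellIndex_eq (d.q_pos n) hn.1
  · filter_upwards [h1] with n hn using dist_le_of_cellIndex_eq (d.s_pos n) hn.2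

/-- A good point is at least n levels away from both ends of its tower, so for large n its word
covers any given window of coordinates. -/
theorem name_mem_symbolicShift (hR1 : d.R1) {x : M} (h : ∃ n, d.Good κ T n x) :
    d.name κ T x ∈ symbolicShift d.words := by
  obtain ⟨n₀, h⟩ := h
  intro a N
  obtain ⟨n, hn₀, hna, hnN⟩ : ∃ n, n₀ ≤ n ∧ a.natAbs ≤ n ∧ a.natAbs + N ≤ n :=
    ⟨n₀ + a.natAbs + N, by omega, by omega, by omega⟩
  have hg := h.mono hn₀
  obtain ⟨-, -, h1, h2⟩ := h n hn₀
  obtain ⟨J, hJ⟩ : ∃ J : ℕ, (J : ℤ) = d.level n (κ x) + a :=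
    ⟨(d.level n (κ x) + a).toNat, by rw [Int.toNat_of_nonneg]; omega⟩
  refine ⟨n, d.word n (d.tower n (κ x)), ⟨_, rfl⟩, (d.word n (d.tower n (κ x))).take J,
    (d.word n (d.tower n (κ x))).drop (J + N), ?_⟩
  have h3 : List.ofFn (fun i : Fin N => d.name κ T x (a + (i : ℕ))) =
      ((d.word n (d.tower n (κ x))).drop J).take N := by
    apply List.ext_getElem?
    intro i
    rcases Nat.lt_or_ge i N with hi | hi
    · rw [List.getElem?_take_of_lt hi, List.getElem?_drop, d.getElem?_word _ (by omega),
        List.getElem?_ofFn, dif_pos hi, hg.name_eq hR1 (J := J + i) (by push_cast; omega) (by omega)]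
    · rw [List.getElem?_eq_none (by simpa using hi),
        List.getElem?_eq_none (by rw [List.length_take]; omega)]
  rw [h3, ← List.drop_drop, List.append_assoc, List.take_append_drop, List.take_append_drop]

variable [MeasurableSpace M] {μ : Measure M}

theorem summable_ends : Summable fun n : ℕ => 2 * (n : ℝ) / d.q n := by
  have h1 : Summable fun n : ℕ => (n : ℝ) ^ 1 * (1 / 2 : ℝ) ^ n :=
    summable_pow_mul_geometric_of_norm_lt_one 1 (by norm_num)
  refine Summable.of_nonneg_of_le (fun n => by positivity) (fun n => ?_) (h1.mul_left 2)
  rw [pow_one, div_pow, one_pow, mul_div_assoc, mul_one_div]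
  gcongr
  exact_mod_cast two_pow_le_q n

/-- Three applications of Borel–Cantelli: to the jumps, to the labels with bounds 1 / l n, and to
the ends of the towers with bounds 2 n / q n. -/
theorem ae_good (hsum : Summable fun n => 1 / (d.l n : ℝ)) (hR1 : d.R1)
    (hκ : MeasurePreserving κ μ lebSq) (T : M ≃ᵐ M)
    (hT : MeasurePreserving T μ μ) (hlim : IsWeakLimit μ κ d.T T) :
    ∀ᵐ x ∂μ, ∃ n, d.Good κ T.toEquiv n x := by
  have hpre : ∀ A : Set Sq, μ (κ ⁻¹' A) ≤ lebSq A := fun A => by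
    rw [← hκ.map_eq]
    exact Measure.le_map_apply hκ.measurable.aemeasurable A
  have h1 : ∑' n, μ (κ ⁻¹' (d.newB n ∪ d.newE n)) ≠ ⊤ :=
    ne_top_of_le_ne_top hsum.tsum_ofReal_ne_top
      (ENNReal.tsum_le_tsum fun n => (hpre _).trans (lebSq_newB_union_newE_le hR1 n))
  have h2 : ∑' n, μ (κ ⁻¹' {z | d.level n z < n ∨ d.q n ≤ d.level n z + n}) ≠ ⊤ :=
    ne_top_of_le_ne_top (summable_ends (d := d)).tsum_ofReal_ne_top
      (ENNReal.tsum_le_tsum fun n => (hpre _).trans (lebSq_level_ends_le hR1 n n))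
  filter_upwards [ae_eventually_tracks hsum hR1 hκ T hT hlim, ae_eventually_notMem h1,
    ae_eventually_notMem h2] with x hx1 hx2 hx3
  obtain ⟨n, hn⟩ := eventually_atTop.mp (hx1.and (hx2.and hx3))
  refine ⟨n, fun m hm => ⟨(hn m hm).1, (hn m hm).2.1, ?_⟩⟩
  have := (hn m hm).2.2
  rw [Set.mem_preimage, Set.mem_ofPred_eq, not_or] at this
  omega

end AbC


/-! ### Sequences of the symbolic shift outside the runs -/

namespace AbC

variable {d : AbC}

theorem _root_.TwistCoeff.lead_mono (c : TwistCoeff) : Monotone c.lead :=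
  monotone_nat_of_le_succ fun n => by rw [c.lead_succ]; exact Nat.le_add_right _ _

/-- A position in a spacer of stage `m + 1` is followed by letters `e` and then at least `lead m`
letters `b`. -/
theorem spacer_tail (hl : ∀ n, 2 ≤ d.l n) {m J y : ℕ} (t : Fin (d.s (m + 1)))
    (hy : y < d.q m * d.k m)
    (h : (y * (d.l m * d.q m) ≤ J ∧ J < d.runStart m y) ∨
      (d.runStart m y + (d.l m - 1) * d.q m ≤ J ∧ J < (y + 1) * (d.l m * d.q m))) :
    ∃ x, J + x + d.lead m ≤ d.q (m + 1) ∧ (∀ i < x, d.letter (m + 1) t (J + i) = Letter.e) ∧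
      ∀ i < d.lead m, d.letter (m + 1) t (J + x + i) = Letter.b := by
  rcases h with h | h
  · have := run_lead_lt hl hy
    exact ⟨0, by omega, by simp, fun i hi => letter_near_run hl t hy (by omega) (by omega)⟩
  · have hrun := d.runStart_add_run m y
    have hy' : y + 1 < d.q m * d.k m := by
      by_contra hcon
      have e : y = d.q m * d.k m - 1 := by omega
      have h3 := d.offset_last m
      rw [← e] at h3
      omega
    have hlt := run_lead_lt hl hy'
    have hge : (y + 1) * (d.l m * d.q m) ≤ d.runStart m (y + 1) := Nat.le_add_right _ _
    refine ⟨(y + 1) * (d.l m * d.q m) - J, by omega, fun i hi => ?_, fun i hi => ?_⟩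
    · exact d.letter_after_run t hy (by omega) (by omega)
    · have : 0 < d.q m - d.offset m (y + 1) := by have := d.offset_lt m (y + 1); omega
      exact letter_near_run hl t hy' (by omega) (by unfold TwistCoeff.runStart; omega)

/-- A position in a word of stage `m > n` lies in a run of copies of a word of stage `n`, or it is
followed by letters `e` and then at least `lead n` letters `b`. -/
theorem run_or_tail (hl : ∀ n, 2 ≤ d.l n) {n m : ℕ} (hnm : n < m) {J : ℕ} (hJ : J < d.q m)
    (t : Fin (d.s m)) :
    (∃ u, ∃ o < (d.l n - 1) * d.q n, o + 1 ≤ J ∧ J - o + (d.l n - 1) * d.q n ≤ d.q m ∧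
      d.letter m t (J - o - 1) = Letter.b ∧
      ∀ i < (d.l n - 1) * d.q n, d.letter m t (J - o + i) = d.letter n u (i % d.q n)) ∨
    ∃ x, J + x + d.lead n ≤ d.q m ∧ (∀ i < x, d.letter m t (J + i) = Letter.e) ∧
      ∀ i < d.lead n, d.letter m t (J + x + i) = Letter.b := by
  induction m, hnm using Nat.le_induction generalizing J with
  | base =>
    obtain ⟨y, hy, hc | ⟨g, i, hg, hi, rfl⟩ | hc⟩ := d.exists_pos_cases hJ
    · exact Or.inr (spacer_tail hl t hy (Or.inl hc))
    · left
      have hpos := d.runStart_pos n y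
      have hg' : (g + 1) * d.q n ≤ (d.l n - 1) * d.q n := Nat.mul_le_mul_right _ hg
      rw [Nat.succ_mul] at hg'
      have hrun := d.run_le hy
      refine ⟨d.rowAt n y t, g * d.q n + i, by omega, by omega, ?_, ?_, fun i' hi' => ?_⟩
      · show _ ≤ d.q (n + 1)
        omega
      · refine d.letter_before_run t hy ?_ (by omega)
        have := d.offset_lt n y
        unfold TwistCoeff.runStart
        omega
      · rw [← d.letter_run t hy hi']
        congr 1
        omega
    · exact Or.inr (spacer_tail hl t hy (Or.inr hc))
  | succ m hm ih =>
    have hlead : d.lead n ≤ d.lead m := d.lead_mono (by omega)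
    obtain ⟨y, hy, hc | ⟨g, i, hg, hi, rfl⟩ | hc⟩ := d.exists_pos_cases hJ
    · obtain ⟨x, h0, h1, h2⟩ := spacer_tail hl t hy (Or.inl hc)
      exact Or.inr ⟨x, by omega, h1, fun i hi => h2 i (by omega)⟩
    · have hcopy : ∀ i' < d.q m, d.letter (m + 1) t (d.runStart m y + g * d.q m + i') =
          d.letter m (d.rowAt m y t) i' := fun i' hi' => d.letter_copy t hy hg hi'
      have hg' : (g + 1) * d.q m ≤ (d.l m - 1) * d.q m := Nat.mul_le_mul_right _ hg
      rw [Nat.succ_mul] at hg'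
      have hrun := d.run_le hy
      rcases ih hi (d.rowAt m y t) with ⟨u, o, ho, h1, h2, h3, h4⟩ | ⟨x, h0, h1, h2⟩
      · refine Or.inl ⟨u, o, ho, by omega, by omega, ?_, fun i' hi' => ?_⟩
        · rw [← h3, ← hcopy _ (by omega)]
          congr 1
          omega
        · rw [← h4 i' hi', ← hcopy _ (by omega)]
          congr 1
          omega
      · refine Or.inr ⟨x, by omega, fun i' hi' => ?_, fun i' hi' => ?_⟩
        · rw [← h1 i' hi', ← hcopy _ (by omega), add_assoc]
        · rw [← h2 i' hi', ← hcopy _ (by omega)]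
          congr 1
          omega
    · obtain ⟨x, h0, h1, h2⟩ := spacer_tail hl t hy (Or.inr hc)
      exact Or.inr ⟨x, by omega, h1, fun i hi => h2 i (by omega)⟩

theorem exists_word_of_le (hocc : ∀ n, ∀ w ∈ d.words n, ∀ w' ∈ d.words (n + 1), w <:+: w')
    {n m : ℕ} (hnm : n ≤ m) {w : List (Letter (Fin (d.s 0)))} (hw : w ∈ d.words n) :
    ∃ t, w <:+: d.word m t := by
  induction m, hnm using Nat.le_induction with
  | base =>
    obtain ⟨t, rfl⟩ := hw
    exact ⟨t, List.infix_rfl⟩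
  | succ m _ ih =>
    obtain ⟨t, ht⟩ := ih
    exact ⟨⟨0, d.s_pos _⟩, ht.trans (hocc m _ ⟨t, rfl⟩ _ ⟨_, rfl⟩)⟩

theorem exists_word_window (hocc : ∀ n, ∀ w ∈ d.words n, ∀ w' ∈ d.words (n + 1), w <:+: w')
    {z : ℤ → Letter (Fin (d.s 0))} (hz : z ∈ symbolicShift d.words) (n B : ℕ) :
    ∃ m, n < m ∧ ∃ t J, B ≤ J ∧ J + B ≤ d.q m ∧
      ∀ i : ℕ, i < 2 * B → z ((i : ℤ) - B) = d.letter m t (J - B + i) := by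
  obtain ⟨n', w, hw, hinf⟩ := hz (-(B : ℤ)) (2 * B)
  obtain ⟨t, ht⟩ := exists_word_of_le hocc (show n' ≤ n' + n + 1 by omega) hw
  obtain ⟨p, r, hpr⟩ := hinf.trans ht
  have hlen := congrArg List.length hpr
  simp only [List.length_append, List.length_ofFn, length_word] at hlen
  refine ⟨n' + n + 1, by omega, t, p.length + B, by omega, by omega, fun i hi => ?_⟩
  apply Option.some_injective
  rw [← d.getElem?_word t (by omega), ← hpr, List.append_assoc,
    List.getElem?_append_right (by omega),
    List.getElem?_append_left (by rw [List.length_ofFn]; omega), List.getElem?_ofFn,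
    dif_pos (by omega)]
  simp only [Option.some.injEq]
  congr 1
  omega

/-- The sequences of which the coordinate `0` lies in a run of copies of words of stage `n`. -/
def runSet (d : AbC) (n : ℕ) : Set (ℤ → Letter (Fin (d.s 0))) :=
  ⋃ c ∈ (Finset.univ : Finset (Fin (d.s n))) ×ˢ Finset.range ((d.l n - 1) * d.q n),
    {z | d.InRun n c.1 c.2 z}

/-- A window around 0 is part of a word of a later stage, and off the runs `run_or_tail` leaves only
e's followed by b's to the right of 0. The conclusion speaks of adjacent coordinates only, so that
it can be combined over different n. -/
theorem tail_of_notMem_runSet (hl : ∀ n, 2 ≤ d.l n)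
    (hocc : ∀ n, ∀ w ∈ d.words n, ∀ w' ∈ d.words (n + 1), w <:+: w') {n : ℕ}
    {z : ℤ → Letter (Fin (d.s 0))} (hz : z ∈ symbolicShift d.words) (hn : z ∉ d.runSet n) {i : ℕ}
    (hi : i + 1 < d.lead n) :
    (z i = Letter.e ∨ z i = Letter.b) ∧ (z i = Letter.b → z ((i : ℤ) + 1) = Letter.b) := by
  obtain ⟨m, hnm, t, J, hJ, hJ', hw⟩ :=
    exists_word_window hocc hz n ((d.l n - 1) * d.q n + d.lead n + 1)
  -- Wide enough for a complete run through 0 with the letter before it, and for `lead n` letters to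
  -- the right.
  set B := (d.l n - 1) * d.q n + d.lead n + 1 with hB
  rcases run_or_tail hl hnm (by omega : J < d.q m) t with
    ⟨u, o, ho, h1, h2, h3, h4⟩ | ⟨x, h0, h1, h2⟩
  · refine absurd ?_ hn
    have hmem : (u, o) ∈ (Finset.univ : Finset (Fin (d.s n))) ×ˢ
        Finset.range ((d.l n - 1) * d.q n) := by simpa using ho
    refine Set.mem_biUnion (Finset.mem_coe.mpr hmem) (show d.InRun n u o z from ⟨?_, fun i hi => ?_⟩)
    · rw [← h3]
      have := hw (B - o - 1) (by omega)
      rw [show J - B + (B - o - 1) = J - o - 1 by omega] at this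
      rw [← this]
      congr 1
      omega
    · rw [← h4 i hi]
      have := hw (B - o + i) (by omega)
      rw [show J - B + (B - o + i) = J - o + i by omega] at this
      rw [← this]
      congr 1
      omega
  · have hz' : ∀ i < d.lead n, z i = d.letter m t (J + i) := by
      intro i hi
      have := hw (B + i) (by omega)
      rw [show J - B + (B + i) = J + i by omega] at this
      rw [← this]
      congr 1
      omega
    have hbx : ∀ i < d.lead n, x ≤ i → z i = Letter.b := by
      intro i hi hx
      rw [hz' i hi, ← h2 (i - x) (by omega)]
      congr 1
      omega
    rcases Nat.lt_or_ge i x with hx | hx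
    · have : z i = Letter.e := by rw [hz' i (by omega), h1 i hx]
      exact ⟨Or.inl this, fun h => by rw [this] at h; simp at h⟩
    · refine ⟨Or.inr (hbx i (by omega) hx), fun _ => ?_⟩
      exact_mod_cast hbx (i + 1) hi (by omega)

end AbC

/-! ### Invariant measures of the symbolic shift -/

instance (n : ℕ) : Countable (Letter (Fin n)) := by
  let f : Letter (Fin n) → Option (Option (Fin n)) := fun x => match x with
    | .sym a => some (some a)
    | .b => some none
    | .e => none
  refine Function.Injective.countable (f := f) ?_
  rintro (a | _ | _) (a' | _ | _) h <;> simp_all [f]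

instance (α : Type) : DiscreteMeasurableSpace (Letter α) := ⟨fun _ => trivial⟩

theorem measurable_shiftMap (A : Type) [MeasurableSpace A] : Measurable (shiftMap A) :=
  measurable_pi_lambda _ fun _ => measurable_pi_apply _

theorem measurableSet_eval_eq {A : Type} [MeasurableSpace A] [DiscreteMeasurableSpace A] (i : ℤ)
    (a : A) : MeasurableSet {z : ℤ → A | z i = a} :=
  (measurable_pi_apply (X := fun _ : ℤ => A) i) (MeasurableSet.of_discrete (s := {a}))

/-- An invariant measure without atoms does not charge the sequences that are constant from
some coordinate on. -/
theorem IsNonatomicInvariant.measure_eventually_const {A : Type} [MeasurableSpace A]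
    [DiscreteMeasurableSpace A] {K : Set (ℤ → A)} {ν : Measure (ℤ → A)}
    (hν : IsNonatomicInvariant K ν) (a : A) (j : ℤ) : ν {z | ∀ i : ℕ, z (i + j) = a} = 0 := by
  have := hν.prob
  let F : ℤ → Set (ℤ → A) := fun j => {z | ∀ i : ℕ, z (i + j) = a}
  have hF : ∀ j, MeasurableSet (F j) := fun j => by
    simp only [F, Set.ofPred_forall]
    exact MeasurableSet.iInter fun i => measurableSet_eval_eq _ _
  have hstep : ∀ j, ν (F (j + 1)) = ν (F j) := by
    intro j
    rw [← hν.invariant.measure_preimage (hF j).nullMeasurableSet]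
    congr 1
    ext z
    simp only [F, Set.mem_ofPred_eq, Set.mem_preimage, shiftMap, add_assoc]
  have hconst : ∀ n : ℕ, ν (F (-(n : ℤ))) = ν (F 0) := by
    intro n
    induction n with
    | zero => simp
    | succ n ih =>
      rw [← ih, ← hstep (-((n + 1 : ℕ) : ℤ))]
      congr 2
      push_cast
      ring
  -- These sets all have the same measure and decrease to the single constant sequence, which is not
  -- an atom.
  have hanti : Antitone fun n : ℕ => F (-(n : ℤ)) := by
    refine antitone_nat_of_succ_le fun n z hz i => ?_
    have := hz (i + 1)
    rw [← this]
    congr 1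
    push_cast
    ring
  have hlim := tendsto_measure_iInter_atTop (μ := ν)
    (fun n : ℕ => (hF (-(n : ℤ))).nullMeasurableSet) hanti ⟨0, measure_ne_top _ _⟩
  have hInter : ⋂ n : ℕ, F (-(n : ℤ)) ⊆ {fun _ => a} := by
    intro z hz
    rw [Set.mem_iInter] at hz
    refine Set.mem_singleton_iff.mpr (funext fun i => ?_)
    have := hz i.natAbs (i + i.natAbs).toNat
    rw [← this]
    congr 1
    omega
  rw [measure_mono_null hInter (hν.noAtoms _)] at hlim
  simp only [Function.comp_def, hconst] at hlim
  have h0 : ν (F 0) = 0 := tendsto_nhds_unique tendsto_const_nhds hlim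
  have hall : ∀ n : ℕ, ν (F n) = 0 := by
    intro n
    induction n with
    | zero => exact h0
    | succ n ih => rw [Nat.cast_succ, hstep, ih]
  obtain ⟨n, rfl | rfl⟩ := j.eq_nat_or_neg
  · exact hall n
  · exact (hconst n).trans h0

namespace AbC

variable {d : AbC}

theorem measurableSet_inRun (n : ℕ) (u : Fin (d.s n)) (o : ℕ) :
    MeasurableSet {z | d.InRun n u o z} := by
  simp only [InRun, Set.ofPred_and, Set.ofPred_forall]
  exact (measurableSet_eval_eq _ _).inter
    (MeasurableSet.iInter fun i => MeasurableSet.iInter fun _ => measurableSet_eval_eq _ _)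

theorem measurableSet_runSet (n : ℕ) : MeasurableSet (d.runSet n) :=
  Finset.measurableSet_biUnion _ fun c _ => measurableSet_inRun n c.1 c.2

/-- The limit superior of the complements is null: as `lead n` is unbounded, its sequences in the
symbolic shift have a right half that is constantly e or eventually b. -/
theorem tendsto_measure_compl_runSet (hl : ∀ n, 2 ≤ d.l n)
    (hocc : ∀ n, ∀ w ∈ d.words n, ∀ w' ∈ d.words (n + 1), w <:+: w')
    {ν : Measure (ℤ → Letter (Fin (d.s 0)))}
    (hν : IsNonatomicInvariant (symbolicShift d.words) ν) :
    Tendsto (fun n => ν (d.runSet n)ᶜ) atTop (𝓝 0) := by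
  have := hν.prob
  let U : ℕ → Set (ℤ → Letter (Fin (d.s 0))) := fun n => ⋃ m, (d.runSet (n + m))ᶜ
  have hU : ∀ n, MeasurableSet (U n) := fun n =>
    MeasurableSet.iUnion fun m => (measurableSet_runSet _).compl
  have hanti : Antitone U := antitone_nat_of_succ_le fun n => by
    refine Set.iUnion_subset fun m => ?_
    rw [add_assoc]
    exact Set.subset_iUnion (fun m => (d.runSet (n + m))ᶜ) (1 + m)
  have hlim := tendsto_measure_iInter_atTop (μ := ν) (fun n => (hU n).nullMeasurableSet) hanti
    ⟨0, measure_ne_top _ _⟩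
  have hnull : ν (⋂ n, U n) = 0 := by
    have hsub : ⋂ n, U n ⊆ (symbolicShift d.words)ᶜ ∪ ({z | ∀ i : ℕ, z (i + 0) = Letter.e} ∪
        ⋃ j : ℕ, {z | ∀ i : ℕ, z (i + (j : ℤ)) = Letter.b}) := by
      intro z hz
      by_cases hzK : z ∈ symbolicShift d.words
      swap
      · exact Or.inl hzK
      right
      have htail : ∀ i : ℕ, (z i = Letter.e ∨ z i = Letter.b) ∧
          (z i = Letter.b → z ((i : ℤ) + 1) = Letter.b) := by
        intro i
        -- The stage is at least i + 2, which by n ≤ `lead n` puts i + 1 within the range that the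
        -- tail controls.
        obtain ⟨m, hm⟩ := Set.mem_iUnion.mp (Set.mem_iInter.mp hz (i + 2))
        refine tail_of_notMem_runSet hl hocc hzK hm ?_
        have := d.le_lead (i + 2 + m)
        omega
      by_cases hb : ∃ j : ℕ, z j = Letter.b
      · obtain ⟨j, hj⟩ := hb
        refine Or.inr (Set.mem_iUnion.mpr ⟨j, fun i => ?_⟩)
        induction i with
        | zero => simpa using hj
        | succ i ih =>
          have := (htail (i + j)).2 (by exact_mod_cast ih)
          rw [← this]
          congr 1
          push_cast
          ring
      · push Not at hb
        exact Or.inl fun i => by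
          rw [add_zero]
          exact (htail i).1.resolve_right (hb i)
    refine measure_mono_null hsub (measure_union_null hν.concentrated
      (measure_union_null (hν.measure_eventually_const _ _)
        (measure_iUnion_null fun j => hν.measure_eventually_const _ _)))
  rw [hnull] at hlim
  refine tendsto_of_tendsto_of_tendsto_of_le_of_le tendsto_const_nhds hlim
    (fun n => zero_le) fun n => measure_mono ?_
  exact Set.subset_iUnion (fun m => (d.runSet (n + m))ᶜ) 0

end AbC


/-! ### Frequencies of patterns in the words -/

theorem Finset.sum_range_mul_mod {R : Type*} [Semiring R] (a q : ℕ) (f : ℕ → R) :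
    ∑ o ∈ Finset.range (a * q), f (o % q) = a * ∑ i ∈ Finset.range q, f i := by
  induction a with
  | zero => simp
  | succ a ih =>
    rw [Nat.succ_mul, Finset.sum_range_add, ih, Nat.cast_succ, add_mul, one_mul]
    congr 1
    refine Finset.sum_congr rfl fun i hi => ?_
    rw [Nat.mul_add_mod_self_right, Nat.mod_eq_of_lt (Finset.mem_range.mp hi)]

namespace AbC

variable {d : AbC}

/-- The positions at distance at least `B` from the ends of a word at which the pattern `v` on the
set `I` of coordinates occurs. -/
def patternPositions (d : AbC) (I : Finset ℤ) (v : ℤ → Letter (Fin (d.s 0))) (B n : ℕ)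
    (u : Fin (d.s n)) : Finset ℕ :=
  (Finset.range (d.q n)).filter fun J => B ≤ J ∧ J + B < d.q n ∧
    ∀ i ∈ I, d.letter n u ((J : ℤ) + i).toNat = v i

/-- The positions at distance less than `B` from the ends of a word. -/
def endPositions (d : AbC) (B n : ℕ) : Finset ℕ :=
  (Finset.range (d.q n)).filter fun J => J < B ∨ d.q n ≤ J + B

theorem card_endPositions_le (B n : ℕ) : (d.endPositions B n).card ≤ 2 * B := by
  have hsub : d.endPositions B n ⊆ Finset.range B ∪ Finset.Ico (d.q n - B) (d.q n) := by
    intro J hJ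
    simp only [endPositions, Finset.mem_filter, Finset.mem_union, Finset.mem_range,
      Finset.mem_Ico] at hJ ⊢
    omega
  refine (Finset.card_le_card hsub).trans ((Finset.card_union_le _ _).trans ?_)
  simp only [Finset.card_range, Nat.card_Ico]
  omega

theorem copyPosition_injOn (n : ℕ) : Set.InjOn
    (fun c : (ℕ × ℕ) × ℕ => d.runStart n c.1.1 + c.1.2 * d.q n + c.2)
    {c | c.1.2 < d.l n - 1 ∧ c.2 < d.q n} := by
  rintro ⟨⟨y, g⟩, i⟩ ⟨hg, hi⟩ ⟨⟨y', g'⟩, i'⟩ ⟨hg', hi'⟩ e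
  simp only at hg hi hg' hi' e
  have hq := d.q_pos n
  have hb : ∀ y g i, g < d.l n - 1 → i < d.q n →
      y * (d.l n * d.q n) ≤ d.runStart n y + g * d.q n + i ∧
        d.runStart n y + g * d.q n + i < (y + 1) * (d.l n * d.q n) := by
    intro y g i hg hi
    have h1 : (g + 1) * d.q n ≤ (d.l n - 1) * d.q n := Nat.mul_le_mul_right _ hg
    have h2 := d.runStart_add_run n y
    rw [Nat.succ_mul] at h1
    exact ⟨by unfold TwistCoeff.runStart; omega, by omega⟩
  have b1 := hb y g i hg hi
  have b2 := hb y' g' i' hg' hi'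
  have hyy : y = y' := by
    rcases lt_trichotomy y y' with h1 | h1 | h1
    · have := Nat.mul_le_mul_right (d.l n * d.q n) (Nat.succ_le_of_lt h1)
      rw [Nat.succ_eq_add_one] at this
      omega
    · exact h1
    · have := Nat.mul_le_mul_right (d.l n * d.q n) (Nat.succ_le_of_lt h1)
      rw [Nat.succ_eq_add_one] at this
      omega
  subst hyy
  have h3 : d.q n * g + i = d.q n * g' + i' := by
    rw [mul_comm, mul_comm _ g']; omega
  have h4 := congrArg (· / d.q n) h3
  have h5 := congrArg (· % d.q n) h3
  simp only [Nat.mul_add_div hq, Nat.div_eq_of_lt hi, Nat.div_eq_of_lt hi', add_zero,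
    Nat.mul_add_mod, Nat.mod_eq_of_lt hi, Nat.mod_eq_of_lt hi'] at h4 h5
  rw [h4, h5]

/-- The number of occurrences of a pattern in the words of stage `n + 1` is almost the same for
all of them. -/
theorem card_patternPositions_succ (hR2 : d.R2) (I : Finset ℤ) (v : ℤ → Letter (Fin (d.s 0)))
    {B : ℕ} (hI : ∀ i ∈ I, |i| ≤ B) (n : ℕ) : ∃ c : ℕ, ∀ t : Fin (d.s (n + 1)),
      c ≤ (d.patternPositions I v B (n + 1) t).card ∧
      (d.patternPositions I v B (n + 1) t).card ≤
        c + (d.q n * d.k n * d.q n + d.q n * d.k n * (d.l n - 1) * (2 * B)) := by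
  classical
  -- The count inside the copies away from their ends, which R2 makes independent of t. The error
  -- term counts the spacers and the ends of the copies.
  refine ⟨(d.l n - 1) * (d.q n * (d.k n / d.s n) * ∑ u, (d.patternPositions I v B n u).card),
    fun t => ?_⟩
  have hq := d.q_pos n
  let Φ : (ℕ × ℕ) × ℕ → ℕ := fun c => d.runStart n c.1.1 + c.1.2 * d.q n + c.2
  let D : Finset ((ℕ × ℕ) × ℕ) :=
    (Finset.range (d.q n * d.k n) ×ˢ Finset.range (d.l n - 1)) ×ˢ Finset.range (d.q n)
  let S : Finset ((ℕ × ℕ) × ℕ) :=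
    D.filter fun c => c.2 ∈ d.patternPositions I v B n (d.rowAt n c.1.1 t)
  let R : Finset ((ℕ × ℕ) × ℕ) := D.filter fun c => c.2 ∉ d.endPositions B n
  have hinjD : Set.InjOn Φ (D : Set ((ℕ × ℕ) × ℕ)) := by
    refine (copyPosition_injOn n).mono fun c hc => ?_
    simp only [D, Finset.coe_product, Set.mem_prod, Finset.mem_coe, Finset.mem_range] at hc
    exact ⟨hc.1.2, hc.2⟩
  have hcardS : S.card =
      (d.l n - 1) * (d.q n * (d.k n / d.s n) * ∑ u, (d.patternPositions I v B n u).card) := by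
    rw [← sum_rowAt hR2 n t, Finset.mul_sum, Finset.card_filter, Finset.sum_product,
      Finset.sum_product]
    refine Finset.sum_congr rfl fun y _ => ?_
    have h1 : (Finset.range (d.q n)).filter
        (fun i => i ∈ d.patternPositions I v B n (d.rowAt n y t)) =
        d.patternPositions I v B n (d.rowAt n y t) := by
      ext i
      simp only [Finset.mem_filter, patternPositions, Finset.mem_range]
      tauto
    have h2 : ∀ g ∈ Finset.range (d.l n - 1),
        (∑ i ∈ Finset.range (d.q n),
          if i ∈ d.patternPositions I v B n (d.rowAt n y t) then 1 else 0) =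
        (d.patternPositions I v B n (d.rowAt n y t)).card := by
      intro g _
      rw [← Finset.card_filter, h1]
    refine (Finset.sum_congr rfl h2).trans ?_
    rw [Finset.sum_const, Finset.card_range, smul_eq_mul]
  have hcardR : d.q n * d.k n * (d.l n - 1) * d.q n ≤
      R.card + d.q n * d.k n * (d.l n - 1) * (2 * B) := by
    have h1 : R.card + (D.filter fun c => ¬ c.2 ∉ d.endPositions B n).card = D.card :=
      Finset.card_filter_add_card_filter_not _
    have h2 : (D.filter fun c => ¬ c.2 ∉ d.endPositions B n) ⊆
        (Finset.range (d.q n * d.k n) ×ˢ Finset.range (d.l n - 1)) ×ˢ d.endPositions B n := by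
      intro c hc
      simp only [D, Finset.mem_filter, Finset.mem_product, not_not] at hc ⊢
      exact ⟨hc.1.1, hc.2⟩
    have h3 := Finset.card_le_card h2
    simp only [D, Finset.card_product, Finset.card_range] at h1 h3
    have h4 := Nat.mul_le_mul_left (d.q n * d.k n * (d.l n - 1)) (card_endPositions_le (d := d) B n)
    omega
  -- copies of a pattern at stage `n` and their positions at stage `n + 1`
  have hmem : ∀ c ∈ R, Φ c ∈ d.patternPositions I v B (n + 1) t ↔ c ∈ S := by
    rintro ⟨⟨y, g⟩, i⟩ hc
    simp only [R, D, S, endPositions, patternPositions, Φ, Finset.mem_filter, Finset.mem_product,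
      Finset.mem_range, not_and, not_or, not_lt, not_le] at hc ⊢
    obtain ⟨⟨⟨hy, hg⟩, hi⟩, hends⟩ := hc
    obtain ⟨h1, h2⟩ := hends hi
    have hg' : (g + 1) * d.q n ≤ (d.l n - 1) * d.q n := Nat.mul_le_mul_right _ hg
    rw [Nat.succ_mul] at hg'
    have hrun := d.run_le hy
    have hlet : ∀ j ∈ I, d.letter (n + 1) t
        (((d.runStart n y + g * d.q n + i : ℕ) : ℤ) + j).toNat =
          d.letter n (d.rowAt n y t) ((i : ℤ) + j).toNat := by
      intro j hj
      have hj' := abs_le.mp (hI j hj)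
      rw [← d.letter_copy t hy hg (by omega)]
      congr 1
      omega
    constructor
    · rintro ⟨-, -, -, h3⟩
      exact ⟨⟨⟨hy, hg⟩, hi⟩, hi, h1, h2, fun j hj => by rw [← hlet j hj, h3 j hj]⟩
    · rintro ⟨-, -, -, -, h3⟩
      exact ⟨by omega, by omega, by omega, fun j hj => by rw [hlet j hj, h3 j hj]⟩
  have hSR : S ⊆ R := by
    intro c hc
    simp only [S, R, patternPositions, endPositions, Finset.mem_filter, Finset.mem_range] at hc ⊢
    exact ⟨hc.1, by omega⟩
  have hRD : R ⊆ D := Finset.filter_subset _ _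
  have hcS : (S.image Φ).card = S.card :=
    Finset.card_image_of_injOn (hinjD.mono (by exact_mod_cast hSR.trans hRD))
  have hcR : (R.image Φ).card = R.card :=
    Finset.card_image_of_injOn (hinjD.mono (by exact_mod_cast hRD))
  have hlow : S.image Φ ⊆ d.patternPositions I v B (n + 1) t := by
    intro J hJ
    obtain ⟨c, hc, rfl⟩ := Finset.mem_image.mp hJ
    exact (hmem c (hSR hc)).mpr hc
  have hup : d.patternPositions I v B (n + 1) t ⊆
      S.image Φ ∪ (Finset.range (d.q (n + 1)) \ R.image Φ) := by
    intro J hJ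
    by_cases hR : J ∈ R.image Φ
    · obtain ⟨c, hc, rfl⟩ := Finset.mem_image.mp hR
      exact Finset.mem_union_left _ (Finset.mem_image_of_mem _ ((hmem c hc).mp hJ))
    · exact Finset.mem_union_right _ (Finset.mem_sdiff.mpr ⟨(Finset.mem_filter.mp hJ).1, hR⟩)
  have hRsub : R.image Φ ⊆ Finset.range (d.q (n + 1)) := by
    intro J hJ
    obtain ⟨⟨⟨y, g⟩, i⟩, hc, rfl⟩ := Finset.mem_image.mp hJ
    simp only [R, D, Finset.mem_filter, Finset.mem_product, Finset.mem_range] at hc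
    have hg' : (g + 1) * d.q n ≤ (d.l n - 1) * d.q n := Nat.mul_le_mul_right _ hc.1.1.2
    rw [Nat.succ_mul] at hg'
    have hrun := d.run_le hc.1.1.1
    simp only [Φ, Finset.mem_range]
    omega
  rw [← hcardS]
  refine ⟨hcS ▸ Finset.card_le_card hlow, ?_⟩
  have h1 := (Finset.card_le_card hup).trans (Finset.card_union_le _ _)
  rw [Finset.card_sdiff_of_subset hRsub, Finset.card_range, hcS, hcR] at h1
  have hsucc : d.q (n + 1) = d.q n * d.k n * (d.l n - 1) * d.q n + d.q n * d.k n * d.q n := by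
    rw [d.q_succ, ← d.pred_l_mul_q]; ring
  omega

/-! ### Uniqueness of the invariant measure -/

theorem inRun_shift (n : ℕ) (u : Fin (d.s n)) (o : ℕ) (z : ℤ → Letter (Fin (d.s 0))) :
    d.InRun n u (o + 1) (shiftMap _ z) ↔ d.InRun n u o z := by
  have e1 : -((o + 1 : ℕ) : ℤ) - 1 + 1 = -(o : ℤ) - 1 := by push_cast; ring
  have e2 : ∀ i : ℕ, (i : ℤ) - ((o + 1 : ℕ) : ℤ) + 1 = i - o := fun i => by push_cast; ring
  simp only [InRun, shiftMap, e1, e2]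

/-- The shift moves coordinate 0 along the run. As all positions in a run are equally likely, the
measure of a pattern inside runs is an average over words. -/
theorem measureReal_inRun {ν : Measure (ℤ → Letter (Fin (d.s 0)))}
    (hν : MeasurePreserving (shiftMap (Letter (Fin (d.s 0)))) ν ν) (n : ℕ) (u : Fin (d.s n))
    (o : ℕ) : ν.real {z | d.InRun n u o z} = ν.real {z | d.InRun n u 0 z} := by
  induction o with
  | zero => rfl
  | succ o ih =>
    rw [← ih, measureReal_def, measureReal_def,
      ← hν.measure_preimage (measurableSet_inRun n u (o + 1)).nullMeasurableSet]
    congr 2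
    ext z
    exact inRun_shift n u o z

/-- The measure of a pattern in terms of the number of its occurrences in words. -/
theorem measureReal_pattern_bounds (hl : ∀ n, 2 ≤ d.l n) (hR3 : d.R3)
    {ν : Measure (ℤ → Letter (Fin (d.s 0)))} [IsProbabilityMeasure ν]
    (hν : MeasurePreserving (shiftMap (Letter (Fin (d.s 0)))) ν ν)
    (I : Finset ℤ) (v : ℤ → Letter (Fin (d.s 0))) {B : ℕ} (hI : ∀ i ∈ I, |i| ≤ B) {n c e : ℕ}
    (hc : ∀ u, c ≤ (d.patternPositions I v B n u).card ∧
      (d.patternPositions I v B n u).card ≤ c + e) :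
    c / d.q n * ν.real (d.runSet n) ≤ ν.real {z | ∀ i ∈ I, z i = v i} ∧
      ν.real {z | ∀ i ∈ I, z i = v i} ≤
        (c + e + 2 * B) / d.q n + ν.real (d.runSet n)ᶜ := by
  classical
  have hq := d.q_pos n
  have hq' : (0 : ℝ) < d.q n := by exact_mod_cast hq
  set E : Set (ℤ → Letter (Fin (d.s 0))) := {z | ∀ i ∈ I, z i = v i} with hE
  have hEm : MeasurableSet E := by
    simp only [hE, Set.ofPred_forall]
    exact MeasurableSet.iInter fun i => MeasurableSet.iInter fun _ => measurableSet_eval_eq _ _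
  let P : Finset (Fin (d.s n) × ℕ) := Finset.univ ×ˢ Finset.range ((d.l n - 1) * d.q n)
  let A : Fin (d.s n) × ℕ → Set (ℤ → Letter (Fin (d.s 0))) := fun p => {z | d.InRun n p.1 p.2 z}
  have hA : ∀ p, MeasurableSet (A p) := fun p => measurableSet_inRun n p.1 p.2
  let ρ : Fin (d.s n) → ℝ := fun u => ν.real (A (u, 0))
  have hρ : ∀ u o, ν.real (A (u, o)) = ρ u := fun u o => measureReal_inRun hν n u o
  have hρ0 : ∀ u, 0 ≤ ρ u := fun u => measureReal_nonneg
  have hdisj : (P : Set (Fin (d.s n) × ℕ)).PairwiseDisjoint A := by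
    rintro ⟨u, o⟩ ho ⟨u', o'⟩ ho' hne
    simp only [P, Finset.coe_product, Set.mem_prod, Finset.mem_coe, Finset.mem_range] at ho ho'
    refine Set.disjoint_left.mpr fun z hz hz' => hne ?_
    obtain ⟨e1, e2⟩ := inRun_unique hl hR3 ho.2 ho'.2 hz hz'
    exact Prod.ext e2 e1
  have hrun : ν.real (d.runSet n) = (d.l n - 1 : ℕ) * d.q n * ∑ u, ρ u := by
    rw [show d.runSet n = ⋃ p ∈ P, A p from rfl,
      measureReal_biUnion_finset hdisj fun p _ => hA p, Finset.sum_product, Finset.mul_sum]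
    refine Finset.sum_congr rfl fun u _ => ?_
    simp [hρ]
  have hErun : ν.real (E ∩ d.runSet n) =
      ∑ u, ∑ o ∈ Finset.range ((d.l n - 1) * d.q n), ν.real (E ∩ A (u, o)) := by
    rw [show d.runSet n = ⋃ p ∈ P, A p from rfl, Set.inter_iUnion₂,
      measureReal_biUnion_finset (hdisj.mono fun p => Set.inter_subset_right)
        (fun p _ => hEm.inter (hA p)), Finset.sum_product]
  -- the pattern on a level of a run
  have hlevel : ∀ u, ∀ o < (d.l n - 1) * d.q n, B ≤ o % d.q n → o % d.q n + B < d.q n →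
      ∀ z ∈ A (u, o), ∀ i ∈ I, z i = d.letter n u (((o % d.q n : ℕ) : ℤ) + i).toNat := by
    intro u o ho h1 h2 z hz i hi
    have hi' := abs_le.mp (hI i hi)
    have hdm := Nat.div_add_mod' o (d.q n)
    have hg : (o / d.q n + 1) * d.q n ≤ (d.l n - 1) * d.q n :=
      Nat.mul_le_mul_right _ ((Nat.div_lt_iff_lt_mul hq).mpr ho)
    rw [Nat.succ_mul] at hg
    have h3 := hz.2 ((o : ℤ) + i).toNat (by omega)
    have e1 : (((o : ℤ) + i).toNat : ℤ) - o = i := by omega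
    rw [e1] at h3
    rw [h3]
    congr 1
    have e2 : ((o : ℤ) + i).toNat =
        d.q n * (o / d.q n) + (((o % d.q n : ℕ) : ℤ) + i).toNat := by
      rw [mul_comm]; omega
    rw [e2, Nat.mul_add_mod, Nat.mod_eq_of_lt (by omega)]
  have hlow : ∀ u, ∀ o ∈ Finset.range ((d.l n - 1) * d.q n),
      (if o % d.q n ∈ d.patternPositions I v B n u then ρ u else 0) ≤ ν.real (E ∩ A (u, o)) := by
    intro u o ho
    rw [Finset.mem_range] at ho
    split_ifs with h
    · simp only [patternPositions, Finset.mem_filter] at h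
      rw [← hρ u o]
      refine measureReal_mono fun z hz => ⟨fun i hi => ?_, hz⟩
      rw [hlevel u o ho h.2.1 h.2.2.1 z hz i hi, h.2.2.2 i hi]
    · exact measureReal_nonneg
  have hup : ∀ u, ∀ o ∈ Finset.range ((d.l n - 1) * d.q n), ν.real (E ∩ A (u, o)) ≤
      (if o % d.q n ∈ d.patternPositions I v B n u then ρ u else 0) +
        if o % d.q n ∈ d.endPositions B n then ρ u else 0 := by
    intro u o ho
    rw [Finset.mem_range] at ho
    have hle : ν.real (E ∩ A (u, o)) ≤ ρ u := by
      rw [← hρ u o]; exact measureReal_mono Set.inter_subset_right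
    have hmod : o % d.q n < d.q n := Nat.mod_lt _ hq
    by_cases h1 : o % d.q n ∈ d.patternPositions I v B n u
    · rw [if_pos h1]
      have : 0 ≤ if o % d.q n ∈ d.endPositions B n then ρ u else 0 := by
        split_ifs
        exacts [hρ0 u, le_rfl]
      linarith
    by_cases h2 : o % d.q n ∈ d.endPositions B n
    · rw [if_neg h1, if_pos h2, zero_add]
      exact hle
    · rw [if_neg h1, if_neg h2, add_zero]
      simp only [endPositions, Finset.mem_filter, Finset.mem_range, not_and, not_or, not_lt,
        not_le] at h2
      obtain ⟨h3, h4⟩ := h2 hmod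
      have hempty : E ∩ A (u, o) = ∅ := by
        refine Set.eq_empty_of_forall_notMem fun z hz => h1 ?_
        simp only [patternPositions, Finset.mem_filter, Finset.mem_range]
        exact ⟨hmod, h3, h4, fun i hi => by
          rw [← hlevel u o ho h3 h4 z hz.2 i hi]; exact hz.1 i hi⟩
      rw [hempty, measureReal_empty]
  have hcount : ∀ (S : Finset ℕ) u, S ⊆ Finset.range (d.q n) →
      ∑ o ∈ Finset.range ((d.l n - 1) * d.q n), (if o % d.q n ∈ S then ρ u else 0) =
        (d.l n - 1 : ℕ) * (S.card * ρ u) := by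
    intro S u hS
    rw [Finset.sum_range_mul_mod _ _ fun i => if i ∈ S then ρ u else 0, Finset.sum_ite_mem,
      Finset.inter_eq_right.mpr hS, Finset.sum_const, nsmul_eq_mul]
  have hfrac : ∀ a : ℝ, ∑ u, ((d.l n - 1 : ℕ) : ℝ) * (a * ρ u) = a / d.q n * ν.real (d.runSet n) := by
    intro a
    rw [hrun, ← Finset.mul_sum, ← Finset.mul_sum]
    field_simp
  constructor
  · rw [← hfrac]
    refine le_trans ?_ (measureReal_mono (Set.inter_subset_left : E ∩ d.runSet n ⊆ E))
    rw [hErun]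
    refine Finset.sum_le_sum fun u _ => le_trans ?_ (Finset.sum_le_sum (hlow u))
    rw [hcount (d.patternPositions I v B n u) u (Finset.filter_subset _ _)]
    have := (hc u).1
    have h0 := hρ0 u
    gcongr
  · have h1 : ν.real E ≤ ν.real (E ∩ d.runSet n) + ν.real (d.runSet n)ᶜ := by
      refine (measureReal_mono (fun z hz => ?_ : E ⊆ (E ∩ d.runSet n) ∪ (d.runSet n)ᶜ)).trans
        (measureReal_union_le _ _)
      by_cases h : z ∈ d.runSet n
      exacts [Or.inl ⟨hz, h⟩, Or.inr h]
    have h2 : ν.real (E ∩ d.runSet n) ≤ (c + e + 2 * B) / d.q n * ν.real (d.runSet n) := by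
      rw [← hfrac, hErun]
      refine Finset.sum_le_sum fun u _ => (Finset.sum_le_sum (hup u)).trans ?_
      rw [Finset.sum_add_distrib,
        hcount (d.patternPositions I v B n u) u (Finset.filter_subset _ _),
        hcount (d.endPositions B n) u (Finset.filter_subset _ _), ← mul_add, ← add_mul]
      have h0 := hρ0 u
      have h3 : ((d.patternPositions I v B n u).card : ℝ) ≤ c + e := by exact_mod_cast (hc u).2
      have h4 : ((d.endPositions B n).card : ℝ) ≤ 2 * B := by
        exact_mod_cast card_endPositions_le B n
      gcongr
    have h3 : ν.real (d.runSet n) ≤ 1 := measureReal_le_one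
    have h4 : (0 : ℝ) ≤ (c + e + 2 * B) / d.q n := by positivity
    nlinarith

theorem tendsto_inv_l (hsum : Summable fun n => 1 / (d.l n : ℝ)) :
    Tendsto (fun n => 1 / (d.l n : ℝ)) atTop (𝓝 0) := hsum.tendsto_atTop_zero

/-- Both measures obey the bounds of stage n + 1 with the same count c, up to errors that tend to 0.
One inequality suffices by symmetry. -/
theorem measure_pattern_le (hl : ∀ n, 2 ≤ d.l n) (hsum : Summable fun n => 1 / (d.l n : ℝ))
    (hR2 : d.R2) (hR3 : d.R3)
    (hocc : ∀ n, ∀ w ∈ d.words n, ∀ w' ∈ d.words (n + 1), w <:+: w')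
    {ν ν' : Measure (ℤ → Letter (Fin (d.s 0)))}
    (hν : IsNonatomicInvariant (symbolicShift d.words) ν)
    (hν' : IsNonatomicInvariant (symbolicShift d.words) ν') (I : Finset ℤ)
    (v : ℤ → Letter (Fin (d.s 0))) :
    ν.real {z | ∀ i ∈ I, z i = v i} ≤ ν'.real {z | ∀ i ∈ I, z i = v i} := by
  have := hν.prob
  have := hν'.prob
  obtain ⟨B, hB⟩ : ∃ B : ℕ, ∀ i ∈ I, |i| ≤ B := by
    refine ⟨I.sup Int.natAbs, fun i hi => ?_⟩
    rw [Int.abs_eq_natAbs]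
    exact_mod_cast Finset.le_sup (f := Int.natAbs) hi
  have hr : ∀ {ν : Measure (ℤ → Letter (Fin (d.s 0)))},
      IsNonatomicInvariant (symbolicShift d.words) ν →
        Tendsto (fun n => ν.real (d.runSet (n + 1))ᶜ) atTop (𝓝 0) := by
    intro ν hν
    have := (ENNReal.tendsto_toReal ENNReal.zero_ne_top).comp
      (tendsto_measure_compl_runSet hl hocc hν)
    exact this.comp (tendsto_add_atTop_nat 1)
  have hinvq : Tendsto (fun n => 1 / (d.q n : ℝ)) atTop (𝓝 0) :=
    summable_inv_q.tendsto_atTop_zero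
  -- The terms account for the spacers, the ends of the copies of stage n, the ends of the words of
  -- stage n + 1, and the mass outside the runs for each measure.
  have herr : Tendsto (fun n => 1 / (d.l n : ℝ) + 2 * B * (1 / (d.q n : ℝ)) +
      2 * B * (1 / (d.q (n + 1) : ℝ)) + ν.real (d.runSet (n + 1))ᶜ +
      ν'.real (d.runSet (n + 1))ᶜ) atTop (𝓝 (0 + 2 * B * 0 + 2 * B * 0 + 0 + 0)) :=
    ((((tendsto_inv_l hsum).add (hinvq.const_mul _)).add
      ((hinvq.comp (tendsto_add_atTop_nat 1)).const_mul _)).add (hr hν)).add (hr hν')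
  have hlim := herr.const_add (ν'.real {z | ∀ i ∈ I, z i = v i})
  simp only [mul_zero, add_zero] at hlim
  refine ge_of_tendsto' hlim fun n => ?_
  obtain ⟨c, hc⟩ := card_patternPositions_succ hR2 I v hB n
  obtain ⟨-, h1⟩ := measureReal_pattern_bounds hl hR3 hν.invariant I v hB hc
  obtain ⟨h2, -⟩ := measureReal_pattern_bounds hl hR3 hν'.invariant I v hB hc
  have hq : (0 : ℝ) < d.q n := by exact_mod_cast d.q_pos n
  have hk : (0 : ℝ) < d.k n := by exact_mod_cast d.k_pos n
  have hl0 : (0 : ℝ) < d.l n := by exact_mod_cast d.l_pos n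
  have hq1 : (0 : ℝ) < d.q (n + 1) := by exact_mod_cast d.q_pos (n + 1)
  have hcq : (c : ℝ) / d.q (n + 1) ≤ 1 := by
    rw [div_le_one hq1]
    have h3 := (hc ⟨0, d.s_pos _⟩).1.trans (Finset.card_filter_le _ _)
    rw [Finset.card_range] at h3
    exact_mod_cast h3
  have he : ((d.q n * d.k n * d.q n + d.q n * d.k n * (d.l n - 1) * (2 * B) : ℕ) : ℝ) /
      d.q (n + 1) ≤ 1 / d.l n + 2 * B * (1 / d.q n) := by
    have hle : ((d.l n - 1 : ℕ) : ℝ) ≤ d.l n := by exact_mod_cast Nat.sub_le _ _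
    rw [div_le_iff₀ hq1, d.q_succ]
    push_cast
    have e1 : (1 / (d.l n : ℝ) + 2 * B * (1 / d.q n)) * (d.q n * d.k n * (d.l n * d.q n)) =
        d.q n * d.k n * d.q n + d.q n * d.k n * d.l n * (2 * B) := by
      field_simp
    rw [e1]
    gcongr
  have hcompl : ν'.real (d.runSet (n + 1)) = 1 - ν'.real (d.runSet (n + 1))ᶜ := by
    rw [probReal_compl_eq_one_sub (measurableSet_runSet _)]
    ring
  rw [hcompl] at h2
  have hnn : 0 ≤ ν'.real (d.runSet (n + 1))ᶜ := measureReal_nonneg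
  rw [add_div, add_div] at h1
  have e2 : (2 : ℝ) * B / d.q (n + 1) = 2 * B * (1 / d.q (n + 1)) := by ring
  rw [e2] at h1
  nlinarith

/-- The alphabet is countable, so measures of finite patterns give the finite-dimensional
distributions, and these determine a finite measure on the product. -/
theorem eq_of_isNonatomicInvariant (hl : ∀ n, 2 ≤ d.l n)
    (hsum : Summable fun n => 1 / (d.l n : ℝ)) (hR2 : d.R2) (hR3 : d.R3)
    (hocc : ∀ n, ∀ w ∈ d.words n, ∀ w' ∈ d.words (n + 1), w <:+: w')
    {ν ν' : Measure (ℤ → Letter (Fin (d.s 0)))}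
    (hν : IsNonatomicInvariant (symbolicShift d.words) ν)
    (hν' : IsNonatomicInvariant (symbolicShift d.words) ν') : ν = ν' := by
  have := hν.prob
  have := hν'.prob
  have hpat : ∀ (I : Finset ℤ) (v : ℤ → Letter (Fin (d.s 0))),
      ν {z | ∀ i ∈ I, z i = v i} = ν' {z | ∀ i ∈ I, z i = v i} := by
    intro I v
    rw [← measureReal_eq_measureReal_iff]
    exact le_antisymm (measure_pattern_le hl hsum hR2 hR3 hocc hν hν' I v)
      (measure_pattern_le hl hsum hR2 hR3 hocc hν' hν I v)
  refine IsProjectiveLimit.unique (P := fun I => ν.map I.restrict) (fun I => rfl) fun I => ?_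
  have hm : Measurable (I.restrict (π := fun _ : ℤ => Letter (Fin (d.s 0)))) := by fun_prop
  refine Measure.ext_of_singleton fun w => ?_
  rw [Measure.map_apply hm (measurableSet_singleton w), Measure.map_apply hm (measurableSet_singleton w)]
  have hset : I.restrict (π := fun _ : ℤ => Letter (Fin (d.s 0))) ⁻¹' {w} =
      {z | ∀ i ∈ I, z i = if h : i ∈ I then w ⟨i, h⟩ else Letter.b} := by
    ext z
    simp only [Set.mem_preimage, Set.mem_singleton_iff, funext_iff, Set.mem_ofPred_eq]
    constructor
    · intro h i hi
      rw [dif_pos hi, ← h ⟨i, hi⟩]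
      rfl
    · rintro h ⟨i, hi⟩
      have := h i hi
      rwa [dif_pos hi] at this
  rw [hset]
  exact (hpat I _).symm

end AbC


/-! ### Measurability of the names -/

namespace AbC

variable {d : AbC}

theorem mem_newB_iff_spacerPattern {n : ℕ} {z : Sq} :
    z ∈ d.newB n ↔ (d.spacerPattern n)[d.level (n + 1) z]? = some Letter.b := by
  rw [newB, Equiv.image_eq_preimage_symm]
  rfl

theorem mem_newE_iff_spacerPattern {n : ℕ} {z : Sq} :
    z ∈ d.newE n ↔ (d.spacerPattern n)[d.level (n + 1) z]? = some Letter.e := by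
  rw [newE, Equiv.image_eq_preimage_symm]
  rfl

theorem measurableSet_newB (hR1 : d.R1) (n : ℕ) : MeasurableSet (d.newB n) := by
  have : d.newB n =
      d.level (n + 1) ⁻¹' {J | (d.spacerPattern n)[J]? = some Letter.b} :=
    Set.ext fun _ => mem_newB_iff_spacerPattern
  rw [this]
  exact measurable_level hR1 (n + 1) (.of_discrete)

theorem measurableSet_newE (hR1 : d.R1) (n : ℕ) : MeasurableSet (d.newE n) := by
  have : d.newE n =
      d.level (n + 1) ⁻¹' {J | (d.spacerPattern n)[J]? = some Letter.e} :=
    Set.ext fun _ => mem_newE_iff_spacerPattern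
  rw [this]
  exact measurable_level hR1 (n + 1) (.of_discrete)

theorem measurable_partitionLabel (hR1 : d.R1) : Measurable d.partitionLabel := by
  have hlater : ∀ n, MeasurableSet {z | ∀ m, n < m → z ∉ d.newB m ∪ d.newE m} := by
    intro n
    simp only [Set.ofPred_forall]
    exact MeasurableSet.iInter fun m => MeasurableSet.iInter fun _ =>
      ((measurableSet_newB hR1 m).union (measurableSet_newE hR1 m)).compl
  have hB : MeasurableSet d.setB := by
    have : d.setB = ⋃ n, d.newB n ∩ {z | ∀ m, n < m → z ∉ d.newB m ∪ d.newE m} := by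
      ext z
      simp [setB]
    rw [this]
    exact MeasurableSet.iUnion fun n => (measurableSet_newB hR1 n).inter (hlater n)
  have hE : MeasurableSet d.setE := by
    have : d.setE = ⋃ n, d.newE n ∩ {z | ∀ m, n < m → z ∉ d.newB m ∪ d.newE m} := by
      ext z
      simp [setE]
    rw [this]
    exact MeasurableSet.iUnion fun n => (measurableSet_newE hR1 n).inter (hlater n)
  have hsym : Measurable fun z : Sq => (Letter.sym (d.tower 0 z) : Letter (Fin (d.s 0))) :=
    (Measurable.of_discrete (f := (Letter.sym : Fin (d.s 0) → _))).comp (measurable_tower hR1 0)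
  classical
  exact Measurable.ite hB measurable_const (Measurable.ite hE measurable_const hsym)

section

variable {M : Type*} {κ : M → Sq}

theorem name_apply (T : Equiv.Perm M) (x : M) :
    d.name κ T (T x) = shiftMap _ (d.name κ T x) := by
  funext i
  rw [shiftMap, name, name, zpow_add_one, Equiv.Perm.mul_apply]

/-- Points that are good from some stage on are determined by their names. -/
theorem coordinates_eq_of_name_eq (hl : ∀ n, 2 ≤ d.l n) (hR1 : d.R1) (hR3 : d.R3)
    {T : Equiv.Perm M} {x y : M} (hx : ∃ n, d.Good κ T n x) (hy : ∃ n, d.Good κ T n y)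
    (h : d.name κ T x = d.name κ T y) : κ x = κ y := by
  obtain ⟨n, hx⟩ := hx
  obtain ⟨m, hy⟩ := hy
  refine eq_of_levelTower_eq hR1 (eventually_atTop.mpr ⟨max n m, fun N hN => ?_⟩)
  exact levelTower_eq_of_name_eq hl hR1 hR3 (hx.mono (le_of_max_le_left hN))
    (hy.mono (le_of_max_le_right hN)) h

end

variable {M : Type*} [MeasurableSpace M] {μ : Measure M} {κ : M → Sq}

theorem measurable_name (hR1 : d.R1) (hκ : Measurable κ) {T : M ≃ᵐ M}
    (hT : MeasurePreserving T μ μ) : Measurable (d.name κ T.toEquiv) :=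
  measurable_pi_lambda _ fun i => (measurable_partitionLabel hR1).comp
    (hκ.comp (MeasurableEquiv.measurePreserving_zpow hT i).measurable)

/-- The name map is injective on a measurable set of full measure, where its values lie in the
symbolic shift. -/
theorem exists_injOn_name (hl : ∀ n, 2 ≤ d.l n) (hsum : Summable fun n => 1 / (d.l n : ℝ))
    (hR1 : d.R1) (hR3 : d.R3) (hκ : IsCoordinates μ κ) (T : M ≃ᵐ M)
    (hT : MeasurePreserving T μ μ) (hlim : IsWeakLimit μ κ d.T T) :
    ∃ M₀ : Set M, MeasurableSet M₀ ∧ μ M₀ᶜ = 0 ∧ Set.InjOn (d.name κ T.toEquiv) M₀ ∧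
      ∀ x ∈ M₀, d.name κ T.toEquiv x ∈ symbolicShift d.words := by
  obtain ⟨M₁, hM₁, hM₁', hinj⟩ := hκ.injOn
  obtain ⟨N, hN, hNm, hN0⟩ := exists_measurable_superset_of_null
    (ae_iff.mp (ae_good hsum hR1 hκ.measurePreserving T hT hlim))
  have hgood : ∀ x ∈ M₁ ∩ Nᶜ, ∃ n, d.Good κ T.toEquiv n x := fun x hx => by
    by_contra h
    exact hx.2 (hN h)
  refine ⟨M₁ ∩ Nᶜ, hM₁.inter hNm.compl, ?_, fun x hx y hy h => ?_, fun x hx => ?_⟩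
  · rw [Set.compl_inter, compl_compl]
    exact measure_union_null hM₁' hN0
  · exact hinj hx.1 hy.1 (coordinates_eq_of_name_eq hl hR1 hR3 (hgood x hx) (hgood y hy) h)
  · exact name_mem_symbolicShift hR1 (hgood x hx)

end AbC

/-! ### The isomorphism -/

theorem lebSq_singleton (z : Sq) : lebSq {z} = 0 := by
  obtain ⟨x, y⟩ := z
  have h : (volume : Measure ℝ).comap (Subtype.val : I01 → ℝ) {x} = 0 := by
    rw [Measure.comap_apply _ Subtype.val_injective
      (fun s hs => measurableSet_Ico.subtype_image hs) _ (measurableSet_singleton x),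
      Set.image_singleton]
    exact Real.volume_singleton
  rw [← Set.singleton_prod_singleton, lebSq, Measure.prod_prod, h, zero_mul]

theorem IsCoordinates.measure_singleton {M : Type*} [MeasurableSpace M] {μ : Measure M}
    {κ : M → Sq} (hκ : IsCoordinates μ κ) (x : M) : μ {x} = 0 := by
  refine measure_mono_null (t := κ ⁻¹' {κ x}) (by simp) ?_
  rw [hκ.measurePreserving.measure_preimage (measurableSet_singleton _).nullMeasurableSet]
  exact lebSq_singleton _

/-- An equivariant measurable map that is injective on a set of full measure is an isomorphism onto
its image measure. -/
theorem isSystemIsomorphism_map {X Y : Type*} [MeasurableSpace X] [StandardBorelSpace X]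
    [MeasurableSpace Y] [MeasurableSpace.CountablySeparated Y] {f : X → Y} (hf : Measurable f)
    {μ : Measure X} {T : X → X} (hT : MeasurePreserving T μ μ) {S : Y → Y}
    (hequi : ∀ x, f (T x) = S (f x)) {M₀ : Set X} (hM₀ : MeasurableSet M₀) (hM₀' : μ M₀ᶜ = 0)
    (hinj : Set.InjOn f M₀) : IsSystemIsomorphism f μ T (μ.map f) S := by
  -- The isomorphism needs a forward invariant domain; this part of M₀ is one and still has full
  -- measure.
  let X₀ : Set X := ⋂ n : ℕ, T^[n] ⁻¹' M₀
  have hX₀ : MeasurableSet X₀ := MeasurableSet.iInter fun n => (hT.iterate n).measurable hM₀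
  have hX₀' : μ X₀ᶜ = 0 := by
    rw [Set.compl_iInter]
    refine measure_iUnion_null fun n => ?_
    rw [← Set.preimage_compl, (hT.iterate n).measure_preimage hM₀.compl.nullMeasurableSet, hM₀']
  have hsub : X₀ ⊆ M₀ := Set.iInter_subset (fun n : ℕ => T^[n] ⁻¹' M₀) 0
  have := hX₀.standardBorel
  -- The Lusin–Souslin theorem: an injective measurable map on a standard Borel space has a
  -- measurable inverse on its measurable range.
  have hemb : MeasurableEmbedding (X₀.domRestrict f) :=
    (hf.comp measurable_subtype_coe).measurableEmbedding
      (Set.injOn_iff_injective.mp (hinj.mono hsub))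
  have hg : ∀ x : X₀, hemb.equivRange x = ⟨f x, x, rfl⟩ := hemb.equivRange_apply
  have hfX₀ : X₀ ⊆ f ⁻¹' Set.range (X₀.domRestrict f) := fun x hx => ⟨⟨x, hx⟩, rfl⟩
  refine ⟨X₀, Set.range (X₀.domRestrict f), hX₀, hemb.measurableSet_range, hX₀', ?_,
    fun x hx => ⟨?_, hequi x⟩, hemb.equivRange, fun x => ?_, hemb.equivRange.measurable, ?_⟩
  · rw [Measure.map_apply hf hemb.measurableSet_range.compl]
    exact measure_mono_null (Set.compl_subset_compl.mpr hfX₀) hX₀'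
  · refine Set.mem_iInter.mpr fun n => ?_
    have := Set.mem_iInter.mp hx (n + 1)
    rwa [Set.mem_preimage, Function.iterate_succ_apply] at this
  · exact congrArg Subtype.val (hg x)
  · ext A hA
    have hA' : MeasurableSet (Subtype.val '' A : Set Y) := hemb.measurableSet_range.subtype_image hA
    rw [Measure.map_apply hemb.equivRange.measurable hA,
      comap_subtype_coe_apply hX₀, comap_subtype_coe_apply hemb.measurableSet_range,
      Measure.map_apply hf hA', ← measure_inter_conull (s := f ⁻¹' (Subtype.val '' A)) hX₀']
    congr 1
    ext x
    constructor
    · rintro ⟨x, hx, rfl⟩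
      exact ⟨⟨_, hx, congrArg Subtype.val (hg x)⟩, x.2⟩
    · rintro ⟨⟨y, hy, hyx⟩, hx⟩
      refine ⟨⟨x, hx⟩, ?_, rfl⟩
      rwa [Set.mem_preimage, hg, ← show y = ⟨f x, ⟨x, hx⟩, rfl⟩ from Subtype.ext hyx]

namespace AbC

variable {d : AbC} {M : Type*} [MeasurableSpace M] {μ : Measure M} {κ : M → Sq}

/-- Equivariance gives invariance, and injectivity transports the absence of atoms. For
concentration the measurable image of M₀ is used, so measurability of the symbolic shift plays no
role. -/
theorem isNonatomicInvariant_map_name [IsProbabilityMeasure μ] [StandardBorelSpace M]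
    (hR1 : d.R1) (hκ : IsCoordinates μ κ)
    {T : M ≃ᵐ M} (hT : MeasurePreserving T μ μ) {M₀ : Set M} (hM₀ : MeasurableSet M₀)
    (hM₀' : μ M₀ᶜ = 0) (hinj : Set.InjOn (d.name κ T.toEquiv) M₀)
    (hmem : ∀ x ∈ M₀, d.name κ T.toEquiv x ∈ symbolicShift d.words) :
    IsNonatomicInvariant (symbolicShift d.words) (μ.map (d.name κ T.toEquiv)) where
  prob := Measure.isProbabilityMeasure_map
    (measurable_name hR1 hκ.measurePreserving.measurable hT).aemeasurable
  concentrated := by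
    have hφ := measurable_name hR1 hκ.measurePreserving.measurable hT
    have him : MeasurableSet (d.name κ T.toEquiv '' M₀) := hM₀.image_of_measurable_injOn hφ hinj
    refine measure_mono_null (t := (d.name κ T.toEquiv '' M₀)ᶜ) ?_ ?_
    · exact Set.compl_subset_compl.mpr (Set.image_subset_iff.mpr hmem)
    · rw [Measure.map_apply hφ him.compl]
      exact measure_mono_null (fun x hx hx' => hx ⟨x, hx', rfl⟩) hM₀'
  noAtoms y := by
    rw [Measure.map_apply (measurable_name hR1 hκ.measurePreserving.measurable hT)
      (measurableSet_singleton y)]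
    have hsub : (d.name κ T.toEquiv ⁻¹' {y} ∩ M₀).Subsingleton := fun x hx x' hx' =>
      hinj hx.2 hx'.2 (hx.1.trans hx'.1.symm)
    have h0 : μ (d.name κ T.toEquiv ⁻¹' {y} ∩ M₀) = 0 := by
      obtain h | ⟨x, h⟩ := hsub.eq_empty_or_singleton
      · rw [h, measure_empty]
      · rw [h, hκ.measure_singleton]
    rwa [measure_inter_conull hM₀'] at h0
  invariant := by
    have hφ := measurable_name hR1 hκ.measurePreserving.measurable hT
    refine ⟨measurable_shiftMap _, ?_⟩
    have hcomp : shiftMap _ ∘ d.name κ T.toEquiv = d.name κ T.toEquiv ∘ T :=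
      funext fun x => (name_apply T.toEquiv x).symm
    rw [Measure.map_map (measurable_shiftMap _) hφ, hcomp, ← Measure.map_map hφ hT.measurable,
      hT.map_eq]

end AbC



/-! ### Assembly of the assertions. -/

theorem proposition39 (d : AbC)
    (hl : ∀ n, 2 ≤ d.l n) (hsum : Summable fun n => 1 / (d.l n : ℝ))
    (hC : ∀ n, d.s n ^ 2 ∣ d.C n)
    (hR1 : d.R1) (hR2 : d.R2) (hR3 : d.R3)
    {M : Type*} [MeasurableSpace M] [StandardBorelSpace M]
    (μ : Measure M) [IsProbabilityMeasure μ]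
    (κ : M → Sq) (hκ : IsCoordinates μ κ)
    (T : M ≃ᵐ M) (hT : MeasurePreserving T μ μ) (hlim : IsWeakLimit μ κ d.T T) :
    -- the words form a strongly uniform construction sequence built by the twisting operators
    (∃ ε : ℕ → ℝ, IsConstructionSequence d.words d.q ε ∧ IsStronglyUniformParsed d.words ε) ∧
    d.IsBuiltFrom d.words d.preWords ∧
    -- the strong readability assumption holds exactly if it holds for the row sequences
    (d.IsTwisted d.words ↔ ∀ n, UniquelyReadable (d.rowWords n)) ∧
    (d.IsTwisted d.words → IsStronglyUniform d.words) ∧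
    -- the words are the names of the towers: for almost every `x` and all large `n`, if `x` lies in
    -- level `i` of the `t`-th tower, then the name of `x` reads `word n t` along `[-i, q n - i)`
    (∀ᵐ x ∂μ, ∀ᶠ n in atTop, ∀ (t : Fin (d.s n)) (i : ℕ), i < d.q n →
      κ x ∈ (d.T n ^ i) '' d.towerBase n t →
      ∀ m : ℕ, m < d.q n →
        (d.word n t)[m]? = some (d.name κ T.toEquiv x ((m : ℤ) - (i : ℤ)))) ∧
    -- almost every name lies in the symbolic shift, and the name map is almost everywhere injective
    (∀ᵐ x ∂μ, d.name κ T.toEquiv x ∈ symbolicShift d.words) ∧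
    (∃ M₀ : Set M, MeasurableSet M₀ ∧ μ M₀ᶜ = 0 ∧ Set.InjOn (d.name κ T.toEquiv) M₀) ∧
    -- the unique non-atomic invariant measure, and the isomorphism
    ∃ ν : Measure (ℤ → Letter (Fin (d.s 0))),
      IsNonatomicInvariant (symbolicShift d.words) ν ∧
      (∀ ν' : Measure (ℤ → Letter (Fin (d.s 0))),
        IsNonatomicInvariant (symbolicShift d.words) ν' → ν' = ν) ∧
      ν (Set.range (d.name κ T.toEquiv))ᶜ = 0 ∧
      IsSystemIsomorphism (d.name κ T.toEquiv) μ T ν (shiftMap (Letter (Fin (d.s 0)))) := by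
  have hφ := AbC.measurable_name (d := d) hR1 hκ.measurePreserving.measurable hT
  have hseq := AbC.isConstructionSequence hl hsum hC hR2 hR3
  obtain ⟨M₀, hM₀, hM₀', hinj, hmem⟩ := AbC.exists_injOn_name hl hsum hR1 hR3 hκ T hT hlim
  have hν := AbC.isNonatomicInvariant_map_name hR1 hκ hT hM₀ hM₀' hinj hmem
  refine ⟨⟨d.eps, hseq, AbC.isStronglyUniformParsed hl hC hR2 hR3⟩, AbC.isBuiltFrom_preWords,
    AbC.isTwisted_iff hl hsum hC hR2 hR3,
    fun h => AbC.isStronglyUniform hl hC hR2 hR3 ((AbC.isTwisted_iff hl hsum hC hR2 hR3).mp h),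
    ?_, ?_, ⟨M₀, hM₀, hM₀', hinj⟩, _, hν,
    fun ν' hν' => AbC.eq_of_isNonatomicInvariant hl hsum hR2 hR3 hseq.occurs hν' hν, ?_,
    isSystemIsomorphism_map hφ hT (AbC.name_apply T.toEquiv) hM₀ hM₀' hinj⟩
  · filter_upwards [AbC.ae_good hsum hR1 hκ.measurePreserving T hT hlim] with x ⟨n₀, hx⟩
    refine eventually_atTop.mpr ⟨n₀, fun n hn t i hi hxi m hm => ?_⟩
    obtain ⟨hlev, htow⟩ := d.level_tower_of_mem_tower hi hxi
    rw [d.getElem?_word t hm, (hx.mono hn).name_eq hR1 (J := m) (by rw [hlev]; ring) hm, htow]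
  · filter_upwards [AbC.ae_good hsum hR1 hκ.measurePreserving T hT hlim] with x hx
    exact AbC.name_mem_symbolicShift hR1 hx
  · have him := hM₀.image_of_measurable_injOn hφ hinj
    refine measure_mono_null (Set.compl_subset_compl.mpr (Set.image_subset_range _ M₀)) ?_
    rw [Measure.map_apply hφ him.compl]
    exact measure_mono_null (fun x hx hx' => hx ⟨x, hx', rfl⟩) hM₀'
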